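/- **Conventions.** $G$ is a (Hausdorff) locally compact group with left Haar measure $dg$ and modular function $\Delta_G$; $\lambda,\rho$ are the left and right regular representations on $L^2(G)$, $(\lambda(g)\xi)(h)=\xi(g^{-1}h)$, $(\rho(g)\xi)(h)=\Delta_G(g)^{1/2}\xi(hg)$, and $u_g=\lambda(g)\rho(g)$. $\mathcal L(G)=\lambda(G)''$ carries the coproduct $\hat\Gamma(\lambda(g))=\lambda(g)\otimes\lambda(g)$, and $L^\infty(G)\subset B(L^2(G))$ carries the coproduct $\Gamma(f)(g,h)=f(gh)$. Tensor products of von Neumann algebras are von Neumann tensor products; $\imath$ denotes identity maps and $\sigma$ flips. The dual $\widehat{\mathcal D(G)}$ of the quantum double is the von Neumann algebra $\mathcal L(G)\otimes L^\infty(G)$ with the coproduct $$\hat{\tilde\Gamma}(x)=R\,(1\otimes\sigma\otimes 1)\,(\hat\Gamma\otimes\Gamma)(x)\,(1\otimes\sigma\otimes 1)\,R^*,$$ where $R$ is the unitary $(R\xi)(g,h)=(u_h\otimes 1)\,\xi(g,h)$ on $L^2(G)^{\otimes 4}\cong L^2(G\times G,\,L^2(G)\otimes L^2(G))$, the variables $g,h$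 belonging to the second and fourth tensor factors. (The coproduct is the only part of the Kac algebra structure that enters the notion of a coaction.) A coaction on a von Neumann algebra $A$ of a von Neumann algebra $N$ with coproduct $\Gamma_N$ is a normal unital $*$-homomorphism $\delta:A\to A\otimes N$ with $(\delta\otimes\imath)\circ\delta=(\imath\otimes\Gamma_N)\circ\delta$; its fixpoint algebra is $A^\delta=\{x\in A:\delta(x)=x\otimes 1\}$. A coaction of $G$ is a coaction of $(\mathcal L(G),\hat\Gamma)$. **Theorem.** Let $A$ be a von Neumann algebra with an action $\alpha$ of $G$ by $*$-automorphisms such that $g\mapsto\alpha_g(x)$ is weakly continuous for every $x\in A$, and with a coaction $\delta:A\to A\otimes\mathcal L(G)$ of $G$ such that $$\delta\circ\alpha_g=(\alpha_g\otimes\mathrm{Ad}\,\lambda(g))\circ\delta\qquad(g\in G).$$ Write $\alpha$ also for the homomorphism $A\to A\otimes L^\infty(G)$ that maps $x$ to the function $g\mapsto\alpha_g(x)$, and let $$\Delta=(\imath_A\otimes\sigma)\circ(\alpha\otimes\imath_{\mathcal L(G)})\circ\delta:\ A\to A\otimes\mathcal L(G)\otimes L^\infty(G)=A\otimes\widehat{\mathcal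 D(G)} .$$ Then $\Delta$ is a coaction of $\widehat{\mathcal D(G)}$ on $A$: it is a normal unital $*$-homomorphism into $A\otimes\widehat{\mathcal D(G)}$ with $$(\Delta\otimes\imath)\circ\Delta=(\imath_A\otimes\hat{\tilde\Gamma})\circ\Delta ,$$ and it is injective if $\delta$ is. Moreover $A^\Delta=A^\alpha\cap A^\delta$, where $A^\alpha=\{x\in A:\alpha(x)=x\otimes 1\}=\{x\in A:\alpha_g(x)=x\ \text{for all }g\in G\}$. -/

import Mathlib

open scoped InnerProductSpace TensorProduct
open MeasureTheory

namespace DualDouble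

set_option linter.unusedSectionVars false

noncomputable section

/-! ### Hilbert space tensor products -/

/-- The Hilbert space tensor product: the completion of the algebraic tensor product. -/
def HTensor (H K : Type*) [NormedAddCommGroup H] [InnerProductSpace ℂ H]
    [NormedAddCommGroup K] [InnerProductSpace ℂ K] : Type _ :=
  UniformSpace.Completion (H ⊗[ℂ] K)

infixl:70 " ⊗ʰ " => HTensor

section Hilbert

variable {H K L H' K' : Type*}
  [NormedAddCommGroup H] [InnerProductSpace ℂ H]
  [NormedAddCommGroup K] [InnerProductSpace ℂ K]
  [NormedAddCommGroup L] [InnerProductSpace ℂ L]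
  [NormedAddCommGroup H'] [InnerProductSpace ℂ H']
  [NormedAddCommGroup K'] [InnerProductSpace ℂ K']

instance : NormedAddCommGroup (H ⊗ʰ K) :=
  inferInstanceAs (NormedAddCommGroup (UniformSpace.Completion (H ⊗[ℂ] K)))

instance : InnerProductSpace ℂ (H ⊗ʰ K) :=
  inferInstanceAs (InnerProductSpace ℂ (UniformSpace.Completion (H ⊗[ℂ] K)))

instance : CompleteSpace (H ⊗ʰ K) :=
  inferInstanceAs (CompleteSpace (UniformSpace.Completion (H ⊗[ℂ] K)))

/-- The canonical isometric embedding of the algebraic into the Hilbert space tensor product. -/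
def incl (H K : Type*) [NormedAddCommGroup H] [InnerProductSpace ℂ H]
    [NormedAddCommGroup K] [InnerProductSpace ℂ K] : H ⊗[ℂ] K →ₗᵢ[ℂ] H ⊗ʰ K :=
  (UniformSpace.Completion.toComplₗᵢ :
    H ⊗[ℂ] K →ₗᵢ[ℂ] UniformSpace.Completion (H ⊗[ℂ] K))

/-- The continuous extension of a bounded operator on the algebraic tensor product. -/
def extend [CompleteSpace L] (T : H ⊗[ℂ] K →L[ℂ] L) : H ⊗ʰ K →L[ℂ] L :=
  (T.fromCompletion : UniformSpace.Completion (H ⊗[ℂ] K) →L[ℂ] L)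

theorem extend_incl [CompleteSpace L] (T : H ⊗[ℂ] K →L[ℂ] L) (v : H ⊗[ℂ] K) :
    extend T (incl H K v) = T v :=
  ContinuousLinearMap.fromCompletion_apply_coe T v

/-- The elementary tensor `x ⊗ y` in the Hilbert space tensor product. -/
def tmul (x : H) (y : K) : H ⊗ʰ K := incl H K (x ⊗ₜ[ℂ] y)

/-- The tensor product `S ⊗ T` of bounded operators, `(S ⊗ T) (x ⊗ y) = S x ⊗ T y`. -/
def opTensor (S : H →L[ℂ] H') (T : K →L[ℂ] K') : H ⊗ʰ K →L[ℂ] H' ⊗ʰ K' :=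
  extend ((incl H' K').toContinuousLinearMap ∘L TensorProduct.mapL S T)

theorem opTensor_tmul (S : H →L[ℂ] H') (T : K →L[ℂ] K') (x : H) (y : K) :
    opTensor S T (tmul x y) = tmul (S x) (T y) :=
  extend_incl _ _

/-- The operator `x ↦ x ⊗ η`. -/
def tmulRight (η : K) : H →L[ℂ] H ⊗ʰ K :=
  (incl H K).toContinuousLinearMap ∘L (TensorProduct.mkL ℂ H K).flip η

theorem tmulRight_apply (x : H) (η : K) : tmulRight η x = tmul x η :=
  rfl

/-- The flip `x ⊗ y ↦ y ⊗ x`, a unitary operator. -/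
def flip (H K : Type*) [NormedAddCommGroup H] [InnerProductSpace ℂ H]
    [NormedAddCommGroup K] [InnerProductSpace ℂ K] : H ⊗ʰ K →L[ℂ] K ⊗ʰ H :=
  extend ((incl K H).comp
    (TensorProduct.commIsometry ℂ H K).toLinearIsometry).toContinuousLinearMap

theorem flip_tmul (x : H) (y : K) : flip H K (tmul x y) = tmul y x :=
  extend_incl _ _

theorem tmul_induction (p : H ⊗ʰ K → Prop) (w : H ⊗ʰ K) (hc : IsClosed {w | p w})
    (h0 : p 0) (ht : ∀ x y, p (tmul x y)) (ha : ∀ v w, p v → p w → p (v + w)) : p w := by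
  have key : ∀ v : H ⊗[ℂ] K, p (incl H K v) := by
    intro v
    induction v using TensorProduct.induction_on with
    | zero => simpa only [map_zero] using h0
    | tmul x y => exact ht x y
    | add x y hx hy => simpa only [map_add] using ha _ _ hx hy
  exact UniformSpace.Completion.induction_on (p := p) w hc key

theorem inner_tmul (x x' : H) (y y' : K) :
    ⟪(tmul x y : H ⊗ʰ K), tmul x' y'⟫_ℂ = ⟪x, x'⟫_ℂ * ⟪y, y'⟫_ℂ := by
  rw [tmul, tmul, LinearIsometry.inner_map_map, TensorProduct.inner_tmul]

theorem tmul_add (x : H) (y y' : K) : (tmul x (y + y') : H ⊗ʰ K) = tmul x y + tmul x y' := by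
  simp only [tmul, TensorProduct.tmul_add, map_add]

theorem tmul_smul (c : ℂ) (x : H) (y : K) : (tmul x (c • y) : H ⊗ʰ K) = c • tmul x y := by
  simp only [tmul, TensorProduct.tmul_smul, map_smul]

theorem assocAux_add (z z' : L) (w : H ⊗ʰ K) :
    opTensor (ContinuousLinearMap.id ℂ H) (tmulRight (z + z')) w =
      opTensor (ContinuousLinearMap.id ℂ H) (tmulRight z) w +
        opTensor (ContinuousLinearMap.id ℂ H) (tmulRight (H := K) z') w := by
  induction w using tmul_induction
  · exact isClosed_eq (by fun_prop) (by fun_prop)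
  · simp
  · rename_i x y
    simp only [opTensor_tmul, tmulRight_apply, tmul_add]
  · rename_i v w hv hw
    simp only [map_add, hv, hw]
    abel

theorem assocAux_smul (c : ℂ) (z : L) (w : H ⊗ʰ K) :
    opTensor (ContinuousLinearMap.id ℂ H) (tmulRight (c • z)) w =
      c • opTensor (ContinuousLinearMap.id ℂ H) (tmulRight (H := K) z) w := by
  induction w using tmul_induction
  · exact isClosed_eq (ContinuousLinearMap.continuous _)
      ((ContinuousLinearMap.continuous _).const_smul c)
  · rw [map_zero, map_zero, smul_zero]
  · rename_i x y
    rw [opTensor_tmul, opTensor_tmul, tmulRight_apply, tmulRight_apply, tmul_smul, tmul_smul]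
  · rename_i v w hv hw
    rw [map_add, map_add, hv, hw, smul_add]

/-- The linear map `w ⊗ z ↦ (id ⊗ (· ⊗ z)) w` underlying the associativity operator. -/
def assocAux (H K L : Type*) [NormedAddCommGroup H] [InnerProductSpace ℂ H]
    [NormedAddCommGroup K] [InnerProductSpace ℂ K]
    [NormedAddCommGroup L] [InnerProductSpace ℂ L] :
    (H ⊗ʰ K) ⊗[ℂ] L →ₗ[ℂ] H ⊗ʰ (K ⊗ʰ L) :=
  TensorProduct.lift (LinearMap.mk₂ ℂ
    (fun (w : H ⊗ʰ K) (z : L) => opTensor (ContinuousLinearMap.id ℂ H) (tmulRight z) w)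
    (fun _ _ _ => map_add _ _ _) (fun _ _ _ => map_smul _ _ _)
    (fun w z z' => assocAux_add z z' w) (fun c w z => assocAux_smul c z w))

theorem inner_assocAux_tmul (w w' : H ⊗ʰ K) (z z' : L) :
    ⟪opTensor (ContinuousLinearMap.id ℂ H) (tmulRight z) w,
      opTensor (ContinuousLinearMap.id ℂ H) (tmulRight (H := K) z') w'⟫_ℂ =
      ⟪w, w'⟫_ℂ * ⟪z, z'⟫_ℂ := by
  induction w using tmul_induction
  · exact isClosed_eq (by fun_prop) (by fun_prop)
  · simp
  · rename_i x y
    induction w' using tmul_induction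
    · exact isClosed_eq (by fun_prop) (by fun_prop)
    · simp
    · rename_i x' y'
      simp only [opTensor_tmul, tmulRight_apply, inner_tmul, ContinuousLinearMap.coe_id', id_eq]
      ring
    · rename_i v v' hv hv'
      simp only [map_add, inner_add_right, hv, hv', add_mul]
  · rename_i v v' hv hv'
    simp only [map_add, inner_add_left, hv, hv', add_mul]

theorem inner_assocAux (u v : (H ⊗ʰ K) ⊗[ℂ] L) :
    ⟪assocAux H K L u, assocAux H K L v⟫_ℂ = ⟪u, v⟫_ℂ := by
  induction u using TensorProduct.induction_on with
  | zero => simp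
  | tmul w z =>
    induction v using TensorProduct.induction_on with
    | zero => simp
    | tmul w' z' => exact inner_assocAux_tmul w w' z z'
    | add a b ha hb => simp only [map_add, inner_add_right, ha, hb]
  | add a b ha hb => simp only [map_add, inner_add_left, ha, hb]

/-- The associativity operator `(x ⊗ y) ⊗ z ↦ x ⊗ (y ⊗ z)`, a unitary operator. -/
def assoc (H K L : Type*) [NormedAddCommGroup H] [InnerProductSpace ℂ H]
    [NormedAddCommGroup K] [InnerProductSpace ℂ K]
    [NormedAddCommGroup L] [InnerProductSpace ℂ L] :
    (H ⊗ʰ K) ⊗ʰ L →L[ℂ] H ⊗ʰ (K ⊗ʰ L) :=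
  extend ((assocAux H K L).isometryOfInner inner_assocAux).toContinuousLinearMap

theorem assoc_tmul (x : H) (y : K) (z : L) :
    assoc H K L (tmul (tmul x y) z) = tmul x (tmul y z) := by
  have h : assocAux H K L ((tmul x y) ⊗ₜ z) = tmul x (tmul y z) := by
    change opTensor (ContinuousLinearMap.id ℂ H) (tmulRight z) (tmul x y) = _
    rw [opTensor_tmul, tmulRight_apply, ContinuousLinearMap.id_apply]
  rw [← h]
  exact extend_incl _ _

end Hilbert

section HilbertComplete

variable {H K L : Type*}
  [NormedAddCommGroup H] [InnerProductSpace ℂ H] [CompleteSpace H]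
  [NormedAddCommGroup K] [InnerProductSpace ℂ K] [CompleteSpace K]
  [NormedAddCommGroup L] [InnerProductSpace ℂ L] [CompleteSpace L]

/-- Conjugation `X ↦ U X U*`. -/
def conjBy (U : H →L[ℂ] K) (X : H →L[ℂ] H) : K →L[ℂ] K :=
  U ∘L X ∘L ContinuousLinearMap.adjoint U

/-- The exchange of the two middle legs,
`(w ⊗ x) ⊗ (y ⊗ z) ↦ (w ⊗ y) ⊗ (x ⊗ z)`. -/
def midSwap (K : Type*) [NormedAddCommGroup K] [InnerProductSpace ℂ K] [CompleteSpace K] :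
    (K ⊗ʰ K) ⊗ʰ (K ⊗ʰ K) →L[ℂ] (K ⊗ʰ K) ⊗ʰ (K ⊗ʰ K) :=
  ContinuousLinearMap.adjoint (assoc K K (K ⊗ʰ K)) ∘L
    opTensor (ContinuousLinearMap.id ℂ K)
      (assoc K K K ∘L opTensor (flip K K) (ContinuousLinearMap.id ℂ K) ∘L
        ContinuousLinearMap.adjoint (assoc K K K)) ∘L
    assoc K K (K ⊗ʰ K)

/-- The slice `(id ⊗ ω_{ζ,η})(X)` of an operator `X` on `H ⊗ K`, that is, the operator on `H` with
`⟪x, (id ⊗ ω_{ζ,η})(X) y⟫ = ⟪x ⊗ ζ, X (y ⊗ η)⟫`. -/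
def slice (X : H ⊗ʰ K →L[ℂ] H ⊗ʰ K) (ζ η : K) : H →L[ℂ] H :=
  ContinuousLinearMap.adjoint (tmulRight ζ) ∘L X ∘L tmulRight η

theorem inner_slice (X : H ⊗ʰ K →L[ℂ] H ⊗ʰ K) (ζ η : K) (x y : H) :
    ⟪x, slice X ζ η y⟫_ℂ = ⟪(tmul x ζ : H ⊗ʰ K), X (tmul y η)⟫_ℂ := by
  simp [slice, ContinuousLinearMap.adjoint_inner_right, tmulRight_apply]

/-! ### Von Neumann algebras and their tensor products -/

/-- The von Neumann algebra generated by a set `S` of operators (the bicommutant of `S ∪ S*`). -/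
def generated (S : Set (H →L[ℂ] H)) : VonNeumannAlgebra H where
  toStarSubalgebra := StarSubalgebra.centralizer ℂ
    (StarSubalgebra.centralizer ℂ S : Set (H →L[ℂ] H))
  centralizer_centralizer' := by
    have h : ∀ T : StarSubalgebra ℂ (H →L[ℂ] H),
        (StarSubalgebra.centralizer ℂ (T : Set (H →L[ℂ] H)) : Set (H →L[ℂ] H)) =
          Set.centralizer (T : Set (H →L[ℂ] H)) := by
      intro T
      rw [StarSubalgebra.coe_centralizer, StarMemClass.star_coe_eq, Set.union_self]
    change Set.centralizer (Set.centralizer (StarSubalgebra.centralizer ℂ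
      (StarSubalgebra.centralizer ℂ S : Set (H →L[ℂ] H)) : Set (H →L[ℂ] H))) =
        (StarSubalgebra.centralizer ℂ
          (StarSubalgebra.centralizer ℂ S : Set (H →L[ℂ] H)) : Set (H →L[ℂ] H))
    rw [h, Set.centralizer_centralizer_centralizer]

/-- The von Neumann tensor product, generated by the operators `a ⊗ b`, `a ∈ M`, `b ∈ N`. -/
def vnTensor (M : VonNeumannAlgebra H) (N : VonNeumannAlgebra K) : VonNeumannAlgebra (H ⊗ʰ K) :=
  generated {X | ∃ a ∈ M, ∃ b ∈ N, X = opTensor a b}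

end HilbertComplete

section Maps

variable {H K H' K' : Type*}
  [NormedAddCommGroup H] [InnerProductSpace ℂ H] [CompleteSpace H]
  [NormedAddCommGroup K] [InnerProductSpace ℂ K] [CompleteSpace K]
  [NormedAddCommGroup H'] [InnerProductSpace ℂ H'] [CompleteSpace H']
  [NormedAddCommGroup K'] [InnerProductSpace ℂ K'] [CompleteSpace K']

/-- Normality: if an increasing net of self-adjoint elements of `M` has supremum `s ∈ M`
(equivalently, its quadratic forms have the quadratic form of `s` as pointwise supremum), then the
image of the net has supremum `φ s` in the same sense. -/
def IsNormal (M : VonNeumannAlgebra H) (φ : M.toStarSubalgebra → (K →L[ℂ] K)) : Prop :=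
  ∀ (D : Set M.toStarSubalgebra) (s : M.toStarSubalgebra), D.Nonempty →
    (∀ x ∈ D, IsSelfAdjoint x) → IsSelfAdjoint s →
    DirectedOn (fun x y : M.toStarSubalgebra => (x : H →L[ℂ] H) ≤ (y : H →L[ℂ] H)) D →
    (∀ ξ : H, IsLUB ((fun x : M.toStarSubalgebra => (⟪ξ, (x : H →L[ℂ] H) ξ⟫_ℂ).re) '' D)
      (⟪ξ, (s : H →L[ℂ] H) ξ⟫_ℂ).re) →
    ∀ ξ : K, IsLUB ((fun x => (⟪ξ, φ x ξ⟫_ℂ).re) '' D) (⟪ξ, φ s ξ⟫_ℂ).re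

/-- `Y = (φ ⊗ id)(X)` for a map `φ` defined on `M`, expressed through slices:
`(id ⊗ ω_{ζ,η})(Y) = φ ((id ⊗ ω_{ζ,η})(X))` for all `ζ`, `η`, where the slices of `X` lie in `M`.
These equations determine `Y`, because an operator is determined by its slices. -/
def IsAmplification (M : VonNeumannAlgebra H) (φ : M.toStarSubalgebra → (H' →L[ℂ] H'))
    (X : H ⊗ʰ K →L[ℂ] H ⊗ʰ K) (Y : H' ⊗ʰ K →L[ℂ] H' ⊗ʰ K) : Prop :=
  ∀ ζ η : K, ∃ h : slice X ζ η ∈ M.toStarSubalgebra, slice Y ζ η = φ ⟨slice X ζ η, h⟩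

open Classical in
/-- `(φ ⊗ id)(X)`, for a map `φ` on `M` and an operator `X` on `H ⊗ K` all of whose slices lie in
`M` (such as an element of `M ⊗ N`). It exists whenever `φ` is a *-homomorphism, which is the only
case of interest. -/
def amplify (M : VonNeumannAlgebra H) (φ : M.toStarSubalgebra → (H' →L[ℂ] H'))
    (X : H ⊗ʰ K →L[ℂ] H ⊗ʰ K) : H' ⊗ʰ K →L[ℂ] H' ⊗ʰ K :=
  if h : ∃ Y, IsAmplification M φ X Y then h.choose else 0

/-- `(id ⊗ ψ)(X)`, for a map `ψ` on `N` and an operator `X` on `H ⊗ K`. -/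
def amplifyLeft (N : VonNeumannAlgebra K) (ψ : N.toStarSubalgebra → (K' →L[ℂ] K'))
    (X : H ⊗ʰ K →L[ℂ] H ⊗ʰ K) : H ⊗ʰ K' →L[ℂ] H ⊗ʰ K' :=
  conjBy (flip K' H) (amplify N ψ (conjBy (flip H K) X))

/-- The tensor product `(φ ⊗ ψ)(X)` of maps `φ` on `M` and `ψ` on `N`, for `X` in `M ⊗ N`. -/
def tensorMap (M : VonNeumannAlgebra H) (N : VonNeumannAlgebra K)
    (φ : M.toStarSubalgebra → (H' →L[ℂ] H')) (ψ : N.toStarSubalgebra → (K' →L[ℂ] K'))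
    (X : H ⊗ʰ K →L[ℂ] H ⊗ʰ K) : H' ⊗ʰ K' →L[ℂ] H' ⊗ʰ K' :=
  amplifyLeft N ψ (amplify M φ X)

/-- A coaction on `A` of a von Neumann algebra `N` with coproduct `Γ : N → N ⊗ N`: a normal unital
*-homomorphism `δ : A → A ⊗ N` with `(δ ⊗ id) ∘ δ = (id ⊗ Γ) ∘ δ`. -/
structure IsCoaction (A : VonNeumannAlgebra H) (N : VonNeumannAlgebra K)
    (Γ : N.toStarSubalgebra → (K ⊗ʰ K →L[ℂ] K ⊗ʰ K))
    (δ : A.toStarSubalgebra → (H ⊗ʰ K →L[ℂ] H ⊗ʰ K)) : Prop where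
  isStarAlgHom : ∃ φ : A.toStarSubalgebra →⋆ₐ[ℂ] (H ⊗ʰ K →L[ℂ] H ⊗ʰ K), ∀ x, φ x = δ x
  mem_vnTensor : ∀ x, δ x ∈ vnTensor A N
  isNormal : IsNormal A δ
  coassoc : ∀ x, conjBy (assoc H K K) (amplify A δ (δ x)) = amplifyLeft N Γ (δ x)

/-- The fixpoint set `{x ∈ A | δ x = x ⊗ 1}`. -/
def fixedPoints (A : VonNeumannAlgebra H) (δ : A.toStarSubalgebra → (H ⊗ʰ K →L[ℂ] H ⊗ʰ K)) :
    Set A.toStarSubalgebra :=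
  {x | δ x = opTensor (x : H →L[ℂ] H) (ContinuousLinearMap.id ℂ K)}

end Maps

/-! ### The Kac algebras of a locally compact group -/

section Group

variable {G : Type*} [Group G] [TopologicalSpace G] [IsTopologicalGroup G] [LocallyCompactSpace G]
  [MeasurableSpace G] [BorelSpace G] (μ : Measure G) [μ.IsHaarMeasure] [μ.Regular]
  {H : Type*} [NormedAddCommGroup H] [InnerProductSpace ℂ H] [CompleteSpace H]

/-- The Hilbert space `L²(G)` with respect to the left Haar measure `μ`. -/
abbrev L2 : Type _ := Lp ℂ 2 μ

/-- The left regular representation, `(λ(g) ξ)(h) = ξ(g⁻¹ h)`. -/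
def leftReg (g : G) : L2 μ →L[ℂ] L2 μ :=
  (Lp.compMeasurePreservingₗᵢ ℂ (fun h => g⁻¹ * h)
    (measurePreserving_mul_left μ g⁻¹)).toContinuousLinearMap

theorem map_mul_right_eq (g : G) :
    μ.map (fun h => h * g) = Measure.modularCharacterFun g • μ := by
  have : (μ.map (fun h => h * g)).Regular := Measure.Regular.map (Homeomorph.mulRight g)
  rw [Measure.modularCharacterFun_eq_haarScalarFactor μ]
  exact Measure.isMulLeftInvariant_eq_smul_of_regular _ μ

/-- The modular function of `G`, normalized by `Δ(g) ∫ f(h g) dh = ∫ f(h) dh` for the left Haar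
measure `dh`. -/
def modularFunction (g : G) : ℝ := ((Measure.modularCharacterFun g)⁻¹ : NNReal)

theorem quasiMeasurePreserving_mul_right (g : G) :
    Measure.QuasiMeasurePreserving (fun h => h * g) μ μ := by
  refine ⟨measurable_mul_const g, ?_⟩
  rw [map_mul_right_eq]
  exact Measure.smul_absolutelyContinuous

theorem memLp_mul_right (g : G) (ξ : L2 μ) : MemLp (fun h => ξ (h * g)) 2 μ := by
  refine MemLp.comp_of_map (f := fun h => h * g) ?_ (measurable_mul_const g).aemeasurable
  rw [map_mul_right_eq]
  exact (Lp.memLp ξ).smul_measure ENNReal.coe_ne_top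

theorem norm_mul_right (g : G) (ξ : L2 μ) :
    ‖((Real.sqrt (modularFunction g) : ℝ) : ℂ) • (memLp_mul_right μ g ξ).toLp‖ = ‖ξ‖ := by
  have h1 : eLpNorm (fun h => ξ (h * g)) 2 μ =
      (Measure.modularCharacterFun g : ENNReal) ^ (1 / (2 : ENNReal)).toReal *
        eLpNorm ξ 2 μ := by
    have h2 := eLpNorm_map_measure (p := 2) (f := fun h => h * g) (g := ξ) (μ := μ) (by
      rw [map_mul_right_eq]
      exact ((Lp.memLp ξ).smul_measure ENNReal.coe_ne_top).1)
      (measurable_mul_const g).aemeasurable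
    change _ = eLpNorm (ξ ∘ fun h => h * g) 2 μ at h2
    change eLpNorm (ξ ∘ fun h => h * g) 2 μ = _
    rw [← h2, map_mul_right_eq]
    exact eLpNorm_smul_measure_of_ne_top (by simp) _ _
  have hpos : 0 < (Measure.modularCharacterFun g : ℝ) := by
    exact_mod_cast Measure.modularCharacterFun_pos g
  rw [norm_smul, Lp.norm_toLp, h1, ENNReal.toReal_mul, ← ENNReal.toReal_rpow, Lp.norm_def,
    ← mul_assoc, Complex.norm_real, Real.norm_of_nonneg (Real.sqrt_nonneg _), modularFunction]
  simp only [one_div, ENNReal.toReal_inv, ENNReal.toReal_ofNat, ENNReal.coe_toReal,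
    NNReal.coe_inv, Real.sqrt_inv]
  rw [← one_div (2 : ℝ), ← Real.sqrt_eq_rpow, inv_mul_cancel₀ (Real.sqrt_pos.2 hpos).ne',
    one_mul]

theorem toLp_mul_right_add (g : G) (ξ η : L2 μ) :
    (memLp_mul_right μ g (ξ + η)).toLp =
      (memLp_mul_right μ g ξ).toLp + (memLp_mul_right μ g η).toLp := by
  rw [← MemLp.toLp_add, MemLp.toLp_eq_toLp_iff]
  exact (quasiMeasurePreserving_mul_right μ g).ae_eq_comp (Lp.coeFn_add ξ η)

theorem toLp_mul_right_smul (g : G) (c : ℂ) (ξ : L2 μ) :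
    (memLp_mul_right μ g (c • ξ)).toLp = c • (memLp_mul_right μ g ξ).toLp := by
  rw [← MemLp.toLp_const_smul, MemLp.toLp_eq_toLp_iff]
  exact (quasiMeasurePreserving_mul_right μ g).ae_eq_comp (Lp.coeFn_smul c ξ)

/-- The right regular representation, `(ρ(g) ξ)(h) = Δ(g)^{1/2} ξ(h g)`. -/
def rightReg (g : G) : L2 μ →L[ℂ] L2 μ :=
  LinearMap.mkContinuous
    { toFun := fun ξ => ((Real.sqrt (modularFunction g) : ℝ) : ℂ) • (memLp_mul_right μ g ξ).toLp
      map_add' := fun ξ η => by rw [toLp_mul_right_add, smul_add]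
      map_smul' := fun c ξ => by rw [toLp_mul_right_smul, smul_comm, RingHom.id_apply] }
    1 (fun ξ => by rw [one_mul]; exact (norm_mul_right μ g ξ).le)

/-- The unitary `u_g = λ(g) ρ(g)` implementing the adjoint action of `G` on `L^∞(G)`. -/
def adjReg (g : G) : L2 μ →L[ℂ] L2 μ := leftReg μ g ∘L rightReg μ g

/-- The group von Neumann algebra `𝓛(G)`, generated by the left regular representation. -/
def groupVN : VonNeumannAlgebra (L2 μ) := generated (Set.range (leftReg μ))

/-- The von Neumann algebra `L^∞(G)` on `L²(G)`, generated by the operators of multiplication by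
bounded measurable functions. -/
def linfVN : VonNeumannAlgebra (L2 μ) :=
  generated {T | ∃ f : G → ℂ, Measurable f ∧ (∃ C : ℝ, ∀ g, ‖f g‖ ≤ C) ∧
    ∀ ξ : L2 μ, T ξ =ᵐ[μ] fun g => f g * ξ g}

/-- `T` is the decomposable operator on `H ⊗ L²(G) = L²(G, H)` given by the operator valued
function `F`, that is, `(T ξ)(g) = F(g) ξ(g)`, expressed through matrix coefficients. -/
def IsDecomposed (F : G → (H →L[ℂ] H)) (T : H ⊗ʰ L2 μ →L[ℂ] H ⊗ʰ L2 μ) : Prop :=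
  ∀ (x y : H) (f k : L2 μ), ⟪(tmul x f : H ⊗ʰ L2 μ), T (tmul y k)⟫_ℂ =
    ∫ g, starRingEnd ℂ (f g) * k g * ⟪x, F g y⟫_ℂ ∂μ

open Classical in
/-- The decomposable operator `(T ξ)(g) = F(g) ξ(g)` on `H ⊗ L²(G) = L²(G, H)`. It exists and is
unique for every bounded weakly continuous function `F`, which is the only case of interest. -/
def decomposable (F : G → (H →L[ℂ] H)) : H ⊗ʰ L2 μ →L[ℂ] H ⊗ʰ L2 μ :=
  if h : ∃ T, IsDecomposed μ F T then h.choose else 0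

/-- The fundamental unitary on `L²(G) ⊗ L²(G)`, `(W ξ)(s, t) = ξ(s, s⁻¹ t)`. -/
def fundamentalUnitary : L2 μ ⊗ʰ L2 μ →L[ℂ] L2 μ ⊗ʰ L2 μ :=
  conjBy (flip (L2 μ) (L2 μ)) (decomposable μ (leftReg μ))

/-- The coproduct of `𝓛(G)`, `x ↦ W (x ⊗ 1) W*`; it is the one with `λ(g) ↦ λ(g) ⊗ λ(g)`. -/
def groupCoproduct (x : (groupVN μ).toStarSubalgebra) : L2 μ ⊗ʰ L2 μ →L[ℂ] L2 μ ⊗ʰ L2 μ :=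
  conjBy (fundamentalUnitary μ)
    (opTensor (x : L2 μ →L[ℂ] L2 μ) (ContinuousLinearMap.id ℂ (L2 μ)))

/-- The coproduct of `L^∞(G)`, `f ↦ W* (1 ⊗ f) W`; that is, `f` is mapped to the function
`(s, t) ↦ f(s t)`. -/
def linfCoproduct (f : (linfVN μ).toStarSubalgebra) : L2 μ ⊗ʰ L2 μ →L[ℂ] L2 μ ⊗ʰ L2 μ :=
  conjBy (ContinuousLinearMap.adjoint (fundamentalUnitary μ))
    (opTensor (ContinuousLinearMap.id ℂ (L2 μ)) (f : L2 μ →L[ℂ] L2 μ))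

/-! ### The dual of the quantum double -/

/-- The von Neumann algebra `𝓛(G) ⊗ L^∞(G)` of the dual Kac algebra of the quantum double. -/
def dualDouble : VonNeumannAlgebra (L2 μ ⊗ʰ L2 μ) := vnTensor (groupVN μ) (linfVN μ)

/-- The unitary `R` on `(L²(G) ⊗ L²(G)) ⊗ (L²(G) ⊗ L²(G))`, identified with
`L²(G × G, L²(G) ⊗ L²(G))` through the second and the fourth leg:
`(R ξ)(g, h) = (u_h ⊗ 1) ξ(g, h)`. So `u_h` acts on the first leg, where `h` is the variable of the
fourth leg. -/
def twistUnitary : (L2 μ ⊗ʰ L2 μ) ⊗ʰ (L2 μ ⊗ʰ L2 μ) →L[ℂ] (L2 μ ⊗ʰ L2 μ) ⊗ʰ (L2 μ ⊗ʰ L2 μ) :=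
  conjBy (assoc (L2 μ ⊗ʰ L2 μ) (L2 μ) (L2 μ))
    (decomposable μ fun h =>
      opTensor (opTensor (adjReg μ h) (ContinuousLinearMap.id ℂ (L2 μ)))
        (ContinuousLinearMap.id ℂ (L2 μ)))

/-- The coproduct of the dual of the quantum double,
`x ↦ R (1 ⊗ σ ⊗ 1) (Γ̂ ⊗ Γ)(x) (1 ⊗ σ ⊗ 1) R*`, where `Γ̂` and `Γ` are the coproducts of `𝓛(G)`
and `L^∞(G)`. -/
def dualDoubleCoproduct (x : (dualDouble μ).toStarSubalgebra) :
    (L2 μ ⊗ʰ L2 μ) ⊗ʰ (L2 μ ⊗ʰ L2 μ) →L[ℂ] (L2 μ ⊗ʰ L2 μ) ⊗ʰ (L2 μ ⊗ʰ L2 μ) :=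
  conjBy (twistUnitary μ) (conjBy (midSwap (L2 μ))
    (tensorMap (groupVN μ) (linfVN μ) (groupCoproduct μ) (linfCoproduct μ)
      (x : L2 μ ⊗ʰ L2 μ →L[ℂ] L2 μ ⊗ʰ L2 μ)))

/-! ### Actions of the group and the map `Δ` -/

variable (A : VonNeumannAlgebra H) (α : G →* (A.toStarSubalgebra ≃⋆ₐ[ℂ] A.toStarSubalgebra))

/-- The weak continuity required of an action `α` of `G` on `A` by automorphisms: all functions
`g ↦ ⟪ξ, α_g(x) η⟫` are continuous. -/
def IsContinuousAction : Prop :=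
  ∀ (x : A.toStarSubalgebra) (ξ η : H),
    Continuous fun g => ⟪ξ, (α g x : H →L[ℂ] H) η⟫_ℂ

/-- The action as a homomorphism `A → A ⊗ L^∞(G)`; it maps `x` to the function `g ↦ α_g(x)`. -/
def actionHom (x : A.toStarSubalgebra) : H ⊗ʰ L2 μ →L[ℂ] H ⊗ʰ L2 μ :=
  decomposable μ fun g => (α g x : H →L[ℂ] H)

/-- The map `Δ = (id ⊗ σ) ∘ (α ⊗ id) ∘ δ : A → A ⊗ (𝓛(G) ⊗ L^∞(G))`. -/
def doubleMap (δ : A.toStarSubalgebra → (H ⊗ʰ L2 μ →L[ℂ] H ⊗ʰ L2 μ)) (x : A.toStarSubalgebra) :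
    H ⊗ʰ (L2 μ ⊗ʰ L2 μ) →L[ℂ] H ⊗ʰ (L2 μ ⊗ʰ L2 μ) :=
  conjBy (opTensor (ContinuousLinearMap.id ℂ H) (flip (L2 μ) (L2 μ)))
    (conjBy (assoc H (L2 μ) (L2 μ)) (amplify A (actionHom μ A α) (δ x)))

/-- The compatibility `δ ∘ α_g = (α_g ⊗ Ad λ(g)) ∘ δ` of an action and a coaction of `G`. -/
def IsCovariant (δ : A.toStarSubalgebra → (H ⊗ʰ L2 μ →L[ℂ] H ⊗ʰ L2 μ)) : Prop :=
  ∀ (g : G) (x : A.toStarSubalgebra), δ (α g x) =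
    tensorMap A (groupVN μ) (fun a => (α g a : H →L[ℂ] H))
      (fun y => conjBy (leftReg μ g) (y : L2 μ →L[ℂ] L2 μ)) (δ x)

end Group

end

end DualDouble

/-!
The idea is to write `Δ(x)` as an operator valued function on `G`. For `g ∈ G` let
`β_g = (α_g ⊗ id) ∘ δ : A → A ⊗ 𝓛(G)` (`twist`). The covariance of `δ` says exactly that
`β_g(x) = (1 ⊗ λ(g)*) δ(α_g(x)) (1 ⊗ λ(g))` (`slice_twist`), and up to the associativity of the
tensor product `Δ(x)` is the decomposable operator on `L²(G, H ⊗ L²(G))` given by the function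
`g ↦ β_g(x)` (`doubleMap_eq`).

Each `β_g` is a normal *-homomorphism, and `g ↦ β_g(x)` is strongly continuous: `g ↦ α_g(x)` is
weakly and, as the `α_g` are *-homomorphisms, even strongly continuous, and the normal map `δ`
preserves bounded strongly continuous families (`IsNormal.isStrongCont`). So `Δ` is a
*-homomorphism (`exists_starAlgHom_decomposable`). Its values lie in `A ⊗ 𝓛(G) ⊗ L^∞(G)`, because a
decomposable operator with strongly continuous symbol is a limit of decomposable operators with
finitely valued symbols (`IsStrongCont.decomposable_mem`). Normality of `Δ`
(`isNormal_decomposable`) requires an interchange of the supremum of an increasing net, not a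
sequence, with an integral over `G`; the net of functions `g ↦ ⟪ξ, β_g(x) ξ⟫` consists of
continuous functions with a continuous pointwise supremum, so that Dini's theorem on compact sets
applies.

For the coassociativity, both sides are compared through their coefficients. The coproduct of the
dual double maps the function `g ↦ n_g`, with values in `𝓛(G)`, to the function
`(s, t) ↦ (λ(t) ⊗ 1) Γ̂(n_{st}) (λ(t) ⊗ 1)*`, where `Γ` produces the argument `s t` and `R` the
conjugation: `u_t = λ(t) ρ(t)`, and `ρ(t) ⊗ 1` commutes with the range of `Γ̂`
(`inner_doubleCoproduct`). On the other side, `β_s(α_t(x)) = (1 ⊗ λ(t)) β_{st}(x) (1 ⊗ λ(t)*)`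
(`twist_comp`), and the coassociativity of `δ` together with the multiplicativity of `Γ̂` gives the
coefficients of `β_g` at the slices of `δ(x)` (`inner_twist`). To apply `Δ` to a slice of `Δ(x)`,
which is an integral of elements `α_t(y)`, normality is used again (`IsNormal.slice_decomposable`).

A decomposable operator determines a weakly continuous symbol at every point, as Haar measure is
positive on nonempty open sets (`IsWeakCont.decomposable_injective`). So `Δ` is injective if
`β_1 = δ` is, and `Δ(x) = x ⊗ 1` means that `β_g(x) = x ⊗ 1` for all `g`, which is equivalent to
`δ(x) = x ⊗ 1` and `α_g(x) = x` for all `g`.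
-/

namespace DualDouble

set_option linter.unusedSectionVars false

noncomputable section

open ContinuousLinearMap (adjoint adjoint_inner_left adjoint_inner_right)

/-! ### Total sets and elementary tensors -/

section Total

variable {E F : Type*} [NormedAddCommGroup E] [InnerProductSpace ℂ E]
  [NormedAddCommGroup F] [InnerProductSpace ℂ F]

/-- A set of vectors is total if its linear span is dense. -/
def Total (S : Set E) : Prop := Dense (Submodule.span ℂ S : Set E)

theorem total_univ : Total (Set.univ : Set E) := by
  simp [Total]

theorem Total.mem_of_isClosed {S : Set E} (hS : Total S) (N : Submodule ℂ E)
    (hN : IsClosed (N : Set E)) (h : S ⊆ N) (x : E) : x ∈ N := by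
  have h1 : (Submodule.span ℂ S : Set E) ⊆ N := Submodule.span_le.2 h
  exact closure_minimal h1 hN (hS x)

theorem Total.eq_of_inner {S : Set E} (hS : Total S) {x y : E}
    (h : ∀ u ∈ S, ⟪u, x⟫_ℂ = ⟪u, y⟫_ℂ) : x = y := by
  refine hS.eq_of_inner_right (𝕜 := ℂ) fun v hv => ?_
  induction hv using Submodule.span_induction with
  | mem u hu => exact h u hu
  | zero => simp
  | add u v _ _ hu hv => simp_all [inner_add_left]
  | smul c u _ hu => simp_all [inner_smul_left]

theorem Total.clm_ext {S : Set E} {T : Set F} (hS : Total S) (hT : Total T) {A B : F →L[ℂ] E}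
    (h : ∀ u ∈ S, ∀ v ∈ T, ⟪u, A v⟫_ℂ = ⟪u, B v⟫_ℂ) : A = B :=
  ContinuousLinearMap.ext_on hT fun v hv => hS.eq_of_inner fun u hu => h u hu v hv

theorem clm_ext_inner {A B : F →L[ℂ] E} (h : ∀ u v, ⟪u, A v⟫_ℂ = ⟪u, B v⟫_ℂ) : A = B :=
  total_univ.clm_ext total_univ fun u _ v _ => h u v

end Total

section Tensor

variable {H K L H' K' H'' K'' : Type*}
  [NormedAddCommGroup H] [InnerProductSpace ℂ H]
  [NormedAddCommGroup K] [InnerProductSpace ℂ K]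
  [NormedAddCommGroup L] [InnerProductSpace ℂ L]
  [NormedAddCommGroup H'] [InnerProductSpace ℂ H']
  [NormedAddCommGroup K'] [InnerProductSpace ℂ K']
  [NormedAddCommGroup H''] [InnerProductSpace ℂ H'']
  [NormedAddCommGroup K''] [InnerProductSpace ℂ K'']

/-- The operator `y ↦ ξ ⊗ y`. -/
def tmulLeft (ξ : H) : K →L[ℂ] H ⊗ʰ K :=
  (incl H K).toContinuousLinearMap ∘L (TensorProduct.mkL ℂ H K) ξ

theorem smul_tmul (c : ℂ) (x : H) (y : K) : (tmul (c • x) y : H ⊗ʰ K) = c • tmul x y := by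
  simp only [← tmulRight_apply, map_smul]

theorem norm_tmul (x : H) (y : K) : ‖(tmul x y : H ⊗ʰ K)‖ = ‖x‖ * ‖y‖ := by
  rw [tmul, LinearIsometry.norm_map, TensorProduct.norm_tmul]

theorem Total.tmul {S : Set H} {T : Set K} (hS : Total S) (hT : Total T) :
    Total (Set.image2 (tmul : H → K → H ⊗ʰ K) S T) := by
  set N := (Submodule.span ℂ (Set.image2 (DualDouble.tmul : H → K → H ⊗ʰ K) S T)).topologicalClosure
    with hN
  have hNc : IsClosed (N : Set (H ⊗ʰ K)) := Submodule.isClosed_topologicalClosure _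
  have h1 : ∀ y ∈ T, ∀ x, DualDouble.tmul x y ∈ N := fun y hy x =>
    hS.mem_of_isClosed (N.comap (tmulRight y : H →L[ℂ] H ⊗ʰ K).toLinearMap)
      (hNc.preimage (tmulRight y : H →L[ℂ] H ⊗ʰ K).continuous)
      (fun u hu => Submodule.le_topologicalClosure _ (Submodule.subset_span ⟨u, hu, y, hy, rfl⟩)) x
  have h2 : ∀ x y, DualDouble.tmul x y ∈ N := fun x y =>
    hT.mem_of_isClosed (N.comap (tmulLeft x : K →L[ℂ] H ⊗ʰ K).toLinearMap)
      (hNc.preimage (tmulLeft x : K →L[ℂ] H ⊗ʰ K).continuous)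
      (fun u hu => h1 u hu x) y
  intro w
  change w ∈ N
  induction w using tmul_induction with
  | hc => exact hNc
  | h0 => exact N.zero_mem
  | ht x y => exact h2 x y
  | ha v w hv hw => exact N.add_mem hv hw

theorem clm_ext_tmul {A B : H ⊗ʰ K →L[ℂ] L} (h : ∀ x y, A (tmul x y) = B (tmul x y)) : A = B :=
  ContinuousLinearMap.ext_on (total_univ.tmul total_univ) (by
    rintro _ ⟨x, -, y, -, rfl⟩; exact h x y)

theorem eq_of_inner_tmul {v w : H ⊗ʰ K} (h : ∀ x y, ⟪tmul x y, v⟫_ℂ = ⟪tmul x y, w⟫_ℂ) : v = w :=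
  (total_univ.tmul total_univ).eq_of_inner (by rintro _ ⟨x, -, y, -, rfl⟩; exact h x y)

theorem clm_ext_inner_tmul {A B : H ⊗ʰ K →L[ℂ] H' ⊗ʰ K'}
    (h : ∀ x y x' y', ⟪tmul x y, A (tmul x' y')⟫_ℂ = ⟪tmul x y, B (tmul x' y')⟫_ℂ) : A = B :=
  clm_ext_tmul fun x' y' => eq_of_inner_tmul fun x y => h x y x' y'

theorem opTensor_comp (S : H →L[ℂ] H') (T : K →L[ℂ] K') (S' : H' →L[ℂ] H'') (T' : K' →L[ℂ] K'') :
    opTensor S' T' ∘L opTensor S T = opTensor (S' ∘L S) (T' ∘L T) :=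
  clm_ext_tmul fun x y => by simp [opTensor_tmul]

theorem opTensor_id : opTensor (.id ℂ H) (.id ℂ K) = .id ℂ (H ⊗ʰ K) :=
  clm_ext_tmul fun x y => by simp [opTensor_tmul]

theorem opTensor_smul_left (c : ℂ) (S : H →L[ℂ] H') (T : K →L[ℂ] K') :
    opTensor (c • S) T = c • opTensor S T :=
  clm_ext_tmul fun x y => by simp [opTensor_tmul, smul_tmul]

theorem flip_comp_flip : flip K H ∘L flip H K = .id ℂ (H ⊗ʰ K) :=
  clm_ext_tmul fun x y => by simp [flip_tmul]

end Tensor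

section TensorComplete

variable {H K L H' K' : Type*}
  [NormedAddCommGroup H] [InnerProductSpace ℂ H] [CompleteSpace H]
  [NormedAddCommGroup K] [InnerProductSpace ℂ K] [CompleteSpace K]
  [NormedAddCommGroup L] [InnerProductSpace ℂ L] [CompleteSpace L]
  [NormedAddCommGroup H'] [InnerProductSpace ℂ H'] [CompleteSpace H']
  [NormedAddCommGroup K'] [InnerProductSpace ℂ K'] [CompleteSpace K']

theorem adjoint_opTensor (S : H →L[ℂ] H') (T : K →L[ℂ] K') :
    adjoint (opTensor S T) = opTensor (adjoint S) (adjoint T) :=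
  clm_ext_inner_tmul fun x y x' y' => by
    rw [adjoint_inner_right, opTensor_tmul, opTensor_tmul, inner_tmul, inner_tmul,
      adjoint_inner_right, adjoint_inner_right]

theorem adjoint_flip : adjoint (flip H K) = flip K H :=
  clm_ext_inner_tmul fun x y x' y' => by
    rw [adjoint_inner_right, flip_tmul, flip_tmul, inner_tmul, inner_tmul, mul_comm]

theorem norm_assoc (w : (H ⊗ʰ K) ⊗ʰ L) : ‖assoc H K L w‖ = ‖w‖ := by
  refine UniformSpace.Completion.induction_on (p := fun w => ‖assoc H K L w‖ = ‖w‖) w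
    (isClosed_eq (by fun_prop) continuous_norm) fun v => ?_
  have h1 : assoc H K L (incl _ _ v) = assocAux H K L v := extend_incl _ _
  have h2 : ‖assocAux H K L v‖ = ‖v‖ :=
    ((assocAux H K L).isometryOfInner inner_assocAux).norm_map v
  exact (congrArg norm h1).trans (h2.trans ((incl _ _).norm_map v).symm)

theorem adjoint_comp_self_of_norm {U : H →L[ℂ] K} (h : ∀ x, ‖U x‖ = ‖x‖) :
    adjoint U ∘L U = .id ℂ H := by
  have := (ContinuousLinearMap.norm_map_iff_adjoint_comp_self U).1 h
  exact this

theorem adjoint_assoc_comp_assoc : adjoint (assoc H K L) ∘L assoc H K L = .id ℂ _ :=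
  adjoint_comp_self_of_norm norm_assoc

theorem adjoint_assoc_tmul (x : H) (y : K) (z : L) :
    adjoint (assoc H K L) (tmul x (tmul y z)) = tmul (tmul x y) z := by
  rw [← assoc_tmul, ← ContinuousLinearMap.comp_apply, adjoint_assoc_comp_assoc,
    ContinuousLinearMap.id_apply]

theorem assoc_comp_adjoint_assoc : assoc H K L ∘L adjoint (assoc H K L) = .id ℂ _ := by
  refine ContinuousLinearMap.ext_on
    (total_univ.tmul ((total_univ (E := K)).tmul (total_univ (E := L)))) ?_
  rintro _ ⟨x, -, _, ⟨y, -, z, -, rfl⟩, rfl⟩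
  simp [adjoint_assoc_tmul, assoc_tmul]

theorem midSwap_tmul (w x y z : K) :
    midSwap K (tmul (tmul w x) (tmul y z)) = tmul (tmul w y) (tmul x z) := by
  simp [midSwap, assoc_tmul, opTensor_tmul, adjoint_assoc_tmul, flip_tmul]

theorem inner_midSwap (v w : (K ⊗ʰ K) ⊗ʰ (K ⊗ʰ K)) :
    ⟪v, midSwap K w⟫_ℂ = ⟪midSwap K v, w⟫_ℂ := by
  have hT := ((total_univ (E := K)).tmul (total_univ (E := K))).tmul
    ((total_univ (E := K)).tmul (total_univ (E := K)))
  have : midSwap K = adjoint (midSwap K) := by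
    refine hT.clm_ext hT ?_
    rintro _ ⟨_, ⟨a, -, b, -, rfl⟩, _, ⟨c, -, d, -, rfl⟩, rfl⟩
      _ ⟨_, ⟨a', -, b', -, rfl⟩, _, ⟨c', -, d', -, rfl⟩, rfl⟩
    rw [adjoint_inner_right, midSwap_tmul, midSwap_tmul]
    simp only [inner_tmul]
    ring
  rw [this, adjoint_inner_right, ← this]

theorem inner_conjBy (U : H →L[ℂ] K) (X : H →L[ℂ] H) (v w : K) :
    ⟪v, conjBy U X w⟫_ℂ = ⟪adjoint U v, X (adjoint U w)⟫_ℂ := by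
  simp [conjBy, adjoint_inner_left]

theorem conjBy_conjBy (U : H →L[ℂ] K) (V : K →L[ℂ] L) (X : H →L[ℂ] H) :
    conjBy V (conjBy U X) = conjBy (V ∘L U) X := by
  simp only [conjBy, ContinuousLinearMap.adjoint_comp, ContinuousLinearMap.comp_assoc]

theorem conjBy_id (X : H →L[ℂ] H) : conjBy (.id ℂ H) X = X := by
  refine clm_ext_inner fun u v => ?_
  rw [inner_conjBy, adjoint_inner_left]
  simp only [ContinuousLinearMap.adjoint_id, ContinuousLinearMap.id_apply]

theorem conjBy_flip_conjBy_flip (X : H ⊗ʰ K →L[ℂ] H ⊗ʰ K) :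
    conjBy (flip K H) (conjBy (flip H K) X) = X := by
  rw [conjBy_conjBy, flip_comp_flip, conjBy_id]

theorem conjBy_mul {U : H →L[ℂ] K} (hU : adjoint U ∘L U = .id ℂ H) (X Y : H →L[ℂ] H) :
    conjBy U (X * Y) = conjBy U X * conjBy U Y := by
  ext v
  have := fun w => DFunLike.congr_fun hU w
  simp only [ContinuousLinearMap.comp_apply, ContinuousLinearMap.id_apply] at this
  simp [conjBy, this]

theorem star_conjBy (U : H →L[ℂ] K) (X : H →L[ℂ] H) : star (conjBy U X) = conjBy U (star X) := by
  simp [conjBy, ContinuousLinearMap.star_eq_adjoint, ContinuousLinearMap.adjoint_comp,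
    ContinuousLinearMap.comp_assoc]

theorem conjBy_add (U : H →L[ℂ] K) (X Y : H →L[ℂ] H) :
    conjBy U (X + Y) = conjBy U X + conjBy U Y := by
  ext; simp [conjBy]

theorem conjBy_smul (U : H →L[ℂ] K) (c : ℂ) (X : H →L[ℂ] H) :
    conjBy U (c • X) = c • conjBy U X := by
  ext; simp [conjBy]

theorem conjBy_one {U : H →L[ℂ] K} (hU : U ∘L adjoint U = .id ℂ K) : conjBy U 1 = 1 := by
  ext v
  have := DFunLike.congr_fun hU v
  simpa [conjBy] using this

/-! ### Slices -/

/-- The slice `(ω_{ξ,ξ'} ⊗ id)(X)` of an operator `X` on `H ⊗ K` in the first leg. -/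
def sliceLeft (X : H ⊗ʰ K →L[ℂ] H ⊗ʰ K) (ξ ξ' : H) : K →L[ℂ] K :=
  slice (conjBy (flip H K) X) ξ ξ'

theorem inner_sliceLeft (X : H ⊗ʰ K →L[ℂ] H ⊗ʰ K) (ξ ξ' : H) (y y' : K) :
    ⟪y, sliceLeft X ξ ξ' y'⟫_ℂ = ⟪(tmul ξ y : H ⊗ʰ K), X (tmul ξ' y')⟫_ℂ := by
  rw [sliceLeft, inner_slice, inner_conjBy, adjoint_flip, flip_tmul, flip_tmul]

theorem slice_conjBy_flip (X : H ⊗ʰ K →L[ℂ] H ⊗ʰ K) (ζ η : K) :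
    sliceLeft (conjBy (flip H K) X) ζ η = slice X ζ η := by
  rw [sliceLeft, conjBy_flip_conjBy_flip]

theorem ext_slice {X Y : H ⊗ʰ K →L[ℂ] H ⊗ʰ K} (h : ∀ ζ η, slice X ζ η = slice Y ζ η) : X = Y :=
  clm_ext_inner_tmul fun x y x' y' => by rw [← inner_slice, ← inner_slice, h]

theorem ext_sliceLeft {X Y : H ⊗ʰ K →L[ℂ] H ⊗ʰ K}
    (h : ∀ ζ η, sliceLeft X ζ η = sliceLeft Y ζ η) : X = Y :=
  clm_ext_inner_tmul fun x y x' y' => by rw [← inner_sliceLeft, ← inner_sliceLeft, h]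

theorem slice_opTensor (a : H →L[ℂ] H) (b : K →L[ℂ] K) (ζ η : K) :
    slice (opTensor a b) ζ η = ⟪ζ, b η⟫_ℂ • a :=
  clm_ext_inner fun x y => by
    simp [inner_slice, opTensor_tmul, inner_tmul, mul_comm]

theorem sliceLeft_opTensor (a : H →L[ℂ] H) (b : K →L[ℂ] K) (ζ η : H) :
    sliceLeft (opTensor a b) ζ η = ⟪ζ, a η⟫_ℂ • b :=
  clm_ext_inner fun x y => by
    simp [inner_sliceLeft, opTensor_tmul, inner_tmul]

theorem slice_left_mul (a : H →L[ℂ] H) (X : H ⊗ʰ K →L[ℂ] H ⊗ʰ K) (ζ η : K) :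
    slice (opTensor a 1 * X) ζ η = a * slice X ζ η :=
  clm_ext_inner fun x y => by
    rw [inner_slice, mul_apply_eq_comp, mul_apply_eq_comp, ← adjoint_inner_left,
      adjoint_opTensor, opTensor_tmul, ← adjoint_inner_left a, inner_slice,
      ← ContinuousLinearMap.star_eq_adjoint (1 : K →L[ℂ] K), star_one, one_apply_eq_self]

theorem slice_right_mul (a : H →L[ℂ] H) (X : H ⊗ʰ K →L[ℂ] H ⊗ʰ K) (ζ η : K) :
    slice (X * opTensor a 1) ζ η = slice X ζ η * a :=
  clm_ext_inner fun x y => by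
    simp [inner_slice, opTensor_tmul]

theorem slice_one_mul (T : K →L[ℂ] K) (X : H ⊗ʰ K →L[ℂ] H ⊗ʰ K) (ζ η : K) :
    slice (opTensor 1 T * X) ζ η = slice X (adjoint T ζ) η :=
  clm_ext_inner fun x y => by
    simp only [inner_slice, mul_apply_eq_comp]
    rw [← adjoint_inner_left, adjoint_opTensor, opTensor_tmul,
      ← ContinuousLinearMap.star_eq_adjoint (1 : H →L[ℂ] H), star_one]
    simp

theorem slice_mul_one (T : K →L[ℂ] K) (X : H ⊗ʰ K →L[ℂ] H ⊗ʰ K) (ζ η : K) :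
    slice (X * opTensor 1 T) ζ η = slice X ζ (T η) :=
  clm_ext_inner fun x y => by
    simp [inner_slice, opTensor_tmul]

theorem slice_sub (X Y : H ⊗ʰ K →L[ℂ] H ⊗ʰ K) (ζ η : K) :
    slice (X - Y) ζ η = slice X ζ η - slice Y ζ η := by
  ext; simp [slice]

theorem slice_add_right (X : H ⊗ʰ K →L[ℂ] H ⊗ʰ K) (ζ η η' : K) :
    slice X ζ (η + η') = slice X ζ η + slice X ζ η' :=
  clm_ext_inner fun x y => by simp [inner_slice, tmul_add]

theorem slice_smul_right (X : H ⊗ʰ K →L[ℂ] H ⊗ʰ K) (c : ℂ) (ζ η : K) :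
    slice X ζ (c • η) = c • slice X ζ η :=
  clm_ext_inner fun x y => by simp [inner_slice, tmul_smul]

theorem slice_add_left (X : H ⊗ʰ K →L[ℂ] H ⊗ʰ K) (ζ ζ' η : K) :
    slice X (ζ + ζ') η = slice X ζ η + slice X ζ' η :=
  clm_ext_inner fun x y => by simp [inner_slice, tmul_add]

theorem slice_smul_left (X : H ⊗ʰ K →L[ℂ] H ⊗ʰ K) (c : ℂ) (ζ η : K) :
    slice X (c • ζ) η = (starRingEnd ℂ) c • slice X ζ η :=
  clm_ext_inner fun x y => by simp [inner_slice, tmul_smul, mul_comm]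

theorem norm_slice_apply_le (X : H ⊗ʰ K →L[ℂ] H ⊗ʰ K) (ζ η : K) (x : H) :
    ‖slice X ζ η x‖ ≤ ‖ζ‖ * ‖X (tmul x η)‖ := by
  have h : ∀ y : H, ‖⟪y, slice X ζ η x⟫_ℂ‖ ≤ (‖ζ‖ * ‖X (tmul x η)‖) * ‖y‖ := fun y => by
    rw [inner_slice]
    refine (norm_inner_le_norm _ _).trans (le_of_eq ?_)
    rw [norm_tmul]; ring
  by_cases h0 : ‖slice X ζ η x‖ = 0
  · rw [h0]; positivity
  have := h (slice X ζ η x)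
  rw [inner_self_eq_norm_sq_to_K] at this
  norm_num [sq] at this
  exact le_of_mul_le_mul_right this (lt_of_le_of_ne (norm_nonneg _) (Ne.symm h0))

theorem norm_slice_le (X : H ⊗ʰ K →L[ℂ] H ⊗ʰ K) (ζ η : K) :
    ‖slice X ζ η‖ ≤ ‖ζ‖ * ‖X‖ * ‖η‖ := by
  refine ContinuousLinearMap.opNorm_le_bound _ (by positivity) fun x => ?_
  refine (norm_slice_apply_le X ζ η x).trans ?_
  calc ‖ζ‖ * ‖X (tmul x η)‖ ≤ ‖ζ‖ * (‖X‖ * (‖x‖ * ‖η‖)) := by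
        gcongr; rw [← norm_tmul]; exact X.le_opNorm _
    _ = _ := by ring

/-! ### Elements of von Neumann algebras and of their tensor products -/

theorem mem_of_forall_commute {M : VonNeumannAlgebra H} {x : H →L[ℂ] H}
    (h : ∀ T ∈ M.commutant, T * x = x * T) : x ∈ M := by
  rw [← VonNeumannAlgebra.commutant_commutant M, VonNeumannAlgebra.mem_commutant_iff]
  exact h

theorem commute_of_mem {M : VonNeumannAlgebra H} {x T : H →L[ℂ] H} (hx : x ∈ M)
    (hT : T ∈ M.commutant) : T * x = x * T :=
  ((VonNeumannAlgebra.mem_commutant_iff.1 hT) x hx).symm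

theorem mem_generated_iff {S : Set (H →L[ℂ] H)} (hS : ∀ x ∈ S, star x ∈ S) {x : H →L[ℂ] H} :
    x ∈ generated S ↔ ∀ T, (∀ a ∈ S, a * T = T * a) → T * x = x * T := by
  have h1 : x ∈ generated S ↔ x ∈ StarSubalgebra.centralizer ℂ
    (StarSubalgebra.centralizer ℂ S : Set (H →L[ℂ] H)) := Iff.rfl
  have h2 : ∀ T, T ∈ StarSubalgebra.centralizer ℂ S ↔ ∀ a ∈ S, a * T = T * a := fun T => by
    rw [StarSubalgebra.mem_centralizer_iff]
    exact ⟨fun h a ha => (h a ha).1, fun h a ha => ⟨h a ha, h _ (hS a ha)⟩⟩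
  rw [h1, StarSubalgebra.mem_centralizer_iff]
  refine ⟨fun h T hT => (h T ((h2 T).2 hT)).1, fun h T hT => ⟨h T ((h2 T).1 hT), ?_⟩⟩
  exact h _ ((h2 _).1 (star_mem hT))

theorem mem_generated_of_mem {S : Set (H →L[ℂ] H)} (hS : ∀ x ∈ S, star x ∈ S) {x : H →L[ℂ] H}
    (hx : x ∈ S) : x ∈ generated S :=
  (mem_generated_iff hS).2 fun _ hT => (hT x hx).symm

theorem vnTensor_star_mem (M : VonNeumannAlgebra H) (N : VonNeumannAlgebra K) :
    ∀ x ∈ {X : H ⊗ʰ K →L[ℂ] H ⊗ʰ K | ∃ a ∈ M, ∃ b ∈ N, X = opTensor a b},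
      star x ∈ {X : H ⊗ʰ K →L[ℂ] H ⊗ʰ K | ∃ a ∈ M, ∃ b ∈ N, X = opTensor a b} := by
  rintro _ ⟨a, ha, b, hb, rfl⟩
  exact ⟨star a, star_mem ha, star b, star_mem hb, adjoint_opTensor a b⟩

theorem mem_vnTensor_iff {M : VonNeumannAlgebra H} {N : VonNeumannAlgebra K}
    {X : H ⊗ʰ K →L[ℂ] H ⊗ʰ K} :
    X ∈ vnTensor M N ↔ ∀ T, (∀ a ∈ M, ∀ b ∈ N, opTensor a b * T = T * opTensor a b) →
      T * X = X * T := by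
  rw [vnTensor, mem_generated_iff (vnTensor_star_mem M N)]
  refine forall_congr' fun T => imp_congr_left ⟨fun h a ha b hb => h _ ⟨a, ha, b, hb, rfl⟩, ?_⟩
  rintro h _ ⟨a, ha, b, hb, rfl⟩
  exact h a ha b hb

theorem opTensor_mul (a a' : H →L[ℂ] H) (b b' : K →L[ℂ] K) :
    opTensor a b * opTensor a' b' = opTensor (a * a') (b * b') :=
  opTensor_comp _ _ _ _

theorem opTensor_one : opTensor (1 : H →L[ℂ] H) (1 : K →L[ℂ] K) = 1 := opTensor_id

theorem opTensor_mem {M : VonNeumannAlgebra H} {N : VonNeumannAlgebra K}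
    {a : H →L[ℂ] H} {b : K →L[ℂ] K} (ha : a ∈ M) (hb : b ∈ N) : opTensor a b ∈ vnTensor M N :=
  mem_generated_of_mem (vnTensor_star_mem M N) ⟨a, ha, b, hb, rfl⟩

theorem commute_left_of_mem_vnTensor {M : VonNeumannAlgebra H} {N : VonNeumannAlgebra K}
    {X : H ⊗ʰ K →L[ℂ] H ⊗ʰ K} (hX : X ∈ vnTensor M N) {T : H →L[ℂ] H} (hT : T ∈ M.commutant) :
    opTensor T 1 * X = X * opTensor T 1 :=
  mem_vnTensor_iff.1 hX _ fun a ha b _ => by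
    rw [opTensor_mul, opTensor_mul, commute_of_mem ha hT, mul_one, one_mul]

theorem commute_right_of_mem_vnTensor {M : VonNeumannAlgebra H} {N : VonNeumannAlgebra K}
    {X : H ⊗ʰ K →L[ℂ] H ⊗ʰ K} (hX : X ∈ vnTensor M N) {T : K →L[ℂ] K} (hT : T ∈ N.commutant) :
    opTensor 1 T * X = X * opTensor 1 T :=
  mem_vnTensor_iff.1 hX _ fun a _ b hb => by
    rw [opTensor_mul, opTensor_mul, commute_of_mem hb hT, mul_one, one_mul]

theorem slice_mem_of_commute {M : VonNeumannAlgebra H} {X : H ⊗ʰ K →L[ℂ] H ⊗ʰ K}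
    (hX : ∀ T ∈ M.commutant, opTensor T 1 * X = X * opTensor T 1) (ζ η : K) :
    slice X ζ η ∈ M :=
  mem_of_forall_commute fun T hT => by
    rw [← slice_left_mul, hX T hT, slice_right_mul]

theorem slice_mem {M : VonNeumannAlgebra H} {N : VonNeumannAlgebra K}
    {X : H ⊗ʰ K →L[ℂ] H ⊗ʰ K} (hX : X ∈ vnTensor M N) (ζ η : K) : slice X ζ η ∈ M :=
  slice_mem_of_commute (fun _ hT => commute_left_of_mem_vnTensor hX hT) ζ η

theorem conjBy_flip_opTensor (a : H →L[ℂ] H) (b : K →L[ℂ] K) :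
    conjBy (flip H K) (opTensor a b) = opTensor b a :=
  clm_ext_inner_tmul fun x y x' y' => by
    simp [inner_conjBy, adjoint_flip, flip_tmul, opTensor_tmul, inner_tmul, mul_comm]

theorem sliceLeft_mem_of_commute {N : VonNeumannAlgebra K} {X : H ⊗ʰ K →L[ℂ] H ⊗ʰ K}
    (hX : ∀ T ∈ N.commutant, opTensor 1 T * X = X * opTensor 1 T) (ζ η : H) :
    sliceLeft X ζ η ∈ N :=
  slice_mem_of_commute (fun T hT => by
    have hf : adjoint (flip H K) ∘L flip H K = .id ℂ _ := by rw [adjoint_flip, flip_comp_flip]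
    rw [← conjBy_flip_opTensor, ← conjBy_mul hf, ← conjBy_mul hf, hX T hT]) ζ η

theorem sliceLeft_mem {M : VonNeumannAlgebra H} {N : VonNeumannAlgebra K}
    {X : H ⊗ʰ K →L[ℂ] H ⊗ʰ K} (hX : X ∈ vnTensor M N) (ζ η : H) : sliceLeft X ζ η ∈ N :=
  sliceLeft_mem_of_commute (fun _ hT => commute_right_of_mem_vnTensor hX hT) ζ η

/-- An operator commutes with `a ⊗ 1` if and only if all its slices commute with `a`. -/
theorem commute_opTensor_one_iff {a : H →L[ℂ] H} {X : H ⊗ʰ K →L[ℂ] H ⊗ʰ K} :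
    opTensor a 1 * X = X * opTensor a 1 ↔ ∀ ζ η, a * slice X ζ η = slice X ζ η * a := by
  refine ⟨fun h ζ η => by rw [← slice_left_mul, h, slice_right_mul], fun h => ext_slice fun ζ η => ?_⟩
  rw [slice_left_mul, slice_right_mul, h]

/-- An operator commuting with `a ⊗ 1` for all generators `a` commutes with `x ⊗ 1` for all `x` in
the von Neumann algebra that they generate. -/
theorem commute_of_generated {S : Set (H →L[ℂ] H)} (hS : ∀ x ∈ S, star x ∈ S)
    {X : H ⊗ʰ K →L[ℂ] H ⊗ʰ K} (h : ∀ a ∈ S, opTensor a 1 * X = X * opTensor a 1)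
    {x : H →L[ℂ] H} (hx : x ∈ generated S) : opTensor x 1 * X = X * opTensor x 1 :=
  commute_opTensor_one_iff.2 fun ζ η =>
    ((mem_generated_iff hS).1 hx _ fun a ha => commute_opTensor_one_iff.1 (h a ha) ζ η).symm

/-- The associativity operator maps `(M ⊗ N) ⊗ P` into `M ⊗ (N ⊗ P)`. -/
theorem conjBy_assoc_mem {M : VonNeumannAlgebra H} {N : VonNeumannAlgebra K}
    {P : VonNeumannAlgebra L} {X : (H ⊗ʰ K) ⊗ʰ L →L[ℂ] (H ⊗ʰ K) ⊗ʰ L}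
    (hX : X ∈ vnTensor (vnTensor M N) P) : conjBy (assoc H K L) X ∈ vnTensor M (vnTensor N P) := by
  rw [mem_vnTensor_iff] at hX ⊢
  intro T hT
  have hU := adjoint_assoc_comp_assoc (H := H) (K := K) (L := L)
  have hU' := assoc_comp_adjoint_assoc (H := H) (K := K) (L := L)
  set T' := conjBy (adjoint (assoc H K L)) T with hT'
  have hTT : T = conjBy (assoc H K L) T' := by
    rw [hT', conjBy_conjBy, hU', conjBy_id]
  have key : ∀ a ∈ M, ∀ b ∈ N, ∀ c ∈ P, opTensor (opTensor a b) c * T' =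
      T' * opTensor (opTensor a b) c := by
    intro a ha b hb c hc
    have h1 : opTensor (opTensor a b) c =
        conjBy (adjoint (assoc H K L)) (opTensor a (opTensor b c)) := by
      refine ContinuousLinearMap.ext_on
        (((total_univ (E := H)).tmul (total_univ (E := K))).tmul (total_univ (E := L))) ?_
      rintro _ ⟨_, ⟨x, -, y, -, rfl⟩, z, -, rfl⟩
      simp [conjBy, opTensor_tmul, assoc_tmul, adjoint_assoc_tmul]
    have h2 : adjoint (adjoint (assoc H K L)) ∘L adjoint (assoc H K L) = .id ℂ _ := by
      rw [ContinuousLinearMap.adjoint_adjoint, hU']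
    rw [h1, hT', ← conjBy_mul h2, ← conjBy_mul h2, hT a ha _ (opTensor_mem hb hc)]
  have h3 : T' * X = X * T' := by
    refine hX _ fun Y hY c hc => ?_
    have e1 : opTensor Y c = opTensor Y 1 * opTensor 1 c := by
      rw [opTensor_mul, mul_one, one_mul]
    have e2 : opTensor Y 1 * T' = T' * opTensor Y 1 := by
      refine commute_of_generated (vnTensor_star_mem M N) ?_ hY
      rintro _ ⟨a, ha, b, hb, rfl⟩
      exact key a ha b hb 1 (one_mem P)
    have e3 : opTensor 1 c * T' = T' * opTensor 1 c := by
      have := key 1 (one_mem M) 1 (one_mem N) c hc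
      rwa [opTensor_one] at this
    rw [e1, mul_assoc, e3, ← mul_assoc, e2, mul_assoc]
  rw [hTT, ← conjBy_mul hU, ← conjBy_mul hU, h3]

end TensorComplete

/-! ### Vector valued square integrable functions -/

/-- A bounded sesquilinear form is given by a bounded operator. -/
theorem exists_clm_of_form {E : Type*} [NormedAddCommGroup E] [InnerProductSpace ℂ E]
    [CompleteSpace E] (b : E → E → ℂ) (h1 : ∀ x x' y, b (x + x') y = b x y + b x' y)
    (h2 : ∀ (c : ℂ) x y, b (c • x) y = (starRingEnd ℂ) c * b x y)
    (h3 : ∀ x y y', b x (y + y') = b x y + b x y') (h4 : ∀ (c : ℂ) x y, b x (c • y) = c * b x y)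
    {C : ℝ} (hC : ∀ x y, ‖b x y‖ ≤ C * ‖x‖ * ‖y‖) :
    ∃ T : E →L[ℂ] E, ∀ x y, ⟪x, T y⟫_ℂ = b x y := by
  let B0 : E →ₛₗ[starRingEnd ℂ] E →ₗ[ℂ] ℂ := LinearMap.mk₂'ₛₗ (starRingEnd ℂ) (RingHom.id ℂ) b
    h1 h2 h3 h4
  let B := B0.mkContinuous₂ C hC
  refine ⟨adjoint (InnerProductSpace.continuousLinearMapOfBilin B), fun x y => ?_⟩
  rw [adjoint_inner_right, InnerProductSpace.continuousLinearMapOfBilin_apply]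
  rfl

section

variable {G : Type*} [Group G] [TopologicalSpace G] [IsTopologicalGroup G] [LocallyCompactSpace G]
  [MeasurableSpace G] [BorelSpace G] (μ : Measure G) [μ.IsHaarMeasure] [μ.Regular]
  {H H' : Type*} [NormedAddCommGroup H] [InnerProductSpace ℂ H] [CompleteSpace H]
  [NormedAddCommGroup H'] [InnerProductSpace ℂ H'] [CompleteSpace H']

/-- The map `x ⊗ f ↦ (g ↦ f(g) x)` on the algebraic tensor product. -/
def toL2Aux (H : Type*) [NormedAddCommGroup H] [InnerProductSpace ℂ H] :
    H ⊗[ℂ] L2 μ →ₗ[ℂ] Lp H 2 μ :=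
  TensorProduct.lift (LinearMap.mk₂ ℂ
    (fun (x : H) (f : L2 μ) => (ContinuousLinearMap.toSpanSingleton ℂ x).compLpL 2 μ f)
    (fun x x' f => by
      rw [ContinuousLinearMap.toSpanSingleton_add, ContinuousLinearMap.add_compLpL]; rfl)
    (fun c x f => by
      rw [ContinuousLinearMap.toSpanSingleton_smul, ContinuousLinearMap.smul_compLpL]; rfl)
    (fun _ _ _ => map_add _ _ _) (fun _ _ _ => map_smul _ _ _))

theorem coeFn_toL2Aux_tmul (x : H) (f : L2 μ) :
    toL2Aux μ H (x ⊗ₜ f) =ᵐ[μ] fun g => f g • x :=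
  ContinuousLinearMap.coeFn_compLpL (ContinuousLinearMap.toSpanSingleton ℂ x) f

theorem inner_toL2Aux (u v : H ⊗[ℂ] L2 μ) : ⟪toL2Aux μ H u, toL2Aux μ H v⟫_ℂ = ⟪u, v⟫_ℂ := by
  induction u using TensorProduct.induction_on with
  | zero => simp
  | tmul x f =>
    induction v using TensorProduct.induction_on with
    | zero => simp
    | tmul y k =>
      rw [TensorProduct.inner_tmul, L2.inner_def, L2.inner_def, ← integral_const_mul]
      refine integral_congr_ae ?_
      filter_upwards [coeFn_toL2Aux_tmul μ x f, coeFn_toL2Aux_tmul μ y k] with g h1 h2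
      rw [h1, h2, inner_smul_left, inner_smul_right]
      simp
      ring
    | add a b ha hb => simp only [map_add, inner_add_right, ha, hb]
  | add a b ha hb => simp only [map_add, inner_add_left, ha, hb]

/-- The unitary operator `H ⊗ L²(G) → L²(G, H)`, `x ⊗ f ↦ (g ↦ f(g) x)`. -/
def toL2 : H ⊗ʰ L2 μ →L[ℂ] Lp H 2 μ :=
  extend ((toL2Aux μ H).isometryOfInner (inner_toL2Aux μ)).toContinuousLinearMap

theorem coeFn_toL2_tmul (x : H) (f : L2 μ) :
    toL2 μ (tmul x f : H ⊗ʰ L2 μ) =ᵐ[μ] fun g => f g • x := by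
  have : toL2 μ (tmul x f : H ⊗ʰ L2 μ) = toL2Aux μ H (x ⊗ₜ f) := extend_incl _ _
  rw [this]
  exact coeFn_toL2Aux_tmul μ x f

theorem norm_toL2 (w : H ⊗ʰ L2 μ) : ‖toL2 μ w‖ = ‖w‖ := by
  refine UniformSpace.Completion.induction_on (p := fun w => ‖toL2 μ w‖ = ‖w‖) w
    (isClosed_eq (by fun_prop) continuous_norm) fun v => ?_
  have h1 : toL2 μ (incl _ _ v) = toL2Aux μ H v := extend_incl _ _
  exact (congrArg norm h1).trans ((((toL2Aux μ H).isometryOfInner (inner_toL2Aux μ)).norm_map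
    v).trans ((incl _ _).norm_map v).symm)

theorem inner_toL2 (v w : H ⊗ʰ L2 μ) : ⟪toL2 μ v, toL2 μ w⟫_ℂ = ⟪v, w⟫_ℂ := by
  have h := adjoint_comp_self_of_norm (norm_toL2 μ (H := H))
  rw [← adjoint_inner_right, ← ContinuousLinearMap.comp_apply, h, ContinuousLinearMap.id_apply]

/-- The range is closed and contains the indicator functions `c 1_E`. -/
theorem toL2_surjective : Function.Surjective (toL2 μ : H ⊗ʰ L2 μ →L[ℂ] Lp H 2 μ) := by
  have hi : Isometry (toL2 μ : H ⊗ʰ L2 μ →L[ℂ] Lp H 2 μ) :=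
    AddMonoidHomClass.isometry_of_norm _ (norm_toL2 μ)
  have hc : IsClosed (Set.range (toL2 μ : H ⊗ʰ L2 μ →L[ℂ] Lp H 2 μ)) :=
    hi.isClosedEmbedding.isClosed_range
  intro u
  change u ∈ Set.range _
  induction u using Lp.induction (show (2 : ENNReal) ≠ ⊤ by simp) with
  | @indicatorConst c s hs hμs =>
    refine ⟨tmul c (indicatorConstLp 2 hs hμs.ne 1), Lp.ext ?_⟩
    rw [Lp.simpleFunc.coe_indicatorConst]
    filter_upwards [coeFn_toL2_tmul μ c (indicatorConstLp 2 hs hμs.ne 1),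
      indicatorConstLp_coeFn (p := 2) (hs := hs) (hμs := hμs.ne) (c := (1 : ℂ)),
      indicatorConstLp_coeFn (p := 2) (hs := hs) (hμs := hμs.ne) (c := c)] with g h1 h2 h3
    rw [h1, h2, h3]
    by_cases hg : g ∈ s <;> simp [hg]
  | add hf hg _ h1 h2 =>
    obtain ⟨v, hv⟩ := h1
    obtain ⟨w, hw⟩ := h2
    exact ⟨v + w, by rw [map_add, hv, hw]⟩
  | isClosed => exact hc

/-- A bounded and weakly measurable operator valued function. -/
structure IsBddMeas (F : G → (H →L[ℂ] H)) : Prop where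
  bdd : ∃ C, ∀ g, ‖F g‖ ≤ C
  meas : ∀ x y, Measurable fun g => ⟪x, F g y⟫_ℂ

variable {μ} {F F' : G → (H →L[ℂ] H)}

theorem IsBddMeas.aestronglyMeasurable_inner (hF : IsBddMeas F) {u w : G → H}
    (hu : AEStronglyMeasurable u μ) (hw : AEStronglyMeasurable w μ) :
    AEStronglyMeasurable (fun g => ⟪u g, F g (w g)⟫_ℂ) μ := by
  obtain ⟨u', hu', hu''⟩ := hu
  obtain ⟨w', hw', hw''⟩ := hw
  refine (?_ : StronglyMeasurable (fun g => ⟪u' g, F g (w' g)⟫_ℂ)).aestronglyMeasurable.congr ?_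
  · refine stronglyMeasurable_of_tendsto (f := fun n g => ⟪hu'.approx n g, F g (hw'.approx n g)⟫_ℂ)
      Filter.atTop (fun n => ?_) ?_
    · refine Measurable.stronglyMeasurable ?_
      exact (hu'.approx n).measurable_bind (fun x g => ⟪x, F g (hw'.approx n g)⟫_ℂ) fun x =>
        (hw'.approx n).measurable_bind (fun y g => ⟪x, F g y⟫_ℂ) fun y => hF.meas x y
    · refine tendsto_pi_nhds.2 fun g => ?_
      exact (hu'.tendsto_approx g).inner
        (((F g).continuous.tendsto _).comp (hw'.tendsto_approx g))
  · filter_upwards [hu'', hw''] with g h1 h2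
    rw [h1, h2]

theorem IsBddMeas.norm_integral_le_of_bound (hF : IsBddMeas F) (u w : Lp H 2 μ) {k : G → ℝ}
    (hk : MemLp k 2 μ) (h : ∀ᵐ g ∂μ, ‖F g (w g)‖ ≤ k g) :
    Integrable (fun g => ⟪u g, F g (w g)⟫_ℂ) μ ∧
      ‖∫ g, ⟪u g, F g (w g)⟫_ℂ ∂μ‖ ≤ ‖u‖ * ‖hk.toLp‖ := by
  have hum : MemLp (fun g => ‖u g‖) 2 μ := (Lp.memLp u).norm
  have hmul : Integrable (fun g => ‖u g‖ * k g) μ := hum.integrable_mul hk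
  have hb : ∀ᵐ g ∂μ, ‖⟪u g, F g (w g)⟫_ℂ‖ ≤ ‖u g‖ * k g := by
    filter_upwards [h] with g hg
    exact (norm_inner_le_norm _ _).trans (by gcongr)
  refine ⟨hmul.mono' (hF.aestronglyMeasurable_inner (Lp.aestronglyMeasurable u)
      (Lp.aestronglyMeasurable w)) hb, (norm_integral_le_of_norm_le hmul hb).trans ?_⟩
  have h2 : ∫ g, ‖u g‖ * k g ∂μ = ⟪hum.toLp, hk.toLp⟫_ℝ := by
    rw [L2.inner_def]
    refine integral_congr_ae ?_
    filter_upwards [hum.coeFn_toLp, hk.coeFn_toLp] with g h1 h2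
    rw [h1, h2]
    simp [mul_comm]
  rw [h2]
  have h3 : ‖hum.toLp‖ = ‖u‖ := by rw [Lp.norm_toLp, eLpNorm_norm, Lp.norm_def]
  rw [← h3]
  exact real_inner_le_norm _ _

theorem IsBddMeas.norm_integral_le (hF : IsBddMeas F) {C : ℝ} (hC : ∀ g, ‖F g‖ ≤ C)
    (u w : Lp H 2 μ) :
    Integrable (fun g => ⟪u g, F g (w g)⟫_ℂ) μ ∧
      ‖∫ g, ⟪u g, F g (w g)⟫_ℂ ∂μ‖ ≤ C * ‖u‖ * ‖w‖ := by
  have hC0 : 0 ≤ C := (norm_nonneg _).trans (hC 1)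
  have hk : MemLp (fun g => C * ‖w g‖) 2 μ := (Lp.memLp w).norm.const_mul C
  obtain ⟨h1, h2⟩ := hF.norm_integral_le_of_bound u w hk
    (.of_forall fun g => (F g).le_of_opNorm_le (hC g) _)
  refine ⟨h1, h2.trans (le_of_eq ?_)⟩
  have h3 : ‖hk.toLp‖ = C * ‖w‖ := by
    have e : hk.toLp = C • ((Lp.memLp w).norm).toLp :=
      MemLp.toLp_const_smul (f := fun g => ‖w g‖) C (Lp.memLp w).norm
    rw [e, norm_smul, Lp.norm_toLp, eLpNorm_norm, Lp.norm_def, Real.norm_of_nonneg hC0]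
  rw [h3]
  ring

/-- The decomposable operator exists: it is transported from the bounded form
`(u, w) ↦ ∫ ⟪u(g), F(g) w(g)⟫ dg` on `L²(G, H)`. -/
theorem IsBddMeas.exists_operator (hF : IsBddMeas F) :
    ∃ T : H ⊗ʰ L2 μ →L[ℂ] H ⊗ʰ L2 μ, ∀ v w,
      ⟪v, T w⟫_ℂ = ∫ g, ⟪toL2 μ v g, F g (toL2 μ w g)⟫_ℂ ∂μ := by
  obtain ⟨C, hC⟩ := hF.bdd
  have hi : ∀ u w : Lp H 2 μ, Integrable (fun g => ⟪u g, F g (w g)⟫_ℂ) μ := fun u w =>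
    (hF.norm_integral_le hC u w).1
  obtain ⟨T, hT⟩ := exists_clm_of_form
    (fun u w : Lp H 2 μ => ∫ g, ⟪u g, F g (w g)⟫_ℂ ∂μ)
    (fun u u' w => by
      rw [← integral_add (hi u w) (hi u' w)]
      refine integral_congr_ae ?_
      filter_upwards [Lp.coeFn_add u u'] with g hg
      rw [hg, Pi.add_apply, inner_add_left])
    (fun c u w => by
      rw [← integral_const_mul]
      refine integral_congr_ae ?_
      filter_upwards [Lp.coeFn_smul c u] with g hg
      rw [hg, Pi.smul_apply, inner_smul_left])
    (fun u w w' => by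
      rw [← integral_add (hi u w) (hi u w')]
      refine integral_congr_ae ?_
      filter_upwards [Lp.coeFn_add w w'] with g hg
      rw [hg, Pi.add_apply, map_add, inner_add_right])
    (fun c u w => by
      rw [← integral_const_mul]
      refine integral_congr_ae ?_
      filter_upwards [Lp.coeFn_smul c w] with g hg
      rw [hg, Pi.smul_apply, map_smul, inner_smul_right])
    (fun u w => (hF.norm_integral_le hC u w).2)
  refine ⟨adjoint (toL2 μ) ∘L T ∘L toL2 μ, fun v w => ?_⟩
  rw [ContinuousLinearMap.comp_apply, adjoint_inner_right, ContinuousLinearMap.comp_apply, hT]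

theorem isDecomposed_of_inner {T : H ⊗ʰ L2 μ →L[ℂ] H ⊗ʰ L2 μ}
    (hT : ∀ v w, ⟪v, T w⟫_ℂ = ∫ g, ⟪toL2 μ v g, F g (toL2 μ w g)⟫_ℂ ∂μ) :
    IsDecomposed μ F T := by
  intro x y f k
  rw [hT]
  refine integral_congr_ae ?_
  filter_upwards [coeFn_toL2_tmul μ x f, coeFn_toL2_tmul μ y k] with g h1 h2
  rw [h1, h2, map_smul, inner_smul_left, inner_smul_right, mul_assoc]

theorem IsDecomposed.unique {T T' : H ⊗ʰ L2 μ →L[ℂ] H ⊗ʰ L2 μ} (h : IsDecomposed μ F T)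
    (h' : IsDecomposed μ F T') : T = T' :=
  clm_ext_inner_tmul fun x f y k => by rw [h, h']

theorem IsDecomposed.eq_decomposable {T : H ⊗ʰ L2 μ →L[ℂ] H ⊗ʰ L2 μ} (h : IsDecomposed μ F T) :
    decomposable μ F = T := by
  have hex : ∃ T, IsDecomposed μ F T := ⟨T, h⟩
  rw [decomposable, dif_pos hex]
  exact hex.choose_spec.unique h

theorem IsBddMeas.inner_decomposable (hF : IsBddMeas F) (v w : H ⊗ʰ L2 μ) :
    ⟪v, decomposable μ F w⟫_ℂ = ∫ g, ⟪toL2 μ v g, F g (toL2 μ w g)⟫_ℂ ∂μ := by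
  obtain ⟨T, hT⟩ := hF.exists_operator (μ := μ)
  rw [(isDecomposed_of_inner hT).eq_decomposable, hT]

theorem IsBddMeas.isDecomposed (hF : IsBddMeas F) : IsDecomposed μ F (decomposable μ F) :=
  isDecomposed_of_inner hF.inner_decomposable

theorem IsBddMeas.norm_decomposable_apply_le (hF : IsBddMeas F) (w : H ⊗ʰ L2 μ) {k : G → ℝ}
    (hk : MemLp k 2 μ) (h : ∀ᵐ g ∂μ, ‖F g (toL2 μ w g)‖ ≤ k g) :
    ‖decomposable μ F w‖ ≤ ‖hk.toLp‖ := by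
  by_cases h0 : ‖decomposable μ F w‖ = 0
  · rw [h0]; positivity
  have h1 := (hF.norm_integral_le_of_bound (toL2 μ (decomposable μ F w)) (toL2 μ w) hk h).2
  rw [← hF.inner_decomposable, norm_toL2, inner_self_eq_norm_sq_to_K] at h1
  norm_num [sq, -Lp.norm_toLp] at h1
  exact le_of_mul_le_mul_left h1 (lt_of_le_of_ne (norm_nonneg _) (Ne.symm h0))

theorem IsBddMeas.norm_decomposable_le (hF : IsBddMeas F) {C : ℝ} (hC : ∀ g, ‖F g‖ ≤ C) :
    ‖decomposable μ F‖ ≤ C := by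
  have hC0 : 0 ≤ C := (norm_nonneg _).trans (hC 1)
  refine ContinuousLinearMap.opNorm_le_bound _ hC0 fun w => ?_
  have hk : MemLp (fun g => C * ‖toL2 μ w g‖) 2 μ := (Lp.memLp _).norm.const_mul C
  refine (hF.norm_decomposable_apply_le w hk
    (.of_forall fun g => (F g).le_of_opNorm_le (hC g) _)).trans (le_of_eq ?_)
  have e : hk.toLp = C • ((Lp.memLp (toL2 μ w)).norm).toLp :=
    MemLp.toLp_const_smul (f := fun g => ‖toL2 μ w g‖) C (Lp.memLp _).norm
  rw [e, norm_smul, Lp.norm_toLp, eLpNorm_norm, Real.norm_of_nonneg hC0, ← Lp.norm_def, norm_toL2]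

/-! ### Strongly continuous families -/

/-- A bounded and strongly continuous operator valued function. -/
structure IsStrongCont (F : G → (H →L[ℂ] H)) : Prop where
  bdd : ∃ C, ∀ g, ‖F g‖ ≤ C
  cont : ∀ x, Continuous fun g => F g x

theorem IsStrongCont.isBddMeas (hF : IsStrongCont F) : IsBddMeas F where
  bdd := hF.bdd
  meas _ _ := (continuous_const.inner (hF.cont _)).measurable

/-- Boundedness makes a strongly continuous function jointly continuous. -/
theorem IsStrongCont.continuous_comp (hF : IsStrongCont F) {X : Type*} [TopologicalSpace X]
    {a : X → G} {u : X → H} (ha : Continuous a) (hu : Continuous u) :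
    Continuous fun p => F (a p) (u p) := by
  obtain ⟨C, hC⟩ := hF.bdd
  rw [continuous_iff_continuousAt]
  intro p
  rw [ContinuousAt, tendsto_iff_norm_sub_tendsto_zero]
  have h1 : Filter.Tendsto (fun q => C * ‖u q - u p‖ + ‖F (a q) (u p) - F (a p) (u p)‖)
      (nhds p) (nhds 0) := by
    have e1 : Continuous fun q => C * ‖u q - u p‖ + ‖F (a q) (u p) - F (a p) (u p)‖ := by
      exact ((hu.sub continuous_const).norm.const_smul C).add
        (((hF.cont (u p)).comp ha).sub continuous_const).norm
    simpa using e1.tendsto p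
  refine squeeze_zero (fun _ => norm_nonneg _) (fun q => ?_) h1
  calc ‖F (a q) (u q) - F (a p) (u p)‖
      = ‖F (a q) (u q - u p) + (F (a q) (u p) - F (a p) (u p))‖ := by rw [map_sub]; congr 1; abel
    _ ≤ _ := (norm_add_le _ _).trans (by gcongr; exact (F (a q)).le_of_opNorm_le (hC _) _)

theorem IsStrongCont.mul (hF : IsStrongCont F) (hF' : IsStrongCont F') :
    IsStrongCont fun g => F g * F' g where
  bdd := by
    obtain ⟨C, hC⟩ := hF.bdd
    obtain ⟨C', hC'⟩ := hF'.bdd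
    exact ⟨C * C', fun g => (norm_mul_le _ _).trans
      (mul_le_mul (hC g) (hC' g) (norm_nonneg _) ((norm_nonneg _).trans (hC g)))⟩
  cont _ := hF.continuous_comp continuous_id (hF'.cont _)

theorem isStrongCont_const (a : H →L[ℂ] H) : IsStrongCont fun _ : G => a where
  bdd := ⟨‖a‖, fun _ => le_rfl⟩
  cont _ := continuous_const

/-- Square integrable functions that are continuous with compact support. -/
def IsCc {E : Type*} [NormedAddCommGroup E] (μ : Measure G) (f : Lp E 2 μ) : Prop :=
  ∃ f₀ : G → E, Continuous f₀ ∧ HasCompactSupport f₀ ∧ f =ᵐ[μ] f₀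

/-- An indicator function of a set of finite measure is approximated through inner regularity,
which holds for the Haar measure `μ` as it is regular; `G` need not be σ-compact. -/
theorem dense_isCc {E : Type*} [NormedAddCommGroup E] [NormedSpace ℝ E] :
    Dense {f : Lp E 2 μ | IsCc μ f} := by
  intro f
  induction f using Lp.induction (show (2 : ENNReal) ≠ ⊤ by simp) with
  | isClosed => exact isClosed_closure
  | add hf hg _ h1 h2 =>
    refine map_mem_closure₂ continuous_add h1 h2 ?_
    rintro f ⟨f₀, hf1, hf2, hf3⟩ g ⟨g₀, hg1, hg2, hg3⟩
    exact ⟨f₀ + g₀, hf1.add hg1, hf2.add hg2, (Lp.coeFn_add f g).trans (hf3.add hg3)⟩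
  | @indicatorConst c t ht htμ =>
    rw [EMetric.mem_closure_iff]
    intro ε hε
    obtain ⟨ε', h1, h2⟩ := exists_between hε
    obtain ⟨η, ηpos, hη⟩ : ∃ η : NNReal, 0 < η ∧
        ∀ s : Set G, μ s ≤ η → eLpNorm (s.indicator fun _ => c) 2 μ ≤ ε' :=
      exists_eLpNorm_indicator_le ENNReal.ofNat_ne_top c h1.ne'
    have hη2 : (0 : ENNReal) < (η : ENNReal) / 2 := by simpa using ηpos.ne'
    obtain ⟨s, st, s_compact, s_closed, μs⟩ :
        ∃ s, s ⊆ t ∧ IsCompact s ∧ IsClosed s ∧ μ (t \ s) < η / 2 :=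
      ht.exists_isCompact_isClosed_sdiff_lt htμ.ne hη2.ne'
    have hsμ : μ s < ⊤ := (measure_mono st).trans_lt htμ
    obtain ⟨u, hsu, u_open, -, hu⟩ := s_closed.measurableSet.exists_isOpen_sdiff_lt hsμ.ne hη2.ne'
    obtain ⟨k, hk1, hk2, hk3, hk4⟩ := exists_continuous_one_zero_of_isCompact s_compact
      u_open.isClosed_compl (Set.disjoint_compl_right_iff_subset.2 hsu)
    have hkc : Continuous fun g => k g • c := k.continuous.smul continuous_const
    have hks : HasCompactSupport fun g => k g • c := hk3.smul_right
    have hkm : MemLp (fun g => k g • c) 2 μ := hkc.memLp_of_hasCompactSupport hks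
    refine ⟨hkm.toLp, ⟨_, hkc, hks, hkm.coeFn_toLp⟩, lt_of_le_of_lt ?_ h2⟩
    rw [Lp.edist_def]
    refine le_trans ?_ (hη ((t \ s) ∪ (u \ s)) ?_)
    · refine eLpNorm_mono_ae ?_
      rw [Lp.simpleFunc.coe_indicatorConst]
      filter_upwards [hkm.coeFn_toLp,
        indicatorConstLp_coeFn (p := 2) (hs := ht) (hμs := htμ.ne) (c := c)] with g hg hg'
      rw [Pi.sub_apply, hg, hg']
      by_cases hgs : g ∈ s
      · simp [hgs, st hgs, hk1 hgs]
      · by_cases hgt : g ∈ t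
        · have e1 : c - k g • c = (1 - k g) • c := by rw [sub_smul, one_smul]
          simp only [hgt, Set.indicator_of_mem, Set.mem_union, Set.mem_sdiff, hgs,
            not_false_eq_true, and_self, true_or, e1, norm_smul]
          refine mul_le_of_le_one_left (norm_nonneg _) ?_
          rw [Real.norm_eq_abs, abs_le]
          constructor <;> linarith [(hk4 g).1, (hk4 g).2]
        · by_cases hgu : g ∈ u
          · simp only [hgt, not_false_eq_true, Set.indicator_of_notMem, zero_sub, norm_neg,
              Set.mem_union, Set.mem_sdiff, hgu, hgs, and_self, or_true, Set.indicator_of_mem,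
              norm_smul]
            refine mul_le_of_le_one_left (norm_nonneg _) ?_
            rw [Real.norm_eq_abs, abs_le]
            constructor <;> linarith [(hk4 g).1, (hk4 g).2]
          · simp [hgt, hgu, hk2 (show g ∈ uᶜ from hgu)]
    · calc μ ((t \ s) ∪ (u \ s)) ≤ μ (t \ s) + μ (u \ s) := measure_union_le _ _
        _ ≤ η / 2 + η / 2 := add_le_add μs.le hu.le
        _ = η := ENNReal.add_halves _

theorem total_isCc : Total {f : L2 μ | IsCc μ f} :=
  (dense_isCc (μ := μ) (E := ℂ)).mono Submodule.subset_span

theorem IsStrongCont.memLp_apply (hF : IsStrongCont F) (u : Lp H 2 μ) :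
    MemLp (fun g => F g (u g)) 2 μ := by
  obtain ⟨C, hC⟩ := hF.bdd
  refine MemLp.of_le_mul (c := C) (Lp.memLp u) ?_
    (.of_forall fun g => (F g).le_of_opNorm_le (hC g) _)
  have hcc : ∀ v : Lp H 2 μ, IsCc μ v → AEStronglyMeasurable (fun g => F g (v g)) μ := by
    rintro v ⟨v₀, h1, h2, h3⟩
    have h4 : AEStronglyMeasurable (fun g => F g (v₀ g)) μ := by
      refine (hF.continuous_comp continuous_id h1).stronglyMeasurable_of_hasCompactSupport
        (h2.mono ?_) |>.aestronglyMeasurable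
      intro g hg hg'
      exact hg (by simp only [id_eq]; rw [hg', map_zero])
    refine h4.congr ?_
    filter_upwards [h3] with g hg
    rw [hg]
  obtain ⟨v, hv1, hv2⟩ := mem_closure_iff_seq_limit.1 (dense_isCc (μ := μ) (E := H) u)
  have h5 : TendstoInMeasure μ (fun n => (v n : G → H)) Filter.atTop u :=
    tendstoInMeasure_of_tendsto_Lp hv2
  obtain ⟨ns, -, h6⟩ := h5.exists_seq_tendsto_ae
  refine aestronglyMeasurable_of_tendsto_ae Filter.atTop (fun n => hcc (v (ns n)) (hv1 _)) ?_
  filter_upwards [h6] with g hg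
  exact ((F g).continuous.tendsto _).comp hg

theorem IsStrongCont.coeFn_decomposable (hF : IsStrongCont F) (w : H ⊗ʰ L2 μ) :
    toL2 μ (decomposable μ F w) =ᵐ[μ] fun g => F g (toL2 μ w g) := by
  have h := hF.memLp_apply (toL2 μ w)
  suffices toL2 μ (decomposable μ F w) = h.toLp from this ▸ h.coeFn_toLp
  refine ext_inner_left ℂ fun u => ?_
  obtain ⟨v, rfl⟩ := toL2_surjective μ u
  rw [inner_toL2, hF.isBddMeas.inner_decomposable, L2.inner_def]
  refine integral_congr_ae ?_
  filter_upwards [h.coeFn_toLp] with g hg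
  rw [hg]

theorem IsBddMeas.decomposable_mul (hF : IsBddMeas F) (hF' : IsStrongCont F')
    (hFF' : IsBddMeas fun g => F g * F' g) :
    decomposable μ F * decomposable μ F' = decomposable μ fun g => F g * F' g := by
  refine clm_ext_inner fun v w => ?_
  rw [mul_apply_eq_comp, hF.inner_decomposable, hFF'.inner_decomposable]
  refine integral_congr_ae ?_
  filter_upwards [hF'.coeFn_decomposable w] with g hg
  rw [hg, mul_apply_eq_comp]

theorem IsBddMeas.star (hF : IsBddMeas F) : IsBddMeas fun g => star (F g) where
  bdd := by simpa using hF.bdd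
  meas x y := by
    have := (Complex.continuous_conj.measurable).comp (hF.meas y x)
    simpa [ContinuousLinearMap.star_eq_adjoint, adjoint_inner_right, Function.comp_def] using this

theorem IsBddMeas.star_decomposable (hF : IsBddMeas F) :
    Star.star (decomposable μ F) = decomposable μ fun g => Star.star (F g) := by
  refine (IsDecomposed.eq_decomposable ?_).symm
  intro x y f k
  rw [ContinuousLinearMap.star_eq_adjoint, adjoint_inner_right, ← inner_conj_symm,
    hF.isDecomposed, ← integral_conj]
  refine integral_congr_ae (.of_forall fun g => ?_)
  beta_reduce
  rw [ContinuousLinearMap.star_eq_adjoint, adjoint_inner_right, map_mul, map_mul,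
    inner_conj_symm, Complex.conj_conj]
  ring

theorem decomposable_const (a : H →L[ℂ] H) : decomposable μ (fun _ => a) = opTensor a 1 := by
  refine IsDecomposed.eq_decomposable fun x y f k => ?_
  rw [opTensor_tmul, inner_tmul, integral_mul_const, mul_comm, L2.inner_def]
  congr 1
  refine integral_congr_ae (.of_forall fun g => ?_)
  simp [mul_comm]

theorem IsBddMeas.add (hF : IsBddMeas F) (hF' : IsBddMeas F') :
    IsBddMeas fun g => F g + F' g where
  bdd := by
    obtain ⟨C, hC⟩ := hF.bdd
    obtain ⟨C', hC'⟩ := hF'.bdd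
    exact ⟨C + C', fun g => (norm_add_le _ _).trans (add_le_add (hC g) (hC' g))⟩
  meas x y := by
    simp only [add_apply, inner_add_right]
    exact (hF.meas x y).add (hF'.meas x y)

theorem IsBddMeas.const_smul (hF : IsBddMeas F) (c : ℂ) : IsBddMeas fun g => c • F g where
  bdd := by
    obtain ⟨C, hC⟩ := hF.bdd
    exact ⟨‖c‖ * C, fun g => (norm_smul_le _ _).trans (by gcongr; exact hC g)⟩
  meas x y := by
    simpa [inner_smul_right] using (hF.meas x y).const_mul c

theorem IsBddMeas.decomposable_add (hF : IsBddMeas F) (hF' : IsBddMeas F') :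
    decomposable μ (fun g => F g + F' g) = decomposable μ F + decomposable μ F' := by
  refine clm_ext_inner fun v w => ?_
  obtain ⟨C, hC⟩ := hF.bdd
  obtain ⟨C', hC'⟩ := hF'.bdd
  rw [add_apply, inner_add_right, hF.inner_decomposable, hF'.inner_decomposable,
    (hF.add hF').inner_decomposable, ← integral_add (hF.norm_integral_le hC _ _).1
      (hF'.norm_integral_le hC' _ _).1]
  simp

theorem IsBddMeas.decomposable_smul (hF : IsBddMeas F) (c : ℂ) :
    decomposable μ (fun g => c • F g) = c • decomposable μ F := by
  refine clm_ext_inner fun v w => ?_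
  rw [smul_apply, inner_smul_right, hF.inner_decomposable,
    (hF.const_smul c).inner_decomposable, ← integral_const_mul]
  simp

end

section

variable {G : Type*} [Group G] [TopologicalSpace G] [IsTopologicalGroup G] [LocallyCompactSpace G]
  [MeasurableSpace G] [BorelSpace G] {μ : Measure G} [μ.IsHaarMeasure] [μ.Regular]
  {H H' : Type*} [NormedAddCommGroup H] [InnerProductSpace ℂ H] [CompleteSpace H]
  [NormedAddCommGroup H'] [InnerProductSpace ℂ H'] [CompleteSpace H']
  {F F' : G → (H →L[ℂ] H)}

/-! ### Weakly continuous families -/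

/-- A bounded and weakly continuous operator valued function. -/
structure IsWeakCont (F : G → (H →L[ℂ] H)) : Prop where
  bdd : ∃ C, ∀ g, ‖F g‖ ≤ C
  cont : ∀ x y, Continuous fun g => ⟪x, F g y⟫_ℂ

theorem IsWeakCont.isBddMeas (hF : IsWeakCont F) : IsBddMeas F where
  bdd := hF.bdd
  meas _ _ := (hF.cont _ _).measurable

theorem IsStrongCont.isWeakCont (hF : IsStrongCont F) : IsWeakCont F where
  bdd := hF.bdd
  cont _ _ := continuous_const.inner (hF.cont _)

theorem isClosed_setOf_continuous {X E : Type*} [TopologicalSpace X] [NormedAddCommGroup E]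
    (L : X → E → ℂ) (C : ℝ) (hL : ∀ g y y', ‖L g y - L g y'‖ ≤ C * ‖y - y'‖) :
    IsClosed {y | Continuous fun g => L g y} := by
  refine isClosed_of_closure_subset fun y hy => ?_
  refine continuous_of_uniform_approx_of_continuous fun s hs => ?_
  obtain ⟨ε, hε, hεs⟩ := Metric.mem_uniformity_dist.1 hs
  have hC : 0 < |C| + 1 := by positivity
  obtain ⟨y', hy', h⟩ := Metric.mem_closure_iff.1 hy (ε / (|C| + 1)) (by positivity)
  refine ⟨_, hy', fun g => hεs ?_⟩
  rw [dist_eq_norm] at h ⊢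
  calc ‖L g y - L g y'‖ ≤ C * ‖y - y'‖ := hL g y y'
    _ ≤ (|C| + 1) * ‖y - y'‖ := by gcongr; linarith [le_abs_self C]
    _ < (|C| + 1) * (ε / (|C| + 1)) := by gcongr
    _ = ε := by field_simp

/-- For a bounded family, weak continuity may be checked on total sets of vectors. -/
theorem isWeakCont_of_total {X : Type*} [TopologicalSpace X] {F : X → (H →L[ℂ] H)}
    {S T : Set H} (hS : Total S) (hT : Total T) {C : ℝ} (hC : ∀ g, ‖F g‖ ≤ C)
    (h : ∀ x ∈ S, ∀ y ∈ T, Continuous fun g => ⟪x, F g y⟫_ℂ) (x y : H) :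
    Continuous fun g => ⟪x, F g y⟫_ℂ := by
  have h1 : ∀ x ∈ S, ∀ y, Continuous fun g => ⟪x, F g y⟫_ℂ := by
    intro x hx y
    let N : Submodule ℂ H :=
      { carrier := {y | Continuous fun g => ⟪x, F g y⟫_ℂ}
        add_mem' := fun {a b} ha hb => by
          have := Continuous.add (Set.mem_ofPred.1 ha) (Set.mem_ofPred.1 hb)
          simpa [inner_add_right, Pi.add_def] using this
        zero_mem' := by simpa using continuous_const
        smul_mem' := fun c a ha => by
          have := (continuous_const (y := c)).mul (Set.mem_ofPred.1 ha)
          simpa [inner_smul_right, Pi.mul_def] using this }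
    refine hT.mem_of_isClosed N (isClosed_setOf_continuous (fun g y => ⟪x, F g y⟫_ℂ) (‖x‖ * C)
      fun g y y' => ?_) (fun y hy => h x hx y hy) y
    rw [← inner_sub_right, ← map_sub, mul_assoc]
    exact (norm_inner_le_norm _ _).trans (by gcongr; exact (F g).le_of_opNorm_le (hC g) _)
  let N : Submodule ℂ H :=
    { carrier := {x | Continuous fun g => ⟪x, F g y⟫_ℂ}
      add_mem' := fun {a b} ha hb => by
        have := Continuous.add (Set.mem_ofPred.1 ha) (Set.mem_ofPred.1 hb)
        simpa [inner_add_left, Pi.add_def] using this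
      zero_mem' := by simpa using continuous_const
      smul_mem' := fun c a ha => by
        have := (Set.mem_ofPred.1 ha).mul (continuous_const (y := starRingEnd ℂ c))
        simpa [inner_smul_left, Pi.mul_def] using this }
  refine hS.mem_of_isClosed N (isClosed_setOf_continuous (fun g x => ⟪x, F g y⟫_ℂ) (C * ‖y‖)
    fun g x x' => ?_) (fun x hx => h1 x hx y) x
  rw [← inner_sub_left, mul_comm]
  exact (norm_inner_le_norm _ _).trans (by gcongr; exact (F g).le_of_opNorm_le (hC g) _)

/-- A weakly continuous family is determined by its decomposable operator. -/
theorem IsWeakCont.decomposable_injective (hF : IsWeakCont F) (hF' : IsWeakCont F')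
    (h : decomposable μ F = decomposable μ F') : F = F' := by
  funext g₀
  refine clm_ext_inner fun x y => ?_
  -- The coefficients of both operators at `x ⊗ φ c` and `y ⊗ φ`, for a cutoff function `φ` at `g₀`,
  -- agree, so that `∫ φ² |c|² = 0`; hence `c` vanishes at `g₀`.
  set c : G → ℂ := fun g => ⟪x, F g y⟫_ℂ - ⟪x, F' g y⟫_ℂ with hc
  have hcc : Continuous c := (hF.cont x y).sub (hF'.cont x y)
  by_contra hne
  have hne' : c g₀ ≠ 0 := sub_ne_zero.2 hne
  obtain ⟨φ, hφ1, -, hφ3, hφ4⟩ := exists_continuous_one_zero_of_isCompact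
    (isCompact_singleton (x := g₀)) isClosed_empty (Set.disjoint_empty _)
  have hφg : φ g₀ = 1 := hφ1 rfl
  have hkc : Continuous fun g => (φ g : ℂ) := by fun_prop
  have hks : HasCompactSupport fun g => (φ g : ℂ) := hφ3.comp_left (g := fun r : ℝ => (r : ℂ)) rfl
  have hk : MemLp (fun g => (φ g : ℂ)) 2 μ := hkc.memLp_of_hasCompactSupport hks
  have hfc : Continuous fun g => (φ g : ℂ) * c g := hkc.mul hcc
  have hf : MemLp (fun g => (φ g : ℂ) * c g) 2 μ :=
    hfc.memLp_of_hasCompactSupport hks.mul_right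
  obtain ⟨C, hC⟩ := hF.bdd
  obtain ⟨C', hC'⟩ := hF'.bdd
  let f' : L2 μ := hf.toLp
  let k' : L2 μ := hk.toLp
  have h1 := hF.isBddMeas.isDecomposed (μ := μ) x y f' k'
  rw [h, hF'.isBddMeas.isDecomposed] at h1
  have e : ∀ {F : G → (H →L[ℂ] H)},
      ∫ g, starRingEnd ℂ (f' g) * k' g * ⟪x, F g y⟫_ℂ ∂μ =
        ∫ g, starRingEnd ℂ ((φ g : ℂ) * c g) * (φ g : ℂ) * ⟪x, F g y⟫_ℂ ∂μ := fun {F} => by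
    refine integral_congr_ae ?_
    filter_upwards [hf.coeFn_toLp, hk.coeFn_toLp] with g h1 h2
    rw [h1, h2]
  rw [e, e] at h1
  have hint : ∀ {F : G → (H →L[ℂ] H)}, IsWeakCont F → Integrable (fun g =>
      starRingEnd ℂ ((φ g : ℂ) * c g) * (φ g : ℂ) * ⟪x, F g y⟫_ℂ) μ := fun {F} hF => by
    refine Continuous.integrable_of_hasCompactSupport ?_ (hks.mul_left.mul_right)
    exact ((Complex.continuous_conj.comp hfc).mul hkc).mul (hF.cont x y)
  have h2 : ∫ g, ((φ g) ^ 2 * ‖c g‖ ^ 2 : ℝ) ∂μ = 0 := by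
    have h3 := sub_eq_zero.2 h1.symm
    rw [← integral_sub (hint hF) (hint hF')] at h3
    have h4 : ((∫ g, ((φ g) ^ 2 * ‖c g‖ ^ 2 : ℝ) ∂μ : ℝ) : ℂ) = 0 := by
      rw [← integral_complex_ofReal, ← h3]
      refine integral_congr_ae (.of_forall fun g => ?_)
      beta_reduce
      rw [← mul_sub]
      change _ = _ * c g
      rw [map_mul, Complex.conj_ofReal]
      push_cast
      rw [← Complex.conj_mul']
      ring
    exact_mod_cast h4
  have h5 : 0 < ∫ g, ((φ g) ^ 2 * ‖c g‖ ^ 2 : ℝ) ∂μ := by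
    refine Continuous.integral_pos_of_hasCompactSupport_nonneg_nonzero (x := g₀) (by fun_prop) ?_
      (fun g => by positivity) ?_
    · exact (hφ3.comp_left (g := fun r : ℝ => r ^ 2) (by simp)).mul_right
    · rw [hφg]; simpa using hne'
  exact h5.ne' h2

theorem IsDecomposed.conjBy_opTensor {T : H ⊗ʰ L2 μ →L[ℂ] H ⊗ʰ L2 μ} (h : IsDecomposed μ F T)
    (U : H →L[ℂ] H') :
    IsDecomposed μ (fun g => conjBy U (F g)) (conjBy (opTensor U (1 : L2 μ →L[ℂ] L2 μ)) T) := by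
  intro x y f k
  have h1 : adjoint (1 : L2 μ →L[ℂ] L2 μ) = 1 := star_one _
  rw [inner_conjBy, adjoint_opTensor, opTensor_tmul, opTensor_tmul, h1, one_apply_eq_self,
    one_apply_eq_self, h]
  simp only [inner_conjBy]

/-! ### Multiplication operators -/

/-- The operator of multiplication by a bounded measurable function. -/
def mulOp (μ : Measure G) [μ.IsHaarMeasure] [μ.Regular] (c : G → ℂ) : L2 μ →L[ℂ] L2 μ :=
  sliceLeft (decomposable μ fun g => c g • (1 : ℂ →L[ℂ] ℂ)) 1 1

theorem isBddMeas_smul_one {c : G → ℂ} (hc : Measurable c) {C : ℝ} (hC : ∀ g, ‖c g‖ ≤ C) :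
    IsBddMeas fun g => c g • (1 : ℂ →L[ℂ] ℂ) where
  bdd := ⟨C, fun g => by simpa [norm_smul] using hC g⟩
  meas x y := by simpa using (hc.mul_const y).mul_const _

theorem inner_mulOp {c : G → ℂ} (hc : Measurable c) {C : ℝ} (hC : ∀ g, ‖c g‖ ≤ C) (f k : L2 μ) :
    ⟪f, mulOp μ c k⟫_ℂ = ∫ g, starRingEnd ℂ (f g) * k g * c g ∂μ := by
  rw [mulOp, inner_sliceLeft, (isBddMeas_smul_one hc hC).isDecomposed]
  simp

theorem coeFn_mulOp {c : G → ℂ} (hc : Measurable c) {C : ℝ} (hC : ∀ g, ‖c g‖ ≤ C) (k : L2 μ) :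
    mulOp μ c k =ᵐ[μ] fun g => c g * k g := by
  have h : MemLp (fun g => c g * k g) 2 μ :=
    MemLp.of_le_mul (c := C) (Lp.memLp k)
      (hc.aestronglyMeasurable.mul (Lp.aestronglyMeasurable k))
      (.of_forall fun g => by rw [norm_mul]; gcongr; exact hC g)
  suffices mulOp μ c k = h.toLp from this ▸ h.coeFn_toLp
  refine ext_inner_left ℂ fun f => ?_
  rw [inner_mulOp hc hC, L2.inner_def]
  refine integral_congr_ae ?_
  filter_upwards [h.coeFn_toLp] with g hg
  rw [hg]
  simp
  ring

/-- The generators of `L^∞(G)` form a set that is closed under adjoints. -/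
theorem linfVN_star_mem :
    ∀ T ∈ {T : L2 μ →L[ℂ] L2 μ | ∃ f : G → ℂ, Measurable f ∧ (∃ C : ℝ, ∀ g, ‖f g‖ ≤ C) ∧
        ∀ ξ : L2 μ, T ξ =ᵐ[μ] fun g => f g * ξ g},
      star T ∈ {T : L2 μ →L[ℂ] L2 μ | ∃ f : G → ℂ, Measurable f ∧ (∃ C : ℝ, ∀ g, ‖f g‖ ≤ C) ∧
        ∀ ξ : L2 μ, T ξ =ᵐ[μ] fun g => f g * ξ g} := by
  rintro T ⟨c, hc, ⟨C, hC⟩, hT⟩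
  have hc' : Measurable fun g => starRingEnd ℂ (c g) := Complex.continuous_conj.measurable.comp hc
  have hC' : ∀ g, ‖starRingEnd ℂ (c g)‖ ≤ C := fun g => by simpa using hC g
  have : star T = mulOp μ fun g => starRingEnd ℂ (c g) := by
    refine clm_ext_inner fun f k => ?_
    rw [inner_mulOp hc' hC', ContinuousLinearMap.star_eq_adjoint, adjoint_inner_right, L2.inner_def]
    refine integral_congr_ae ?_
    filter_upwards [hT f] with g hg
    rw [hg]
    simp
    ring
  exact ⟨_, hc', ⟨C, hC'⟩, fun ξ => this ▸ coeFn_mulOp hc' hC' ξ⟩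

theorem mulOp_mem_linfVN {c : G → ℂ} (hc : Measurable c) {C : ℝ} (hC : ∀ g, ‖c g‖ ≤ C) :
    mulOp μ c ∈ linfVN μ :=
  mem_generated_of_mem linfVN_star_mem ⟨c, hc, ⟨C, hC⟩, coeFn_mulOp hc hC⟩

/-! ### Approximation by finitely valued families -/

/-- Finitely many of the neighbourhoods on which `P g` holds cover the compact set; `τ` is constant on
the pieces of a measurable refinement. -/
theorem exists_simpleFunc_of_eventually {P : G → G → Prop} (hP : ∀ g, ∀ᶠ g' in nhds g, P g g')
    {K : Set G} (hK : IsCompact K) : ∃ τ : SimpleFunc G G, ∀ g ∈ K, P (τ g) g := by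
  suffices ∃ S, MeasurableSet S ∧ K ⊆ S ∧ ∃ τ : SimpleFunc G G, ∀ g ∈ S, P (τ g) g by
    obtain ⟨S, -, hS, τ, hτ⟩ := this
    exact ⟨τ, fun g hg => hτ g (hS hg)⟩
  refine hK.induction_on
    (p := fun K => ∃ S, MeasurableSet S ∧ K ⊆ S ∧ ∃ τ : SimpleFunc G G, ∀ g ∈ S, P (τ g) g)
    ⟨∅, .empty, subset_rfl, SimpleFunc.const G 1, by simp⟩ ?_ ?_ ?_
  · rintro s t hst ⟨S, h1, h2, h3⟩
    exact ⟨S, h1, hst.trans h2, h3⟩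
  · rintro s t ⟨S, hS1, hS2, τ, hτ⟩ ⟨S', hS1', hS2', τ', hτ'⟩
    classical
    refine ⟨S ∪ S', hS1.union hS1', Set.union_subset_union hS2 hS2',
      SimpleFunc.piecewise S hS1 τ τ', fun g hg => ?_⟩
    rw [SimpleFunc.piecewise_apply]
    split_ifs with h
    · exact hτ g h
    · exact hτ' g (hg.resolve_left h)
  · intro g _
    obtain ⟨U, hU1, hU2, hU3⟩ := eventually_nhds_iff.1 (hP g)
    exact ⟨U, mem_nhdsWithin_of_mem_nhds (hU2.mem_nhds hU3), U, hU2.measurableSet, subset_rfl,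
      SimpleFunc.const G g, fun g' hg' => hU1 g' hg'⟩

theorem isBddMeas_comp_simpleFunc (hF : ∃ C, ∀ g, ‖F g‖ ≤ C) (τ : SimpleFunc G G) :
    IsBddMeas fun g => F (τ g) where
  bdd := hF.imp fun _ h g => h (τ g)
  meas x y := (τ.map fun g => ⟪x, F g y⟫_ℂ).measurable

/-- A decomposable operator with finitely many values is a finite sum of elementary tensors. -/
theorem decomposable_comp_simpleFunc (F : G → (H →L[ℂ] H)) (τ : SimpleFunc G G) :
    decomposable μ (fun g => F (τ g)) =
      ∑ s ∈ τ.range, opTensor (F s) (mulOp μ ((τ ⁻¹' {s}).indicator fun _ => 1)) := by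
  have h1 : ∀ s, Measurable ((τ ⁻¹' {s}).indicator fun _ => (1 : ℂ)) := fun s =>
    measurable_const.indicator (τ.measurableSet_fiber s)
  have h2 : ∀ s g, ‖(τ ⁻¹' {s}).indicator (fun _ => (1 : ℂ)) g‖ ≤ 1 := fun s g => by
    by_cases h : g ∈ τ ⁻¹' {s} <;> simp only [h, Set.indicator_of_mem,
      Set.indicator_of_notMem, not_false_eq_true] <;> simp
  refine IsDecomposed.eq_decomposable fun x y f k => ?_
  rw [sum_apply, inner_sum]
  simp only [opTensor_tmul, inner_tmul, inner_mulOp (h1 _) (h2 _)]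
  simp only [← integral_const_mul]
  rw [← integral_finsetSum]
  · refine integral_congr_ae (.of_forall fun g => ?_)
    beta_reduce
    rw [Finset.sum_eq_single (τ g)]
    · simp; ring
    · intro s _ hs
      have : g ∉ τ ⁻¹' {s} := fun h => hs (by simpa using h.symm)
      simp [this]
    · intro h; exact absurd (τ.mem_range_self g) h
  · intro s _
    have := (isBddMeas_smul_one (h1 s) (h2 s)).norm_integral_le (μ := μ) (C := 1)
      (fun g => by simpa [norm_smul] using h2 s g) f k
    refine (this.1.congr (.of_forall fun g => ?_)).const_mul _
    simp
    ring

theorem norm_toLp_indicator {K : Set G} (hK : IsCompact K) (hKm : MeasurableSet K) {η : ℝ}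
    (hη : 0 ≤ η) : ∃ h : MemLp (K.indicator fun _ => η) 2 μ,
      ‖h.toLp‖ = η * (μ.real K) ^ (1 / (2 : ℝ)) := by
  refine ⟨memLp_indicator_const 2 hKm η (.inr hK.measure_lt_top.ne), ?_⟩
  change ‖indicatorConstLp 2 hKm hK.measure_lt_top.ne η‖ = _
  rw [norm_indicatorConstLp (by simp) (by simp), Real.norm_of_nonneg hη]
  simp

/-- A decomposable operator with strongly continuous family is approximated on any two
vectors by those with finitely many values. -/
theorem IsStrongCont.exists_approx (hF : IsStrongCont F) (w₁ w₂ : H ⊗ʰ L2 μ) {ε : ℝ}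
    (hε : 0 < ε) : ∃ τ : SimpleFunc G G,
      ‖(decomposable μ F - decomposable μ fun g => F (τ g)) w₁‖ ≤ ε ∧
      ‖(decomposable μ F - decomposable μ fun g => F (τ g)) w₂‖ ≤ ε := by
  obtain ⟨C, hC⟩ := hF.bdd
  have hC0 : 0 ≤ C := (norm_nonneg _).trans (hC 1)
  have hcc : ∀ w : H ⊗ʰ L2 μ, ∃ v, ‖w - v‖ ≤ ε / (4 * (C + 1)) ∧ ∃ v₀ : G → H, Continuous v₀ ∧
      HasCompactSupport v₀ ∧ toL2 μ v =ᵐ[μ] v₀ := fun w => by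
    obtain ⟨u, hu, h⟩ := Metric.mem_closure_iff.1 (dense_isCc (μ := μ) (E := H) (toL2 μ w))
      (ε / (4 * (C + 1))) (by positivity)
    obtain ⟨v, rfl⟩ := toL2_surjective μ u
    refine ⟨v, ?_, hu⟩
    rw [dist_eq_norm, ← map_sub, norm_toL2] at h
    exact h.le
  obtain ⟨v₁, hv₁, u₁, hu₁c, hu₁s, hu₁⟩ := hcc w₁
  obtain ⟨v₂, hv₂, u₂, hu₂c, hu₂s, hu₂⟩ := hcc w₂
  set K := tsupport u₁ ∪ tsupport u₂ with hKdef
  have hK : IsCompact K := hu₁s.isCompact.union hu₂s.isCompact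
  have hKm : MeasurableSet K :=
    ((isClosed_tsupport _).union (isClosed_tsupport _)).measurableSet
  set R := (μ.real K) ^ (1 / (2 : ℝ)) with hR
  have hR0 : 0 ≤ R := by positivity
  set η := ε / (2 * (R + 1)) with hη
  have hη0 : 0 < η := by positivity
  obtain ⟨τ, hτ⟩ := exists_simpleFunc_of_eventually
    (P := fun g g' => ‖F g' (u₁ g') - F g (u₁ g')‖ < η ∧ ‖F g' (u₂ g') - F g (u₂ g')‖ < η)
    (fun g => by
      have h : ∀ u : G → H, Continuous u → ∀ᶠ g' in nhds g, ‖F g' (u g') - F g (u g')‖ < η := by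
        intro u hu
        have h1 : Continuous fun g' => ‖F g' (u g') - F g (u g')‖ :=
          ((hF.continuous_comp continuous_id hu).sub ((F g).continuous.comp hu)).norm
        exact h1.continuousAt.eventually_lt continuousAt_const (by simpa using hη0)
      exact (h u₁ hu₁c).and (h u₂ hu₂c)) hK
  refine ⟨τ, ?_⟩
  have hB := isBddMeas_comp_simpleFunc hF.bdd τ
  have hD := hF.isBddMeas.add (hB.const_smul (-1))
  have hCD : ∀ g, ‖F g + (-1 : ℂ) • F (τ g)‖ ≤ 2 * C := fun g => by
    refine (norm_add_le _ _).trans ?_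
    rw [norm_smul]
    simp only [norm_neg, norm_one, one_mul]
    linarith [hC g, hC (τ g)]
  have hDD : decomposable μ F - decomposable μ (fun g => F (τ g)) =
      decomposable μ fun g => F g + (-1 : ℂ) • F (τ g) := by
    rw [hF.isBddMeas.decomposable_add (hB.const_smul (-1)), hB.decomposable_smul, neg_one_smul,
      sub_eq_add_neg]
  obtain ⟨hm, hmn⟩ := norm_toLp_indicator (μ := μ) hK hKm hη0.le
  have main : ∀ (w v : H ⊗ʰ L2 μ) (u : G → H), ‖w - v‖ ≤ ε / (4 * (C + 1)) →
      toL2 μ v =ᵐ[μ] u → tsupport u ⊆ K → (∀ g ∈ K, ‖F g (u g) - F (τ g) (u g)‖ < η) →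
      ‖(decomposable μ F - decomposable μ fun g => F (τ g)) w‖ ≤ ε := by
    intro w v u hwv hvu huK hu
    rw [hDD]
    have h1 : ‖decomposable μ (fun g => F g + (-1 : ℂ) • F (τ g)) v‖ ≤ η * R := by
      rw [hR, ← hmn]
      refine hD.norm_decomposable_apply_le v hm ?_
      filter_upwards [hvu] with g hg
      rw [hg]
      by_cases hgK : g ∈ K
      · simpa [hgK, sub_eq_add_neg] using (hu g hgK).le
      · have : u g = 0 := image_eq_zero_of_notMem_tsupport fun h => hgK (huK h)
        simp [hgK, this]
    have h2 : ‖decomposable μ (fun g => F g + (-1 : ℂ) • F (τ g)) (w - v)‖ ≤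
        2 * C * (ε / (4 * (C + 1))) :=
      (ContinuousLinearMap.le_of_opNorm_le _ (hD.norm_decomposable_le hCD) _).trans (by gcongr)
    have h3 : η * R ≤ ε / 2 := by
      rw [hη, div_mul_eq_mul_div, div_le_div_iff₀ (by positivity) (by positivity)]
      nlinarith
    have h4 : 2 * C * (ε / (4 * (C + 1))) ≤ ε / 2 := by
      rw [mul_div_assoc', div_le_div_iff₀ (by positivity) (by positivity)]
      nlinarith
    calc _ = ‖decomposable μ (fun g => F g + (-1 : ℂ) • F (τ g)) (w - v) +
          decomposable μ (fun g => F g + (-1 : ℂ) • F (τ g)) v‖ := by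
            rw [← map_add, sub_add_cancel]
      _ ≤ ε := (norm_add_le _ _).trans (by linarith)
  exact ⟨main w₁ v₁ u₁ hv₁ hu₁ Set.subset_union_left fun g hg => (hτ g hg).1,
    main w₂ v₂ u₂ hv₂ hu₂ Set.subset_union_right fun g hg => (hτ g hg).2⟩

/-- A decomposable operator given by a strongly continuous function with values in `A` belongs to
`A ⊗ L^∞(G)`. -/
theorem IsStrongCont.decomposable_mem {A : VonNeumannAlgebra H} (hF : IsStrongCont F)
    (hA : ∀ g, F g ∈ A) : decomposable μ F ∈ vnTensor A (linfVN μ) := by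
  rw [mem_vnTensor_iff]
  intro T hT
  have hτ : ∀ τ : SimpleFunc G G, T * decomposable μ (fun g => F (τ g)) =
      decomposable μ (fun g => F (τ g)) * T := fun τ => by
    rw [decomposable_comp_simpleFunc F, Finset.mul_sum, Finset.sum_mul]
    refine Finset.sum_congr rfl fun s _ => (hT _ (hA s) _ ?_).symm
    refine mulOp_mem_linfVN (measurable_const.indicator (τ.measurableSet_fiber s)) (C := 1)
      fun g => ?_
    by_cases h : g ∈ τ ⁻¹' {s} <;> simp only [h, Set.indicator_of_mem,
      Set.indicator_of_notMem, not_false_eq_true] <;> simp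
  ext w
  rw [mul_apply_eq_comp, mul_apply_eq_comp, ← sub_eq_zero, ← norm_le_zero_iff]
  refine le_of_forall_pos_le_add fun ε hε => ?_
  obtain ⟨τ, h1, h2⟩ := hF.exists_approx w (T w) (ε := ε / (‖T‖ + 1)) (by positivity)
  have h3 := DFunLike.congr_fun (hτ τ) w
  rw [mul_apply_eq_comp, mul_apply_eq_comp] at h3
  rw [sub_apply] at h1 h2
  have h4 : T (decomposable μ F w) - decomposable μ F (T w) =
      T (decomposable μ F w - decomposable μ (fun g => F (τ g)) w) -
        (decomposable μ F (T w) - decomposable μ (fun g => F (τ g)) (T w)) := by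
    rw [map_sub, h3]; abel
  rw [h4, zero_add]
  calc _ ≤ ‖T‖ * (ε / (‖T‖ + 1)) + ε / (‖T‖ + 1) :=
        (norm_sub_le _ _).trans (add_le_add ((T.le_opNorm _).trans (by gcongr)) h2)
    _ = ε := by field_simp

end

/-! ### Order and suprema in von Neumann algebras -/

section

variable {H K : Type*} [NormedAddCommGroup H] [InnerProductSpace ℂ H] [CompleteSpace H]
  [NormedAddCommGroup K] [InnerProductSpace ℂ K] [CompleteSpace K]
  {A : VonNeumannAlgebra H}

theorem re_inner_nonneg {T : H →L[ℂ] H} (hT : 0 ≤ T) (ξ : H) : 0 ≤ (⟪ξ, T ξ⟫_ℂ).re :=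
  ((ContinuousLinearMap.nonneg_iff_isPositive T).1 hT).re_inner_nonneg_right ξ

theorem re_inner_mono {S T : H →L[ℂ] H} (h : S ≤ T) (ξ : H) :
    (⟪ξ, S ξ⟫_ℂ).re ≤ (⟪ξ, T ξ⟫_ℂ).re := by
  have := re_inner_nonneg (sub_nonneg.2 h) ξ
  rw [sub_apply, inner_sub_right, Complex.sub_re] at this
  linarith

theorem le_of_re_inner {S T : H →L[ℂ] H} (hS : IsSelfAdjoint S) (hT : IsSelfAdjoint T)
    (h : ∀ ξ, (⟪ξ, S ξ⟫_ℂ).re ≤ (⟪ξ, T ξ⟫_ℂ).re) : S ≤ T := by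
  rw [← sub_nonneg, ContinuousLinearMap.nonneg_iff_isPositive,
    ContinuousLinearMap.isPositive_def']
  refine ⟨hT.sub hS, fun ξ => ?_⟩
  have h1 : (⟪(T - S) ξ, ξ⟫_ℂ).re = (⟪ξ, (T - S) ξ⟫_ℂ).re := by
    rw [← inner_conj_symm, Complex.conj_re]
  change 0 ≤ (⟪(T - S) ξ, ξ⟫_ℂ).re
  rw [h1, sub_apply, inner_sub_right, Complex.sub_re]
  linarith [h ξ]

/-- If `0 ≤ T ≤ 1`, then `T² ≤ T`. -/
theorem norm_sq_apply_le {T : H →L[ℂ] H} (h0 : 0 ≤ T) (h1 : T ≤ 1) (ξ : H) :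
    ‖T ξ‖ ^ 2 ≤ (⟪ξ, T ξ⟫_ℂ).re := by
  have hsa : IsSelfAdjoint (CFC.sqrt T) := IsSelfAdjoint.of_nonneg (CFC.sqrt_nonneg T)
  have hs : CFC.sqrt T * CFC.sqrt T = T := CFC.sqrt_mul_sqrt_self T h0
  have key : ∀ ζ, ‖CFC.sqrt T ζ‖ ^ 2 = (⟪ζ, T ζ⟫_ℂ).re := fun ζ => by
    rw [← hs, mul_apply_eq_comp, hs, ← adjoint_inner_left, ← ContinuousLinearMap.star_eq_adjoint,
      hsa.star_eq, inner_self_eq_norm_sq_to_K]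
    norm_cast
  rw [← key]
  have h2 : T ξ = CFC.sqrt T (CFC.sqrt T ξ) := by rw [← mul_apply_eq_comp, hs]
  rw [h2, key]
  refine (re_inner_mono h1 _).trans (le_of_eq ?_)
  rw [one_apply_eq_self, inner_self_eq_norm_sq_to_K]
  norm_cast

/-- The positive square root of an element of a von Neumann algebra belongs to the algebra, because
it commutes with the commutant. -/
theorem exists_mul_self_eq (a : A.toStarSubalgebra) (ha : 0 ≤ (a : H →L[ℂ] H)) :
    ∃ b : A.toStarSubalgebra, IsSelfAdjoint b ∧ b * b = a := by
  have h1 : CFC.sqrt (a : H →L[ℂ] H) ∈ A := mem_of_forall_commute fun T hT => by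
    have h2 : Commute (a : H →L[ℂ] H) T := (commute_of_mem a.2 hT).symm
    exact (h2.cfcₙ_nnreal NNReal.sqrt).eq.symm
  refine ⟨⟨_, h1⟩, ?_, ?_⟩
  · exact Subtype.ext (IsSelfAdjoint.of_nonneg (CFC.sqrt_nonneg (a : H →L[ℂ] H))).star_eq
  · exact Subtype.ext (CFC.sqrt_mul_sqrt_self (a : H →L[ℂ] H) ha)

section Hom

variable (φ : A.toStarSubalgebra →⋆ₐ[ℂ] (K →L[ℂ] K))

theorem starAlgHom_nonneg {a : A.toStarSubalgebra} (ha : 0 ≤ (a : H →L[ℂ] H)) : 0 ≤ φ a := by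
  obtain ⟨b, hb, rfl⟩ := exists_mul_self_eq a ha
  nth_rewrite 1 [← hb.star_eq]
  rw [map_mul, map_star]
  exact star_mul_self_nonneg _

theorem starAlgHom_mono {a b : A.toStarSubalgebra} (h : (a : H →L[ℂ] H) ≤ b) : φ a ≤ φ b := by
  rw [← sub_nonneg, ← map_sub]
  exact starAlgHom_nonneg φ (by simpa using h)

theorem isClosed_vonNeumannAlgebra (A : VonNeumannAlgebra H) :
    IsClosed (A.toStarSubalgebra : Set (H →L[ℂ] H)) := by
  have h := A.centralizer_centralizer'
  have h2 : (A.toStarSubalgebra : Set (H →L[ℂ] H)) =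
    Set.centralizer (Set.centralizer (A.toStarSubalgebra : Set (H →L[ℂ] H))) := h.symm
  rw [h2]
  exact Set.isClosed_centralizer _

theorem norm_starAlgHom_le (a : A.toStarSubalgebra) : ‖φ a‖ ≤ ‖(a : H →L[ℂ] H)‖ := by
  have : IsClosed (A.toStarSubalgebra : Set (H →L[ℂ] H)) := isClosed_vonNeumannAlgebra A
  exact NonUnitalStarAlgHom.norm_apply_le φ a

end Hom

/-- A bounded family of operators with convergent matrix coefficients converges weakly. -/
theorem exists_clm_of_tendsto {ι : Type*} {l : Filter ι} [l.NeBot] {Y : ι → (H →L[ℂ] H)} {C : ℝ}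
    (hC : ∀ᶠ i in l, ‖Y i‖ ≤ C)
    (h : ∀ u v, ∃ c, Filter.Tendsto (fun i => ⟪u, Y i v⟫_ℂ) l (nhds c)) :
    ∃ T : H →L[ℂ] H, ∀ u v, Filter.Tendsto (fun i => ⟪u, Y i v⟫_ℂ) l (nhds ⟪u, T v⟫_ℂ) := by
  choose b hb using h
  obtain ⟨T, hT⟩ := exists_clm_of_form b
    (fun x x' y => tendsto_nhds_unique (hb _ _)
      (by simpa [inner_add_left] using (hb x y).add (hb x' y)))
    (fun c x y => tendsto_nhds_unique (hb _ _)
      (by simpa [inner_smul_left, mul_comm] using (hb x y).const_mul (starRingEnd ℂ c)))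
    (fun x y y' => tendsto_nhds_unique (hb _ _)
      (by simpa [inner_add_right] using (hb x y).add (hb x y')))
    (fun c x y => tendsto_nhds_unique (hb _ _)
      (by simpa [inner_smul_right] using (hb x y).const_mul c))
    (C := C) (fun x y => le_of_tendsto (hb x y).norm (by
      filter_upwards [hC] with i hi
      calc ‖⟪x, Y i y⟫_ℂ‖ ≤ ‖x‖ * ‖Y i y‖ := norm_inner_le_norm _ _
        _ ≤ ‖x‖ * (C * ‖y‖) := by gcongr; exact (Y i).le_of_opNorm_le hi _
        _ = _ := by ring))
  exact ⟨T, fun u v => hT u v ▸ hb u v⟩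

/-- A bounded increasing net of self-adjoint elements of a von Neumann algebra has a supremum,
which is its weak limit. -/
theorem exists_isLUB {D : Set A.toStarSubalgebra} (hne : D.Nonempty)
    (hsa : ∀ x ∈ D, IsSelfAdjoint x)
    (hdir : DirectedOn (fun x y : A.toStarSubalgebra => (x : H →L[ℂ] H) ≤ (y : H →L[ℂ] H)) D)
    {b : H →L[ℂ] H} (hb : ∀ x ∈ D, (x : H →L[ℂ] H) ≤ b) :
    ∃ s : A.toStarSubalgebra, IsSelfAdjoint s ∧
      ∀ ξ : H, IsLUB ((fun x : A.toStarSubalgebra => (⟪ξ, (x : H →L[ℂ] H) ξ⟫_ℂ).re) '' D)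
        (⟪ξ, (s : H →L[ℂ] H) ξ⟫_ℂ).re := by
  obtain ⟨x₀, hx₀⟩ := hne
  let Y : D → (H →L[ℂ] H) := fun x => (x : A.toStarSubalgebra)
  have : Nonempty D := ⟨⟨x₀, hx₀⟩⟩
  let : Preorder D := Preorder.lift Y
  have : IsDirectedOrder D := ⟨fun x y => by
    obtain ⟨z, hz, h1, h2⟩ := hdir x x.2 y y.2
    exact ⟨⟨z, hz⟩, h1, h2⟩⟩
  have hYsa : ∀ x, IsSelfAdjoint (Y x) := fun x => congrArg Subtype.val (hsa x x.2).star_eq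
  have hmono : ∀ ξ, Monotone fun x => (⟪ξ, Y x ξ⟫_ℂ).re := fun ξ x y hxy => re_inner_mono hxy ξ
  have hbdd : ∀ ξ, BddAbove (Set.range fun x => (⟪ξ, Y x ξ⟫_ℂ).re) := fun ξ =>
    ⟨(⟪ξ, b ξ⟫_ℂ).re, by rintro _ ⟨x, rfl⟩; exact re_inner_mono (hb x x.2) ξ⟩
  have hre : ∀ ξ, ∃ c : ℂ, Filter.Tendsto (fun x => ⟪Y x ξ, ξ⟫_ℂ) Filter.atTop (nhds c) :=
    fun ξ => by
    have h1 := tendsto_atTop_ciSup (hmono ξ) (hbdd ξ)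
    refine ⟨_, (Filter.Tendsto.ofReal h1).congr fun x => ?_⟩
    have h2 := LinearMap.isSymmetric_iff_inner_map_self_real (Y x : H →ₗ[ℂ] H) |>.1
      ((ContinuousLinearMap.isSelfAdjoint_iff_isSymmetric).1 (hYsa x)) ξ
    have h3 : starRingEnd ℂ ⟪Y x ξ, ξ⟫_ℂ = ⟪Y x ξ, ξ⟫_ℂ := h2
    have h4 : ⟪ξ, Y x ξ⟫_ℂ = ⟪Y x ξ, ξ⟫_ℂ := by rw [← h3, inner_conj_symm]
    rw [h4]
    exact Complex.conj_eq_iff_re.1 h3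
  have hconv : ∀ u v, ∃ c : ℂ, Filter.Tendsto (fun x => ⟪u, Y x v⟫_ℂ) Filter.atTop (nhds c) :=
    fun u v => by
    obtain ⟨c1, h1⟩ := hre (u + v)
    obtain ⟨c2, h2⟩ := hre (u - v)
    obtain ⟨c3, h3⟩ := hre (u + Complex.I • v)
    obtain ⟨c4, h4⟩ := hre (u - Complex.I • v)
    refine ⟨_, ((((h1.sub h2).sub (h3.const_mul Complex.I)).add
      (h4.const_mul Complex.I)).div_const 4).congr fun x => ?_⟩
    have h5 := inner_map_polarization' (Y x : H →ₗ[ℂ] H) u v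
    have h6 : ⟪u, Y x v⟫_ℂ = ⟪Y x u, v⟫_ℂ := by
      rw [← adjoint_inner_left, ← ContinuousLinearMap.star_eq_adjoint, (hYsa x).star_eq]
    rw [h6]
    exact h5.symm
  have hC : ∀ᶠ x in Filter.atTop, ‖Y x‖ ≤ ‖b - Y ⟨x₀, hx₀⟩‖ + ‖Y ⟨x₀, hx₀⟩‖ := by
    filter_upwards [Filter.eventually_ge_atTop (⟨x₀, hx₀⟩ : D)] with x hx
    have h1 : 0 ≤ Y x - Y ⟨x₀, hx₀⟩ := sub_nonneg.2 hx
    have h2 : Y x - Y ⟨x₀, hx₀⟩ ≤ b - Y ⟨x₀, hx₀⟩ := sub_le_sub_right (hb x x.2) _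
    have h3 := CStarAlgebra.norm_le_norm_of_nonneg_of_le h1 h2
    calc ‖Y x‖ = ‖(Y x - Y ⟨x₀, hx₀⟩) + Y ⟨x₀, hx₀⟩‖ := by rw [sub_add_cancel]
      _ ≤ _ := (norm_add_le _ _).trans (by gcongr)
  obtain ⟨T, hT⟩ := exists_clm_of_tendsto hC hconv
  have hTA : T ∈ A := mem_of_forall_commute fun S hS => clm_ext_inner fun u v => by
    rw [mul_apply_eq_comp, mul_apply_eq_comp, ← adjoint_inner_left]
    refine tendsto_nhds_unique (hT _ _) ((hT u (S v)).congr fun x => ?_)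
    rw [adjoint_inner_left, ← mul_apply_eq_comp, ← mul_apply_eq_comp,
      commute_of_mem (M := A) (x : A.toStarSubalgebra).2 hS]
  have hTsa : IsSelfAdjoint T := by
    rw [isSelfAdjoint_iff, ContinuousLinearMap.star_eq_adjoint]
    refine clm_ext_inner fun u v => ?_
    rw [adjoint_inner_right, ← inner_conj_symm]
    refine tendsto_nhds_unique ((Complex.continuous_conj.tendsto _).comp (hT v u))
      ((hT u v).congr fun x => ?_)
    rw [Function.comp_apply, inner_conj_symm, ← adjoint_inner_left,
      ← ContinuousLinearMap.star_eq_adjoint, (hYsa x).star_eq]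
  refine ⟨⟨T, hTA⟩, Subtype.ext hTsa.star_eq, fun ξ => ?_⟩
  have h1 : Filter.Tendsto (fun x => (⟪ξ, Y x ξ⟫_ℂ).re) Filter.atTop (nhds (⟪ξ, T ξ⟫_ℂ).re) :=
    (Complex.continuous_re.tendsto _).comp (hT ξ ξ)
  have h2 := isLUB_of_tendsto_atTop (hmono ξ) h1
  rw [Set.image_eq_range]
  exact h2

theorem le_of_isLUB {D : Set A.toStarSubalgebra} (hsa : ∀ x ∈ D, IsSelfAdjoint x)
    {s : A.toStarSubalgebra} (hs : IsSelfAdjoint s)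
    (h : ∀ ξ : H, IsLUB ((fun x : A.toStarSubalgebra => (⟪ξ, (x : H →L[ℂ] H) ξ⟫_ℂ).re) '' D)
        (⟪ξ, (s : H →L[ℂ] H) ξ⟫_ℂ).re) {x : A.toStarSubalgebra} (hx : x ∈ D) :
    (x : H →L[ℂ] H) ≤ s :=
  le_of_re_inner (congrArg Subtype.val (hsa x hx).star_eq) (congrArg Subtype.val hs.star_eq)
    fun ξ => (h ξ).1 ⟨x, hx, rfl⟩

theorem isLUB_le {D : Set A.toStarSubalgebra}
    {s : A.toStarSubalgebra} (hs : IsSelfAdjoint s)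
    (h : ∀ ξ : H, IsLUB ((fun x : A.toStarSubalgebra => (⟪ξ, (x : H →L[ℂ] H) ξ⟫_ℂ).re) '' D)
        (⟪ξ, (s : H →L[ℂ] H) ξ⟫_ℂ).re) {b : H →L[ℂ] H} (hbs : IsSelfAdjoint b)
    (hb : ∀ x ∈ D, (x : H →L[ℂ] H) ≤ b) : (s : H →L[ℂ] H) ≤ b :=
  le_of_re_inner (congrArg Subtype.val hs.star_eq) hbs fun ξ => (h ξ).2 (by
    rintro _ ⟨x, hx, rfl⟩; exact re_inner_mono (hb x hx) ξ)

end

section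

variable {H K : Type*} [NormedAddCommGroup H] [InnerProductSpace ℂ H] [CompleteSpace H]
  [NormedAddCommGroup K] [InnerProductSpace ℂ K] [CompleteSpace K]
  {A : VonNeumannAlgebra H}

/-! ### Normal homomorphisms -/

theorem isSelfAdjoint_of_coe_nonneg {a : A.toStarSubalgebra} (ha : 0 ≤ (a : H →L[ℂ] H)) :
    IsSelfAdjoint a :=
  Subtype.ext (IsSelfAdjoint.of_nonneg ha).star_eq

theorem directedOn_of_isChain {D : Set A.toStarSubalgebra} (hD : IsChain (· ≤ ·) D) :
    DirectedOn (fun x y : A.toStarSubalgebra => (x : H →L[ℂ] H) ≤ (y : H →L[ℂ] H)) D :=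
  hD.directedOn

/-- If the vector functional of `ζ` is strictly less than that of `ξ` on `c`, then it is dominated
by it on the order interval `[0, y]` for some nonzero `y ≤ c`. -/
theorem exists_dominated {φ : A.toStarSubalgebra →⋆ₐ[ℂ] (K →L[ℂ] K)} (w : K) (ξ : H)
    {c : A.toStarSubalgebra} (hc : 0 ≤ (c : H →L[ℂ] H))
    (hlt : (⟪w, φ c w⟫_ℂ).re < (⟪ξ, (c : H →L[ℂ] H) ξ⟫_ℂ).re) :
    ∃ y : A.toStarSubalgebra, y ≠ 0 ∧ 0 ≤ (y : H →L[ℂ] H) ∧ (y : H →L[ℂ] H) ≤ c ∧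
      ∀ x : A.toStarSubalgebra, 0 ≤ (x : H →L[ℂ] H) → (x : H →L[ℂ] H) ≤ y →
        (⟪w, φ x w⟫_ℂ).re ≤ (⟪ξ, (x : H →L[ℂ] H) ξ⟫_ℂ).re := by
  -- For a maximal `m` in `[0, c]` on which the functional of `ξ` is at most that of `w`, the
  -- difference `y = c - m` has the required property.
  obtain ⟨m, -, hm⟩ := zorn_le_nonempty₀ {x : A.toStarSubalgebra | 0 ≤ (x : H →L[ℂ] H) ∧
      (x : H →L[ℂ] H) ≤ c ∧ (⟪ξ, (x : H →L[ℂ] H) ξ⟫_ℂ).re ≤ (⟪w, φ x w⟫_ℂ).re} (by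
    intro D hD hchain y hy
    have hsa : ∀ x ∈ D, IsSelfAdjoint x := fun x hx => isSelfAdjoint_of_coe_nonneg (hD hx).1
    obtain ⟨s, hs, hlub⟩ := exists_isLUB ⟨y, hy⟩ hsa (directedOn_of_isChain hchain)
      (fun x hx => (hD hx).2.1)
    have hle : ∀ x ∈ D, (x : H →L[ℂ] H) ≤ s := fun x hx => le_of_isLUB hsa hs hlub hx
    refine ⟨s, ⟨(hD hy).1.trans (hle y hy),
      isLUB_le hs hlub (IsSelfAdjoint.of_nonneg hc) (fun x hx => (hD hx).2.1), ?_⟩, hle⟩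
    refine (hlub ξ).2 ?_
    rintro _ ⟨x, hx, rfl⟩
    exact (hD hx).2.2.trans (re_inner_mono (starAlgHom_mono φ (hle x hx)) w)) 0
    ⟨le_rfl, hc, by simp⟩
  obtain ⟨hm0, hmc, hmle⟩ := hm.prop
  refine ⟨c - m, fun h => ?_, sub_nonneg.2 hmc, ?_, fun x hx hxy => ?_⟩
  · rw [sub_eq_zero.1 h] at hlt
    exact absurd hmle (not_le.2 hlt)
  · simpa using hm0
  · by_contra hcon
    have h1 : m + x ≤ m := hm.le_of_ge (y := m + x) ⟨add_nonneg hm0 hx, by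
      have := add_le_add_right hxy (m : H →L[ℂ] H)
      simpa using this, by
      have e1 : ((m + x : A.toStarSubalgebra) : H →L[ℂ] H) = m + x := rfl
      rw [e1, map_add, add_apply, add_apply, inner_add_right, inner_add_right, Complex.add_re,
        Complex.add_re]
      linarith⟩ (by
        change (m : H →L[ℂ] H) ≤ m + x
        simpa using hx)
    have h2 : (m : H →L[ℂ] H) + x ≤ m := h1
    have h3 : (x : H →L[ℂ] H) = 0 := le_antisymm (by simpa using h2) hx
    have h4 : x = 0 := Subtype.ext h3
    rw [h4] at hcon
    simp at hcon

theorem re_inner_star_mul_self (T : H →L[ℂ] H) (v : H) :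
    (⟪v, (star T * T) v⟫_ℂ).re = ‖T v‖ ^ 2 := by
  rw [mul_apply_eq_comp, ContinuousLinearMap.star_eq_adjoint, adjoint_inner_right,
    inner_self_eq_norm_sq_to_K]
  norm_cast

/-- The domination of a vector functional on `[0, y]` bounds `φ (a y) w`, because
`y a* a y ≤ ‖a‖² y² ≤ ‖a‖² y`. -/
theorem norm_mul_apply_le_of_dominated {φ : A.toStarSubalgebra →⋆ₐ[ℂ] (K →L[ℂ] K)} {w : K} {ξ : H}
    {y : A.toStarSubalgebra} (hy0 : 0 ≤ (y : H →L[ℂ] H)) (hy1 : (y : H →L[ℂ] H) ≤ 1)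
    (hdom : ∀ x : A.toStarSubalgebra, 0 ≤ (x : H →L[ℂ] H) → (x : H →L[ℂ] H) ≤ y →
        (⟪w, φ x w⟫_ℂ).re ≤ (⟪ξ, (x : H →L[ℂ] H) ξ⟫_ℂ).re) (a : A.toStarSubalgebra) :
    ‖φ (a * y) w‖ ≤ ‖(a : H →L[ℂ] H) ((y : H →L[ℂ] H) ξ)‖ := by
  by_cases ha : ‖(a : H →L[ℂ] H)‖ = 0
  · have : a = 0 := Subtype.ext (norm_eq_zero.1 ha)
    simp [this]
  obtain ⟨r, hr⟩ : ∃ r : ℝ, r = (‖(a : H →L[ℂ] H)‖ ^ 2)⁻¹ := ⟨_, rfl⟩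
  have hr0 : 0 < r := by rw [hr]; positivity
  obtain ⟨b, hb⟩ : ∃ b : A.toStarSubalgebra, b = a * y := ⟨_, rfl⟩
  have hb' : (b : H →L[ℂ] H) = a * y := congrArg Subtype.val hb
  have hsa : IsSelfAdjoint ((r : ℂ) • (star (b : H →L[ℂ] H) * b)) := by
    rw [isSelfAdjoint_iff, star_smul, star_mul, star_star, RCLike.star_def, Complex.conj_ofReal]
  have hform : ∀ v, (⟪v, ((r : ℂ) • (star (b : H →L[ℂ] H) * b)) v⟫_ℂ).re =
      r * ‖(b : H →L[ℂ] H) v‖ ^ 2 := fun v => by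
    rw [smul_apply, inner_smul_right, Complex.re_ofReal_mul, re_inner_star_mul_self]
  obtain ⟨c, hc⟩ : ∃ c : A.toStarSubalgebra, c = (r : ℂ) • (star b * b) := ⟨_, rfl⟩
  have hc' : (c : H →L[ℂ] H) = (r : ℂ) • (star (b : H →L[ℂ] H) * b) := by rw [hc]; rfl
  have hx := hdom c (hc' ▸ le_of_re_inner (.zero _) hsa fun v => by
      rw [hform]
      simp only [zero_apply, inner_zero_right, Complex.zero_re]
      positivity)
    (hc' ▸ le_of_re_inner hsa (IsSelfAdjoint.of_nonneg hy0) fun v => by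
      rw [hform]
      refine le_trans ?_ (norm_sq_apply_le hy0 hy1 v)
      rw [hr, inv_mul_le_iff₀ (by positivity), ← mul_pow, hb']
      exact pow_le_pow_left₀ (norm_nonneg _) ((a : H →L[ℂ] H).le_opNorm _) 2)
  rw [hc', hform, hc, map_smul, map_mul, map_star, smul_apply, inner_smul_right,
    Complex.re_ofReal_mul, re_inner_star_mul_self] at hx
  have h := le_of_sq_le_sq (le_of_mul_le_mul_left hx hr0) (norm_nonneg _)
  rwa [hb', hb] at h

/-- On bounded sets, a normal *-homomorphism is continuous for the strong operator topologies. -/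
theorem IsNormal.exists_bound {φ : A.toStarSubalgebra →⋆ₐ[ℂ] (K →L[ℂ] K)}
    (hφ : IsNormal A φ) (w : K) {ε : ℝ} (hε : 0 < ε) :
    ∃ l : List H, ∀ a : A.toStarSubalgebra,
      ‖φ a w‖ ≤ (l.map fun ξ => ‖(a : H →L[ℂ] H) ξ‖).sum + ε * ‖(a : H →L[ℂ] H)‖ := by
  -- A maximal `u ∈ [0, 1]` such that the claim holds for `a ↦ φ (a u) w` is equal to `1`.
  -- Normality is used for the upper bounds of chains.
  obtain ⟨u, -, hu⟩ := zorn_le_nonempty₀ {u : A.toStarSubalgebra | 0 ≤ (u : H →L[ℂ] H) ∧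
      (u : H →L[ℂ] H) ≤ 1 ∧ ∀ ε > 0, ∃ l : List H, ∀ a : A.toStarSubalgebra,
      ‖φ (a * u) w‖ ≤ (l.map fun ξ => ‖(a : H →L[ℂ] H) ξ‖).sum + ε * ‖(a : H →L[ℂ] H)‖} (by
    intro D hD hchain y hy
    have hsa : ∀ x ∈ D, IsSelfAdjoint x := fun x hx => isSelfAdjoint_of_coe_nonneg (hD hx).1
    have hdir := directedOn_of_isChain hchain
    obtain ⟨s, hs, hlub⟩ := exists_isLUB ⟨y, hy⟩ hsa hdir (fun x hx => (hD hx).2.1)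
    have hle : ∀ x ∈ D, (x : H →L[ℂ] H) ≤ s := fun x hx => le_of_isLUB hsa hs hlub hx
    have hs1 : (s : H →L[ℂ] H) ≤ 1 := isLUB_le hs hlub (.one _) (fun x hx => (hD hx).2.1)
    refine ⟨s, ⟨(hD hy).1.trans (hle y hy), hs1, fun ε hε => ?_⟩, hle⟩
    have hlub' := hφ D s ⟨y, hy⟩ hsa hs hdir hlub w
    obtain ⟨_, ⟨u, hu, rfl⟩, h1⟩ := (lt_isLUB_iff hlub').1
      (show (⟪w, φ s w⟫_ℂ).re - (ε / 2) ^ 2 < _ from sub_lt_self _ (by positivity))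
    obtain ⟨l, hl⟩ := (hD hu).2.2 (ε / 2) (by positivity)
    refine ⟨l, fun a => ?_⟩
    have h2 : ‖φ (s - u) w‖ ≤ ε / 2 := by
      refine le_of_sq_le_sq ?_ (by positivity)
      refine (norm_sq_apply_le (starAlgHom_nonneg φ (sub_nonneg.2 (hle u hu))) ?_ w).trans ?_
      · rw [← map_one φ]
        refine starAlgHom_mono φ ?_
        exact (sub_le_self _ (hD hu).1).trans hs1
      · rw [map_sub, sub_apply, inner_sub_right, Complex.sub_re]
        linarith
    have h3 : φ (a * s) w = φ (a * u) w + φ a (φ (s - u) w) := by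
      rw [← mul_apply_eq_comp, ← map_mul, ← add_apply, ← map_add]
      congr 2
      noncomm_ring
    rw [h3]
    calc _ ≤ ((l.map fun ξ => ‖(a : H →L[ℂ] H) ξ‖).sum + ε / 2 * ‖(a : H →L[ℂ] H)‖) +
          ‖(a : H →L[ℂ] H)‖ * (ε / 2) := (norm_add_le _ _).trans (add_le_add (hl a)
            (((φ a).le_of_opNorm_le (norm_starAlgHom_le φ a) _).trans (by gcongr)))
      _ = _ := by ring) 0 ⟨le_rfl, zero_le_one, fun ε hε => ⟨[], fun a => by simp; positivity⟩⟩
  obtain ⟨hu0, hu1, hub⟩ := hu.prop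
  suffices h : u = 1 by
    obtain ⟨l, hl⟩ := hub ε hε
    exact ⟨l, fun a => by simpa [h] using hl a⟩
  by_contra hne
  have hc0 : 0 ≤ ((1 - u : A.toStarSubalgebra) : H →L[ℂ] H) := by simpa using hu1
  -- If `u ≠ 1`, a multiple `ξ` of a vector on which `1 - u` is positive dominates `w` on some
  -- nonzero `y ≤ 1 - u`, and then the claim holds for `u + y` as well.
  obtain ⟨ξ, hξ⟩ : ∃ ξ : H, (⟪w, φ (1 - u) w⟫_ℂ).re <
      (⟪ξ, ((1 - u : A.toStarSubalgebra) : H →L[ℂ] H) ξ⟫_ℂ).re := by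
    have hc1 : ∃ ξ : H, 0 < (⟪ξ, ((1 - u : A.toStarSubalgebra) : H →L[ℂ] H) ξ⟫_ℂ).re := by
      by_contra! hcon
      have : ((1 - u : A.toStarSubalgebra) : H →L[ℂ] H) ≤ 0 :=
        le_of_re_inner (IsSelfAdjoint.of_nonneg hc0) (.zero _) fun ξ => by simpa using hcon ξ
      exact hne (sub_eq_zero.1 (Subtype.ext (le_antisymm this hc0))).symm
    obtain ⟨ξ, hξ⟩ := hc1
    set r := (⟪ξ, ((1 - u : A.toStarSubalgebra) : H →L[ℂ] H) ξ⟫_ℂ).re with hr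
    have hw0 : 0 ≤ (⟪w, φ (1 - u) w⟫_ℂ).re := re_inner_nonneg (starAlgHom_nonneg φ hc0) w
    set q := (⟪w, φ (1 - u) w⟫_ℂ).re with hq
    refine ⟨((Real.sqrt ((q + 1) / r) : ℝ) : ℂ) • ξ, ?_⟩
    rw [map_smul, inner_smul_left, inner_smul_right, Complex.conj_ofReal, ← mul_assoc,
      ← Complex.ofReal_mul, Real.mul_self_sqrt (by positivity), Complex.re_ofReal_mul, ← hr,
      div_mul_cancel₀ _ hξ.ne']
    linarith
  obtain ⟨y, hy, hy0, hyc, hdom⟩ := exists_dominated w ξ hc0 hξ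
  have hyc' : (y : H →L[ℂ] H) ≤ 1 - u := hyc
  have hy1 : (y : H →L[ℂ] H) ≤ 1 := hyc'.trans (sub_le_self _ hu0)
  have key : ∀ a : A.toStarSubalgebra, ‖φ (a * y) w‖ ≤ ‖(a : H →L[ℂ] H) ((y : H →L[ℂ] H) ξ)‖ :=
    norm_mul_apply_le_of_dominated hy0 hy1 hdom
  have hmem : u + y ≤ u := hu.le_of_ge (y := u + y) ⟨add_nonneg hu0 hy0, by
      have := add_le_add_right hyc' (u : H →L[ℂ] H)
      simpa using this, fun ε hε => by
      obtain ⟨l, hl⟩ := hub ε hε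
      refine ⟨l ++ [(y : H →L[ℂ] H) ξ], fun a => ?_⟩
      rw [mul_add, map_add, add_apply]
      refine (norm_add_le _ _).trans ?_
      have := hl a
      have := key a
      simp only [List.map_append, List.map_cons, List.map_nil, List.sum_append, List.sum_cons,
        List.sum_nil]
      linarith⟩ (by
        change (u : H →L[ℂ] H) ≤ u + y
        simpa using hy0)
  have h2 : (u : H →L[ℂ] H) + y ≤ u := hmem
  exact hy (Subtype.ext (le_antisymm (by simpa using h2) hy0))

/-- Automorphisms of von Neumann algebras are normal. -/
theorem isNormal_starAlgEquiv (θ : A.toStarSubalgebra ≃⋆ₐ[ℂ] A.toStarSubalgebra) :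
    IsNormal A fun x => (θ x : H →L[ℂ] H) := by
  have hmono : ∀ (θ : A.toStarSubalgebra ≃⋆ₐ[ℂ] A.toStarSubalgebra) {a b : A.toStarSubalgebra},
      (a : H →L[ℂ] H) ≤ b → (θ a : H →L[ℂ] H) ≤ θ b := fun θ a b h =>
    starAlgHom_mono ((A.toStarSubalgebra.subtype).comp (θ : A.toStarSubalgebra →⋆ₐ[ℂ]
      A.toStarSubalgebra)) h
  intro D s hne hsa hs hdir hlub ξ
  have hle : ∀ x ∈ D, (x : H →L[ℂ] H) ≤ s := fun x hx => le_of_isLUB hsa hs hlub hx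
  have hsa' : ∀ x ∈ θ '' D, IsSelfAdjoint x := by
    rintro _ ⟨x, hx, rfl⟩; exact (hsa x hx).map θ
  obtain ⟨t, ht, htlub⟩ := exists_isLUB (D := θ '' D) (hne.image _) hsa'
    (by
      rintro _ ⟨x, hx, rfl⟩ _ ⟨y, hy, rfl⟩
      obtain ⟨z, hz, h1, h2⟩ := hdir x hx y hy
      exact ⟨_, ⟨z, hz, rfl⟩, hmono θ h1, hmono θ h2⟩)
    (b := (θ s : H →L[ℂ] H)) (by rintro _ ⟨x, hx, rfl⟩; exact hmono θ (hle x hx))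
  have h1 : t = θ s := by
    refine Subtype.ext (le_antisymm (isLUB_le ht htlub
      (congrArg Subtype.val (hs.map θ).star_eq) ?_) ?_)
    · rintro _ ⟨x, hx, rfl⟩; exact hmono θ (hle x hx)
    · have h2 : (s : H →L[ℂ] H) ≤ θ.symm t := isLUB_le hs hlub
        (congrArg Subtype.val (ht.map θ.symm).star_eq) fun x hx => by
          have := hmono θ.symm (le_of_isLUB hsa' ht htlub ⟨x, hx, rfl⟩)
          simpa using this
      simpa using hmono θ h2
  have h3 := htlub ξ
  rw [Set.image_image, h1] at h3
  exact h3

theorem IsNormal.comp {φ : A.toStarSubalgebra → (K →L[ℂ] K)} (hφ : IsNormal A φ)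
    (θ : A.toStarSubalgebra ≃⋆ₐ[ℂ] A.toStarSubalgebra) : IsNormal A fun x => φ (θ x) := by
  intro D s hne hsa hs hdir hlub ξ
  have hmono : ∀ {a b : A.toStarSubalgebra},
      (a : H →L[ℂ] H) ≤ b → (θ a : H →L[ℂ] H) ≤ θ b := fun {a b} h =>
    starAlgHom_mono ((A.toStarSubalgebra.subtype).comp (θ : A.toStarSubalgebra →⋆ₐ[ℂ]
      A.toStarSubalgebra)) h
  have := hφ (θ '' D) (θ s) (hne.image _) (by rintro _ ⟨x, hx, rfl⟩; exact (hsa x hx).map θ)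
    (hs.map θ) (by
      rintro _ ⟨x, hx, rfl⟩ _ ⟨y, hy, rfl⟩
      obtain ⟨z, hz, h1, h2⟩ := hdir x hx y hy
      exact ⟨_, ⟨z, hz, rfl⟩, hmono h1, hmono h2⟩) (fun ξ => by
      have := isNormal_starAlgEquiv θ D s hne hsa hs hdir hlub ξ
      rwa [Set.image_image]) ξ
  rwa [Set.image_image] at this

theorem IsNormal.conjBy {L : Type*} [NormedAddCommGroup L] [InnerProductSpace ℂ L]
    [CompleteSpace L] {φ : A.toStarSubalgebra → (K →L[ℂ] K)} (hφ : IsNormal A φ)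
    (U : K →L[ℂ] L) : IsNormal A fun x => conjBy U (φ x) := by
  intro D s hne hsa hs hdir hlub ξ
  simp only [inner_conjBy]
  exact hφ D s hne hsa hs hdir hlub _

end

section

variable {G : Type*} [Group G] [TopologicalSpace G] [IsTopologicalGroup G] [LocallyCompactSpace G]
  [MeasurableSpace G] [BorelSpace G] {μ : Measure G} [μ.IsHaarMeasure] [μ.Regular]
  {H K : Type*} [NormedAddCommGroup H] [InnerProductSpace ℂ H] [CompleteSpace H]
  [NormedAddCommGroup K] [InnerProductSpace ℂ K] [CompleteSpace K]
  {A : VonNeumannAlgebra H}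

/-! ### Continuous families of homomorphisms -/

/-- A normal *-homomorphism preserves bounded strongly continuous families. -/
theorem IsNormal.isStrongCont {φ : A.toStarSubalgebra →⋆ₐ[ℂ] (K →L[ℂ] K)}
    (hφ : IsNormal A φ) {a : G → A.toStarSubalgebra}
    (ha : IsStrongCont fun g => (a g : H →L[ℂ] H)) : IsStrongCont fun g => φ (a g) where
  bdd := by
    obtain ⟨C, hC⟩ := ha.bdd
    exact ⟨C, fun g => (norm_starAlgHom_le φ _).trans (hC g)⟩
  cont w := by
    obtain ⟨C, hC⟩ := ha.bdd
    have hC0 : 0 ≤ C := (norm_nonneg _).trans (hC 1)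
    rw [continuous_iff_continuousAt]
    intro h
    rw [ContinuousAt, tendsto_iff_norm_sub_tendsto_zero, Metric.tendsto_nhds]
    intro ε hε
    obtain ⟨l, hl⟩ := hφ.exists_bound w (ε := ε / (2 * (2 * C + 1))) (by positivity)
    have h1 : ∀ l : List H, Filter.Tendsto (fun g =>
        (l.map fun ξ => ‖((a g : H →L[ℂ] H) - a h) ξ‖).sum) (nhds h) (nhds 0) := by
      intro l
      induction l with
      | nil => simp
      | cons ξ l ih =>
        simp only [List.map_cons, List.sum_cons]
        have : Filter.Tendsto (fun g => ‖((a g : H →L[ℂ] H) - a h) ξ‖) (nhds h) (nhds 0) := by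
          have := tendsto_iff_norm_sub_tendsto_zero.1 ((ha.cont ξ).tendsto h)
          simpa using this
        simpa using this.add ih
    filter_upwards [Metric.tendsto_nhds.1 (h1 l) (ε / 2) (by positivity)] with g hg
    rw [Real.dist_eq, sub_zero] at hg ⊢
    rw [abs_of_nonneg (norm_nonneg _), ← sub_apply, ← map_sub]
    refine (hl (a g - a h)).trans_lt ?_
    have h2 : ‖((a g - a h : A.toStarSubalgebra) : H →L[ℂ] H)‖ ≤ 2 * C := by
      refine (norm_sub_le _ _).trans ?_
      linarith [hC g, hC h]
    have h3 : ε / (2 * (2 * C + 1)) * ‖((a g - a h : A.toStarSubalgebra) : H →L[ℂ] H)‖ ≤ ε / 2 := by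
      refine (mul_le_mul_of_nonneg_left h2 (by positivity)).trans ?_
      rw [div_mul_eq_mul_div, div_le_div_iff₀ (by positivity) (by positivity)]
      nlinarith
    have h4 := (le_abs_self _).trans_lt hg
    have h5 : (l.map fun ξ => ‖((a g - a h : A.toStarSubalgebra) : H →L[ℂ] H) ξ‖).sum < ε / 2 := h4
    linarith

/-- A weakly continuous family of *-homomorphisms is strongly continuous. -/
theorem isStrongCont_of_starAlgHom {β : G → A.toStarSubalgebra →⋆ₐ[ℂ] (K →L[ℂ] K)}
    (hβ : ∀ x ξ η, Continuous fun g => ⟪ξ, β g x η⟫_ℂ) (x : A.toStarSubalgebra) :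
    IsStrongCont fun g => β g x where
  bdd := ⟨_, fun g => norm_starAlgHom_le (β g) x⟩
  cont ξ := by
    have h1 : ∀ g, ⟪β g x ξ, β g x ξ⟫_ℂ = ⟪ξ, β g (star x * x) ξ⟫_ℂ := fun g => by
      rw [map_mul, map_star, mul_apply_eq_comp, ContinuousLinearMap.star_eq_adjoint,
        adjoint_inner_right]
    rw [continuous_iff_continuousAt]
    intro h
    rw [ContinuousAt, tendsto_iff_norm_sub_tendsto_zero]
    have h2 : ∀ g, ‖β g x ξ - β h x ξ‖ ^ 2 = (⟪ξ, β g (star x * x) ξ⟫_ℂ).re -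
        2 * (⟪β h x ξ, β g x ξ⟫_ℂ).re + (⟪ξ, β h (star x * x) ξ⟫_ℂ).re := fun g => by
      rw [← h1, ← h1, @norm_sub_sq ℂ, inner_self_eq_norm_sq_to_K, inner_self_eq_norm_sq_to_K,
        ← inner_conj_symm, RCLike.conj_re]
      norm_cast
    have h3 : Continuous fun g => ‖β g x ξ - β h x ξ‖ ^ 2 := by
      simp only [h2]
      exact (((Complex.continuous_re.comp (hβ (star x * x) ξ ξ)).sub
        (continuous_const.mul (Complex.continuous_re.comp (hβ x (β h x ξ) ξ)))).add
          continuous_const)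
    have h4 := (Real.continuous_sqrt.comp h3).tendsto h
    simpa [Function.comp_def, Real.sqrt_sq] using h4

/-- A weakly continuous family of *-homomorphisms defines a *-homomorphism into decomposable
operators. -/
theorem exists_starAlgHom_decomposable {β : G → A.toStarSubalgebra →⋆ₐ[ℂ] (K →L[ℂ] K)}
    (hβ : ∀ x ξ η, Continuous fun g => ⟪ξ, β g x η⟫_ℂ) :
    ∃ Φ : A.toStarSubalgebra →⋆ₐ[ℂ] (K ⊗ʰ L2 μ →L[ℂ] K ⊗ʰ L2 μ),
      ∀ x, Φ x = decomposable μ fun g => β g x := by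
  have hs := isStrongCont_of_starAlgHom hβ
  have hc : ∀ c : ℂ, decomposable μ (fun g => β g (algebraMap ℂ _ c)) = algebraMap ℂ _ c :=
    fun c => by
    simp only [AlgHomClass.commutes]
    rw [decomposable_const, Algebra.algebraMap_eq_smul_one, opTensor_smul_left, opTensor_one,
      Algebra.algebraMap_eq_smul_one]
  refine ⟨{ toFun := fun x => decomposable μ fun g => β g x
            map_one' := by simpa using hc 1
            map_mul' := fun x y => ?_
            map_zero' := by simpa using hc 0
            map_add' := fun x y => ?_
            commutes' := hc
            map_star' := fun x => ?_ }, fun x => rfl⟩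
  · simp only [map_mul]
    exact ((hs x).isBddMeas.decomposable_mul (hs y) (((hs x).mul (hs y)).isBddMeas)).symm
  · simp only [map_add]
    exact (hs x).isBddMeas.decomposable_add (hs y).isBddMeas
  · simp only [map_star]
    exact ((hs x).isBddMeas.star_decomposable).symm

/-- Normality of a *-homomorphism may be checked on a total set of vectors. -/
theorem isNormal_of_total {φ : A.toStarSubalgebra →⋆ₐ[ℂ] (K →L[ℂ] K)} {S : Set K} (hS : Total S)
    (h : ∀ (D : Set A.toStarSubalgebra) (s : A.toStarSubalgebra), D.Nonempty →
    (∀ x ∈ D, IsSelfAdjoint x) → IsSelfAdjoint s →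
    DirectedOn (fun x y : A.toStarSubalgebra => (x : H →L[ℂ] H) ≤ (y : H →L[ℂ] H)) D →
    (∀ ξ : H, IsLUB ((fun x : A.toStarSubalgebra => (⟪ξ, (x : H →L[ℂ] H) ξ⟫_ℂ).re) '' D)
      (⟪ξ, (s : H →L[ℂ] H) ξ⟫_ℂ).re) →
    ∀ w ∈ S, ∀ ε > 0, ∃ x ∈ D, (⟪w, φ (s - x) w⟫_ℂ).re < ε) : IsNormal A φ := by
  intro D s hne hsa hs hdir hlub
  have hle : ∀ x ∈ D, (x : H →L[ℂ] H) ≤ s := fun x hx => le_of_isLUB hsa hs hlub hx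
  have hpos : ∀ x ∈ D, 0 ≤ φ (s - x) := fun x hx => starAlgHom_nonneg φ (sub_nonneg.2 (hle x hx))
  have hanti : ∀ x y : A.toStarSubalgebra, (x : H →L[ℂ] H) ≤ y → φ (s - y) ≤ φ (s - x) :=
    fun x y hxy => starAlgHom_mono φ (sub_le_sub_left hxy _)
  have hadd : ∀ {T : K →L[ℂ] K}, 0 ≤ T → ∀ v w, (⟪v + w, T (v + w)⟫_ℂ).re ≤
      2 * (⟪v, T v⟫_ℂ).re + 2 * (⟪w, T w⟫_ℂ).re := fun {T} hT v w => by
    have := re_inner_nonneg hT (v - w)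
    simp only [map_sub, map_add, inner_sub_left, inner_sub_right, inner_add_left,
      inner_add_right, Complex.add_re, Complex.sub_re] at this ⊢
    linarith
  obtain ⟨x₀, hx₀⟩ := hne
  -- As `D` is directed, the vectors for which the defect can be made small form a closed subspace.
  let N : Submodule ℂ K :=
    { carrier := {w | ∀ ε > 0, ∃ x ∈ D, (⟪w, φ (s - x) w⟫_ℂ).re < ε}
      zero_mem' := fun ε hε => ⟨x₀, hx₀, by simpa using hε⟩
      add_mem' := fun {v w} hv hw ε hε => by
        obtain ⟨x, hx, h1⟩ := hv (ε / 4) (by positivity)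
        obtain ⟨y, hy, h2⟩ := hw (ε / 4) (by positivity)
        obtain ⟨z, hz, hxz, hyz⟩ := hdir x hx y hy
        refine ⟨z, hz, (hadd (hpos z hz) v w).trans_lt ?_⟩
        linarith [re_inner_mono (hanti x z hxz) v, re_inner_mono (hanti y z hyz) w]
      smul_mem' := fun c w hw ε hε => by
        obtain ⟨x, hx, h1⟩ := hw (ε / (‖c‖ ^ 2 + 1)) (by positivity)
        refine ⟨x, hx, ?_⟩
        have h2 := re_inner_nonneg (hpos x hx) w
        rw [map_smul, inner_smul_left, inner_smul_right, ← mul_assoc, Complex.conj_mul',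
          ← Complex.ofReal_pow, Complex.re_ofReal_mul]
        rw [lt_div_iff₀ (by positivity)] at h1
        nlinarith }
  have hN : IsClosed (N : Set K) := by
    refine isClosed_of_closure_subset fun w hw ε hε => ?_
    set B := ‖φ (s - x₀)‖ with hB
    obtain ⟨w', hw', hd⟩ := Metric.mem_closure_iff.1 hw (Real.sqrt (ε / (4 * (B + 1))))
      (Real.sqrt_pos.2 (by positivity))
    obtain ⟨x, hx, h1⟩ := hw' (ε / 4) (by positivity)
    obtain ⟨z, hz, hxz, hyz⟩ := hdir x hx x₀ hx₀
    refine ⟨z, hz, ?_⟩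
    have h2 := hadd (hpos z hz) (w - w') w'
    rw [sub_add_cancel] at h2
    have h3 := re_inner_mono (hanti x z hxz) w'
    have h4 := re_inner_mono (hanti x₀ z hyz) (w - w')
    have h5 : (⟪w - w', φ (s - x₀) (w - w')⟫_ℂ).re ≤ B * ‖w - w'‖ ^ 2 := by
      refine (Complex.re_le_norm _).trans ((norm_inner_le_norm _ _).trans ?_)
      calc ‖w - w'‖ * ‖φ (s - x₀) (w - w')‖ ≤ ‖w - w'‖ * (B * ‖w - w'‖) := by
            gcongr; exact (φ (s - x₀)).le_opNorm _
        _ = _ := by ring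
    rw [dist_eq_norm] at hd
    have h6 : ‖w - w'‖ ^ 2 < ε / (4 * (B + 1)) := (Real.lt_sqrt (norm_nonneg _)).1 hd
    have h7 : B * ‖w - w'‖ ^ 2 ≤ ε / 4 := by
      have hB0 : 0 ≤ B := norm_nonneg _
      rw [lt_div_iff₀ (by positivity)] at h6
      nlinarith [sq_nonneg ‖w - w'‖]
    linarith
  intro w
  have hw : w ∈ N := hS.mem_of_isClosed N hN (fun w hw => h D s ⟨x₀, hx₀⟩ hsa hs hdir hlub w hw) w
  refine ⟨?_, fun r hr => le_of_forall_pos_lt_add fun ε hε => ?_⟩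
  · rintro _ ⟨x, hx, rfl⟩
    exact re_inner_mono (starAlgHom_mono φ (hle x hx)) w
  · obtain ⟨x, hx, h1⟩ := hw ε hε
    have h2 := hr ⟨x, hx, rfl⟩
    rw [map_sub, sub_apply, inner_sub_right, Complex.sub_re] at h1
    simp only at h2
    linarith

/-- A weakly continuous family of normal *-homomorphisms defines a normal *-homomorphism into
decomposable operators. This rests on Dini's theorem on compact sets. -/
theorem isNormal_decomposable {β : G → A.toStarSubalgebra →⋆ₐ[ℂ] (K →L[ℂ] K)}
    (hβ : ∀ x ξ η, Continuous fun g => ⟪ξ, β g x η⟫_ℂ) (hn : ∀ g, IsNormal A (β g)) :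
    IsNormal A fun x => decomposable μ fun g => β g x := by
  obtain ⟨Φ, hΦ⟩ := exists_starAlgHom_decomposable (μ := μ) hβ
  suffices IsNormal A Φ by
    have e : (fun x => decomposable μ fun g => β g x) = Φ := funext fun x => (hΦ x).symm
    rw [e]; exact this
  refine isNormal_of_total ((total_univ (E := K)).tmul (total_isCc (μ := μ))) ?_
  rintro D s hne hsa hs hdir hlub _ ⟨ξ, -, f, ⟨f₀, hf1, hf2, hf3⟩, rfl⟩ ε hε
  have hle : ∀ x ∈ D, (x : H →L[ℂ] H) ≤ s := fun x hx => le_of_isLUB hsa hs hlub hx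
  set I := ∫ g, ‖f₀ g‖ ^ 2 ∂μ with hI
  have hI0 : 0 ≤ I := integral_nonneg fun g => by positivity
  set η := ε / (I + 1) with hη
  have hη0 : 0 < η := by positivity
  have hcont : ∀ x, Continuous fun g => (⟪ξ, β g (s - x) ξ⟫_ℂ).re := fun x =>
    Complex.continuous_re.comp (hβ _ ξ ξ)
  have : Nonempty D := hne.to_subtype
  -- Dini: the open sets on which the defect of `x` is less than `η` increase with `x` and cover
  -- the support of `f₀`.
  obtain ⟨⟨x, hx⟩, hxK⟩ := hf2.isCompact.elim_directed_cover
    (fun x : D => {g | (⟪ξ, β g (s - x) ξ⟫_ℂ).re < η})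
    (fun x => isOpen_lt (hcont x) continuous_const) (fun g _ => by
      obtain ⟨_, ⟨x, hx, rfl⟩, h1⟩ := (lt_isLUB_iff (hn g D s hne hsa hs hdir hlub ξ)).1
        (sub_lt_self _ hη0)
      refine Set.mem_iUnion.2 ⟨⟨x, hx⟩, ?_⟩
      change (⟪ξ, β g (s - x) ξ⟫_ℂ).re < η
      rw [map_sub, sub_apply, inner_sub_right, Complex.sub_re]
      simp only at h1
      linarith) (fun x y => by
      obtain ⟨z, hz, h1, h2⟩ := hdir x x.2 y y.2
      have : ∀ x : D, (x : A.toStarSubalgebra).1 ≤ z →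
          {g | (⟪ξ, β g (s - x) ξ⟫_ℂ).re < η} ⊆ {g | (⟪ξ, β g (s - z) ξ⟫_ℂ).re < η} :=
        fun x hxz g hg =>
          (re_inner_mono (starAlgHom_mono (β g) (sub_le_sub_left hxz _)) ξ).trans_lt hg
      exact ⟨⟨z, hz⟩, this x h1, this y h2⟩)
  refine ⟨x, hx, ?_⟩
  have hb := (isStrongCont_of_starAlgHom hβ (s - x)).isBddMeas
  have h1 : (⟪(tmul ξ f : K ⊗ʰ L2 μ), Φ (s - x) (tmul ξ f)⟫_ℂ) =
      ∫ g, ((‖f₀ g‖ ^ 2 : ℝ) : ℂ) * ⟪ξ, β g (s - x) ξ⟫_ℂ ∂μ := by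
    rw [hΦ, hb.isDecomposed]
    refine integral_congr_ae ?_
    filter_upwards [hf3] with g hg
    rw [hg, Complex.conj_mul', Complex.ofReal_pow]
  have hs2 : HasCompactSupport fun g => ‖f₀ g‖ ^ 2 :=
    hf2.comp_left (g := fun z : ℂ => ‖z‖ ^ 2) (by simp)
  have hint2 : Integrable (fun g => ‖f₀ g‖ ^ 2) μ :=
    Continuous.integrable_of_hasCompactSupport (by fun_prop) hs2
  have hint : Integrable (fun g => ((‖f₀ g‖ ^ 2 : ℝ) : ℂ) * ⟪ξ, β g (s - x) ξ⟫_ℂ) μ :=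
    Continuous.integrable_of_hasCompactSupport
      ((Complex.continuous_ofReal.comp (by fun_prop)).mul (hβ _ ξ ξ))
      (HasCompactSupport.mul_right (hs2.comp_left (g := fun r : ℝ => (r : ℂ)) rfl))
  have h2 : (⟪(tmul ξ f : K ⊗ʰ L2 μ), Φ (s - x) (tmul ξ f)⟫_ℂ).re =
      ∫ g, ‖f₀ g‖ ^ 2 * (⟪ξ, β g (s - x) ξ⟫_ℂ).re ∂μ := by
    rw [h1]
    have := (integral_re hint).symm
    simp only [RCLike.re_to_complex, Complex.re_ofReal_mul] at this
    exact this
  rw [h2]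
  calc _ ≤ ∫ g, ‖f₀ g‖ ^ 2 * η ∂μ := by
        refine integral_mono_of_nonneg (.of_forall fun g => mul_nonneg (by positivity)
          (re_inner_nonneg (starAlgHom_nonneg _ (sub_nonneg.2 (hle x hx))) ξ))
          (hint2.mul_const η) (.of_forall fun g => ?_)
        by_cases hg : g ∈ tsupport f₀
        · exact mul_le_mul_of_nonneg_left (le_of_lt (hxK hg)) (by positivity)
        · simp [image_eq_zero_of_notMem_tsupport hg]
    _ = I * η := by rw [integral_mul_const]
    _ < ε := by
        rw [hη, mul_div_assoc', div_lt_iff₀ (by positivity)]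
        nlinarith

theorem slice_sum {ι : Type*} (t : Finset ι) (X : ι → (H ⊗ʰ K →L[ℂ] H ⊗ʰ K)) (ζ η : K) :
    slice (∑ i ∈ t, X i) ζ η = ∑ i ∈ t, slice (X i) ζ η :=
  clm_ext_inner fun x y => by
    simp only [inner_slice, sum_apply, inner_sum]

/-- On a vector `ξ`, the slice by `f` and `k` depends only on the values of the family on the support
of `k`. -/
theorem norm_slice_decomposable_sub_le {F F' : G → (H →L[ℂ] H)} (hF : IsBddMeas F)
    (hF' : IsBddMeas F') {f k : L2 μ} {k₀ : G → ℂ} (hk : k =ᵐ[μ] k₀) {ξ : H} {η : ℝ}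
    (hη : 0 ≤ η) (h : ∀ g ∈ tsupport k₀, ‖F g ξ - F' g ξ‖ ≤ η) :
    ‖(slice (decomposable μ F) f k - slice (decomposable μ F') f k) ξ‖ ≤ ‖f‖ * (η * ‖k‖) := by
  have hD := hF.add (hF'.const_smul (-1))
  have hDD : decomposable μ F - decomposable μ F' =
      decomposable μ fun g => F g + (-1 : ℂ) • F' g := by
    rw [hF.decomposable_add (hF'.const_smul (-1)), hF'.decomposable_smul, neg_one_smul,
      sub_eq_add_neg]
  rw [← slice_sub, hDD]
  refine (norm_slice_apply_le _ _ _ _).trans ?_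
  gcongr
  have hm : MemLp (fun g => η * ‖k g‖) 2 μ := (Lp.memLp k).norm.const_mul η
  refine (hD.norm_decomposable_apply_le _ hm ?_).trans (le_of_eq ?_)
  · filter_upwards [coeFn_toL2_tmul μ ξ k, hk] with g h1 h2
    rw [h1, map_smul, norm_smul, mul_comm]
    by_cases hg : g ∈ tsupport k₀
    · gcongr
      simpa [sub_eq_add_neg] using h g hg
    · simp [h2, image_eq_zero_of_notMem_tsupport hg]
  · have e : hm.toLp = η • ((Lp.memLp k).norm).toLp :=
      MemLp.toLp_const_smul (f := fun g => ‖k g‖) η (Lp.memLp k).norm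
    rw [e, norm_smul, Lp.norm_toLp, eLpNorm_norm, Real.norm_of_nonneg hη, ← Lp.norm_def]

/-- Normal *-homomorphisms commute with the integration of strongly continuous families. -/
theorem IsNormal.slice_decomposable {φ : A.toStarSubalgebra →⋆ₐ[ℂ] (K →L[ℂ] K)}
    (hφ : IsNormal A φ) {a : G → A.toStarSubalgebra}
    (ha : IsStrongCont fun g => (a g : H →L[ℂ] H)) {f k : L2 μ} (hk : IsCc μ k)
    {b : A.toStarSubalgebra}
    (hb : (b : H →L[ℂ] H) = slice (decomposable μ fun g => (a g : H →L[ℂ] H)) f k) :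
    φ b = slice (decomposable μ fun g => φ (a g)) f k := by
  obtain ⟨k₀, -, hk2, hk3⟩ := hk
  have hφa := hφ.isStrongCont ha
  obtain ⟨C, hC⟩ := ha.bdd
  have hC0 : 0 ≤ C := (norm_nonneg _).trans (hC 1)
  ext w
  rw [← sub_eq_zero, ← norm_le_zero_iff]
  refine le_of_forall_pos_le_add fun ε hε => ?_
  set R := ‖f‖ * ‖k‖ with hR
  have hR0 : 0 ≤ R := by positivity
  obtain ⟨l, hl⟩ := hφ.exists_bound w (ε := ε / (2 * (2 * C * R + 1))) (by positivity)
  set η := ε / (2 * ((l.length + 1) * (R + 1))) with hη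
  have hη0 : 0 < η := by positivity
  obtain ⟨τ, hτ⟩ := exists_simpleFunc_of_eventually
    (P := fun g g' => (∀ ξ ∈ {ξ | ξ ∈ l}, ‖(a g' : H →L[ℂ] H) ξ - (a g : H →L[ℂ] H) ξ‖ < η) ∧
      ‖φ (a g') w - φ (a g) w‖ < η) (fun g => by
      refine Filter.Eventually.and ?_ ?_
      · refine (Filter.eventually_all_finite l.finite_toSet).2 fun ξ _ => ?_
        have := ((ha.cont ξ).sub (continuous_const (y := (a g : H →L[ℂ] H) ξ))).norm
        exact this.continuousAt.eventually_lt continuousAt_const (by simpa using hη0)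
      · have := ((hφa.cont w).sub (continuous_const (y := φ (a g) w))).norm
        exact this.continuousAt.eventually_lt continuousAt_const (by simpa using hη0))
    hk2.isCompact
  set m : G → L2 μ →L[ℂ] L2 μ := fun s => mulOp μ ((τ ⁻¹' {s}).indicator fun _ => 1) with hm
  -- The Riemann sum `c` approximates `b` on the vectors of the list `l`, and `φ c` approximates
  -- the right-hand side on `w`; the estimate for `φ` carries the former over to `φ b`.
  set c : A.toStarSubalgebra := ∑ s ∈ τ.range, ⟪f, m s k⟫_ℂ • a s with hc
  have hBa := isBddMeas_comp_simpleFunc ha.bdd τ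
  have hBφ := isBddMeas_comp_simpleFunc hφa.bdd τ
  have hc1 : (c : H →L[ℂ] H) = slice (decomposable μ fun g => (a (τ g) : H →L[ℂ] H)) f k := by
    rw [decomposable_comp_simpleFunc (fun g => (a g : H →L[ℂ] H)), slice_sum]
    simp only [slice_opTensor]
    rw [hc]
    exact map_sum A.toStarSubalgebra.subtype _ _
  have hc2 : φ c = slice (decomposable μ fun g => φ (a (τ g))) f k := by
    rw [decomposable_comp_simpleFunc (fun g => φ (a g)), slice_sum]
    simp only [slice_opTensor]
    rw [hc, map_sum]
    simp only [map_smul]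
    rfl
  have h1 : ‖(φ c - slice (decomposable μ fun g => φ (a g)) f k) w‖ ≤ R * η := by
    rw [hc2, ← norm_neg, ← neg_apply, neg_sub]
    refine (norm_slice_decomposable_sub_le hφa.isBddMeas hBφ hk3 hη0.le
      fun g hg => (hτ g hg).2.le).trans (le_of_eq ?_)
    rw [hR]; ring
  have h2 : ∀ ξ ∈ l, ‖((b - c : A.toStarSubalgebra) : H →L[ℂ] H) ξ‖ ≤ R * η := fun ξ hξ => by
    have : ((b - c : A.toStarSubalgebra) : H →L[ℂ] H) = (b : H →L[ℂ] H) - c := rfl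
    rw [this, hb, hc1]
    refine (norm_slice_decomposable_sub_le ha.isBddMeas hBa hk3 hη0.le
      fun g hg => ((hτ g hg).1 ξ hξ).le).trans (le_of_eq ?_)
    rw [hR]; ring
  have h3 : (l.map fun ξ => ‖((b - c : A.toStarSubalgebra) : H →L[ℂ] H) ξ‖).sum ≤
      l.length * (R * η) := by
    refine (List.sum_le_card_nsmul _ (R * η) fun r hr => ?_).trans (by simp)
    obtain ⟨ξ, hξ, rfl⟩ := List.mem_map.1 hr
    exact h2 ξ hξ
  have h4 : ‖((b - c : A.toStarSubalgebra) : H →L[ℂ] H)‖ ≤ 2 * C * R := by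
    have : ((b - c : A.toStarSubalgebra) : H →L[ℂ] H) = (b : H →L[ℂ] H) - c := rfl
    rw [this, hb, hc1]
    have e1 := norm_slice_le (decomposable μ fun g => (a g : H →L[ℂ] H)) f k
    have e2 := norm_slice_le (decomposable μ fun g => (a (τ g) : H →L[ℂ] H)) f k
    have e3 := ha.isBddMeas.norm_decomposable_le (μ := μ) hC
    have e4 := hBa.norm_decomposable_le (μ := μ) (fun g => hC (τ g))
    refine (norm_sub_le _ _).trans ((add_le_add e1 e2).trans ?_)
    calc _ ≤ ‖f‖ * C * ‖k‖ + ‖f‖ * C * ‖k‖ := by gcongr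
      _ = _ := by rw [hR]; ring
  have h5 : φ b w - slice (decomposable μ fun g => φ (a g)) f k w =
      φ (b - c) w + (φ c - slice (decomposable μ fun g => φ (a g)) f k) w := by
    rw [map_sub, sub_apply, sub_apply]; abel
  rw [h5, zero_add]
  have h6 : (l.length + 1) * (R * η) ≤ ε / 2 := by
    rw [hη, mul_div_assoc', mul_div_assoc', div_le_div_iff₀ (by positivity) (by positivity)]
    nlinarith [mul_nonneg (show (0 : ℝ) ≤ l.length + 1 by positivity) hε.le]
  have h7 : ε / (2 * (2 * C * R + 1)) * ‖((b - c : A.toStarSubalgebra) : H →L[ℂ] H)‖ ≤ ε / 2 := by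
    refine (mul_le_mul_of_nonneg_left h4 (by positivity)).trans ?_
    rw [div_mul_eq_mul_div, div_le_div_iff₀ (by positivity) (by positivity)]
    nlinarith
  refine (norm_add_le _ _).trans ?_
  linarith [hl (b - c)]

end

section

variable {G : Type*} [Group G] [TopologicalSpace G] [IsTopologicalGroup G] [LocallyCompactSpace G]
  [MeasurableSpace G] [BorelSpace G] {μ : Measure G} [μ.IsHaarMeasure] [μ.Regular]
  {H K : Type*} [NormedAddCommGroup H] [InnerProductSpace ℂ H] [CompleteSpace H]
  [NormedAddCommGroup K] [InnerProductSpace ℂ K] [CompleteSpace K]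

/-! ### The regular representations -/

/-- A strongly continuous representation by isometries, and hence by unitary operators. -/
structure IsUnitaryRep (U : G → (K →L[ℂ] K)) : Prop where
  map_one : U 1 = 1
  map_mul : ∀ g h, U (g * h) = U g * U h
  norm_map : ∀ g ξ, ‖U g ξ‖ = ‖ξ‖
  cont : ∀ ξ, Continuous fun g => U g ξ

namespace IsUnitaryRep

variable {U V : G → (K →L[ℂ] K)} (hU : IsUnitaryRep U)

include hU

theorem adjoint_mul_self (g : G) : adjoint (U g) * U g = 1 :=
  adjoint_comp_self_of_norm (hU.norm_map g)

theorem adjoint_eq (g : G) : adjoint (U g) = U g⁻¹ := by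
  have h : U g * U g⁻¹ = 1 := by rw [← hU.map_mul, mul_inv_cancel, hU.map_one]
  calc adjoint (U g) = adjoint (U g) * (U g * U g⁻¹) := by rw [h, mul_one]
    _ = U g⁻¹ := by rw [← mul_assoc, hU.adjoint_mul_self, one_mul]

theorem self_mul_adjoint (g : G) : U g * adjoint (U g) = 1 := by
  rw [hU.adjoint_eq, ← hU.map_mul, mul_inv_cancel, hU.map_one]

theorem isStrongCont : IsStrongCont U where
  bdd := ⟨1, fun g => ContinuousLinearMap.opNorm_le_bound _ zero_le_one fun ξ => by
    rw [hU.norm_map, one_mul]⟩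
  cont := hU.cont

theorem isStrongCont_adjoint : IsStrongCont fun g => adjoint (U g) where
  bdd := by simp only [hU.adjoint_eq]; exact hU.isStrongCont.bdd.imp fun C hC g => hC _
  cont ξ := by simp only [hU.adjoint_eq]; exact (hU.cont ξ).comp continuous_inv

theorem mul (hV : IsUnitaryRep V) (hUV : ∀ g h, U g * V h = V h * U g) :
    IsUnitaryRep fun g => U g * V g where
  map_one := by rw [hU.map_one, hV.map_one, one_mul]
  map_mul g h := by
    rw [hU.map_mul, hV.map_mul]
    simp only [mul_assoc]
    rw [← mul_assoc (U h) (V g), hUV h g]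
    simp only [mul_assoc]
  norm_map g ξ := by rw [mul_apply_eq_comp, hU.norm_map, hV.norm_map]
  cont := (hU.isStrongCont.mul hV.isStrongCont).cont

end IsUnitaryRep

/-- A family of isometries is strongly continuous if its coefficients at vectors of total sets are
continuous. -/
theorem continuous_of_total {U : G → (K →L[ℂ] K)} (hn : ∀ g ξ, ‖U g ξ‖ = ‖ξ‖) {S T : Set K}
    (hS : Total S) (hT : Total T) (h : ∀ f ∈ S, ∀ k ∈ T, Continuous fun g => ⟪f, U g k⟫_ℂ)
    (ξ : K) : Continuous fun g => U g ξ := by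
  have hw := isWeakCont_of_total (F := U) hS hT (C := 1)
    (fun g => ContinuousLinearMap.opNorm_le_bound _ zero_le_one fun ξ => by rw [hn, one_mul]) h
  rw [continuous_iff_continuousAt]
  intro g₀
  rw [ContinuousAt, tendsto_iff_norm_sub_tendsto_zero]
  have h2 : ∀ g, ‖U g ξ - U g₀ ξ‖ ^ 2 = 2 * ‖ξ‖ ^ 2 - 2 * (⟪U g₀ ξ, U g ξ⟫_ℂ).re := fun g => by
    rw [@norm_sub_sq ℂ, hn, hn, ← inner_conj_symm, RCLike.conj_re, RCLike.re_to_complex]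
    ring
  have h3 : Continuous fun g => ‖U g ξ - U g₀ ξ‖ ^ 2 := by
    simp only [h2]
    exact continuous_const.sub (continuous_const.mul (Complex.continuous_re.comp (hw (U g₀ ξ) ξ)))
  have h4 := (Real.continuous_sqrt.comp h3).tendsto g₀
  simpa [Function.comp_def, Real.sqrt_sq] using h4

theorem continuous_integral_of_hasCompactSupport {X : Type*} [TopologicalSpace X] {f₀ : G → ℂ}
    (hf : Continuous f₀) (hs : HasCompactSupport f₀) {k : X → G → ℂ}
    (hk : Continuous k.uncurry) : Continuous fun x => ∫ h, f₀ h * k x h ∂μ := by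
  rw [← continuousOn_univ]
  refine continuousOn_integral_of_compact_support (f := fun x h => f₀ h * k x h) hs.isCompact
    ?_ fun x h _ hh => by simp [image_eq_zero_of_notMem_tsupport hh]
  exact ((hf.comp continuous_snd).mul hk).continuousOn

theorem coeFn_leftReg (g : G) (ξ : L2 μ) : leftReg μ g ξ =ᵐ[μ] fun h => ξ (g⁻¹ * h) :=
  Lp.coeFn_compMeasurePreserving ξ (measurePreserving_mul_left μ g⁻¹)

theorem quasiMeasurePreserving_mul_left' (g : G) :
    Measure.QuasiMeasurePreserving (fun h => g * h) μ μ :=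
  (measurePreserving_mul_left μ g).quasiMeasurePreserving

theorem isUnitaryRep_leftReg : IsUnitaryRep (leftReg μ) where
  map_one := by
    ext ξ
    filter_upwards [coeFn_leftReg 1 ξ] with h h1
    rw [h1, one_apply_eq_self]
    simp
  map_mul g h := by
    ext ξ
    filter_upwards [coeFn_leftReg (g * h) ξ, coeFn_leftReg g (leftReg μ h ξ),
      (quasiMeasurePreserving_mul_left' g⁻¹).ae_eq_comp (coeFn_leftReg h ξ)] with x h1 h2 h3
    rw [h1, mul_apply_eq_comp, h2]
    simp only [Function.comp_apply] at h3
    rw [h3, mul_inv_rev, mul_assoc]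
  norm_map g ξ := (Lp.compMeasurePreservingₗᵢ ℂ (fun h => g⁻¹ * h)
    (measurePreserving_mul_left μ g⁻¹)).norm_map ξ
  cont := by
    refine continuous_of_total (fun g ξ => (Lp.compMeasurePreservingₗᵢ ℂ (fun h => g⁻¹ * h)
      (measurePreserving_mul_left μ g⁻¹)).norm_map ξ) total_isCc total_isCc ?_
    rintro f ⟨f₀, hf1, hf2, hf3⟩ k ⟨k₀, hk1, -, hk3⟩
    have e : ∀ g, ⟪f, leftReg μ g k⟫_ℂ = ∫ h, starRingEnd ℂ (f₀ h) * k₀ (g⁻¹ * h) ∂μ := fun g => by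
      rw [L2.inner_def]
      refine integral_congr_ae ?_
      filter_upwards [hf3, coeFn_leftReg g k,
        (quasiMeasurePreserving_mul_left' g⁻¹).ae_eq_comp hk3] with h h1 h2 h3
      simp only [Function.comp_apply] at h3
      rw [h1, h2, h3]
      simp [mul_comm]
    simp only [e]
    refine continuous_integral_of_hasCompactSupport (Complex.continuous_conj.comp hf1)
      (hf2.comp_left (g := starRingEnd ℂ) (map_zero _)) (hk1.comp ?_)
    exact (continuous_fst.inv).mul continuous_snd

/-- The modular function is the quotient of `∫ φ(h g) dh` by `∫ φ(h) dh`, for any cutoff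
function `φ`. -/
theorem continuous_modularCharacterFun :
    Continuous fun g : G => (Measure.modularCharacterFun g : ℝ) := by
  let μ : Measure G := Measure.haar
  obtain ⟨φ, hφ1, -, hφ3, hφ4⟩ := exists_continuous_one_zero_of_isCompact
    (isCompact_singleton (x := (1 : G))) isClosed_empty (Set.disjoint_empty _)
  have hφ1 : φ 1 = 1 := hφ1 rfl
  have hpos : 0 < ∫ h, φ h ∂μ :=
    φ.continuous.integral_pos_of_hasCompactSupport_nonneg_nonzero hφ3 (fun g => (hφ4 g).1)
      (x := 1) (by rw [hφ1]; exact one_ne_zero)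
  have e : ∀ g : G, (Measure.modularCharacterFun g : ℝ) = (∫ h, φ (h * g) ∂μ) / ∫ h, φ h ∂μ :=
    fun g => by
    rw [eq_div_iff hpos.ne', ← integral_map (φ := fun h => h * g) (f := φ)
      (measurable_mul_const g).aemeasurable φ.continuous.aestronglyMeasurable,
      map_mul_right_eq, integral_smul_nnreal_measure]
    rfl
  simp only [e]
  refine Continuous.div_const (continuous_iff_continuousAt.2 fun g₀ => ?_) _
  obtain ⟨S, hS, hS'⟩ := exists_compact_mem_nhds g₀
  refine (continuousOn_integral_of_compact_support (f := fun g h => φ (h * g)) (s := S)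
    (hφ3.isCompact.mul hS.inv) ?_ fun g h hg hh => ?_).continuousAt hS'
  · exact (φ.continuous.comp (continuous_snd.mul continuous_fst)).continuousOn
  · refine image_eq_zero_of_notMem_tsupport fun hcon => hh ?_
    exact ⟨h * g, hcon, g⁻¹, Set.inv_mem_inv.2 hg, by simp⟩

theorem coeFn_rightReg (g : G) (ξ : L2 μ) :
    rightReg μ g ξ =ᵐ[μ] fun h => (Real.sqrt (modularFunction g) : ℂ) * ξ (h * g) := by
  change ((Real.sqrt (modularFunction g) : ℝ) : ℂ) • (memLp_mul_right μ g ξ).toLp =ᵐ[μ] _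
  filter_upwards [Lp.coeFn_smul ((Real.sqrt (modularFunction g) : ℝ) : ℂ)
    (memLp_mul_right μ g ξ).toLp, (memLp_mul_right μ g ξ).coeFn_toLp] with h h1 h2
  rw [h1, Pi.smul_apply, h2, smul_eq_mul]

theorem isUnitaryRep_rightReg : IsUnitaryRep (rightReg μ) where
  map_one := by
    ext ξ
    filter_upwards [coeFn_rightReg 1 ξ] with h h1
    rw [h1, one_apply_eq_self]
    simp [modularFunction, Measure.modularCharacterFun_map_one]
  map_mul g h := by
    ext ξ
    filter_upwards [coeFn_rightReg (g * h) ξ, coeFn_rightReg g (rightReg μ h ξ),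
      (quasiMeasurePreserving_mul_right μ g).ae_eq_comp (coeFn_rightReg h ξ)] with x h1 h2 h3
    rw [h1, mul_apply_eq_comp, h2]
    simp only [Function.comp_apply] at h3
    have h4 : modularFunction (g * h) = modularFunction g * modularFunction h := by
      simp only [modularFunction, Measure.modularCharacterFun_map_mul, mul_inv, NNReal.coe_mul]
    have h5 : 0 ≤ modularFunction g := NNReal.coe_nonneg _
    rw [h3, h4, Real.sqrt_mul h5, Complex.ofReal_mul, mul_assoc, mul_assoc x]
  norm_map g ξ := norm_mul_right μ g ξ
  cont := by
    refine continuous_of_total (fun g ξ => norm_mul_right μ g ξ) total_isCc total_isCc ?_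
    rintro f ⟨f₀, hf1, hf2, hf3⟩ k ⟨k₀, hk1, -, hk3⟩
    have e : ∀ g, ⟪f, rightReg μ g k⟫_ℂ = (Real.sqrt (modularFunction g) : ℂ) *
        ∫ h, starRingEnd ℂ (f₀ h) * k₀ (h * g) ∂μ := fun g => by
      rw [L2.inner_def, ← integral_const_mul]
      refine integral_congr_ae ?_
      filter_upwards [hf3, coeFn_rightReg g k,
        (quasiMeasurePreserving_mul_right μ g).ae_eq_comp hk3] with h h1 h2 h3
      simp only [Function.comp_apply] at h3
      rw [h1, h2, h3]
      simp
      ring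
    simp only [e]
    refine Continuous.mul (Complex.continuous_ofReal.comp (Real.continuous_sqrt.comp ?_)) ?_
    · change Continuous fun g : G => ((Measure.modularCharacterFun g)⁻¹ : NNReal).toReal
      simp only [NNReal.coe_inv]
      refine continuous_modularCharacterFun.inv₀ fun g => ?_
      exact_mod_cast (Measure.modularCharacterFun_pos g).ne'
    · refine continuous_integral_of_hasCompactSupport (Complex.continuous_conj.comp hf1)
        (hf2.comp_left (g := starRingEnd ℂ) (map_zero _)) (hk1.comp ?_)
      exact continuous_snd.mul continuous_fst

theorem leftReg_mul_rightReg (g h : G) :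
    leftReg μ g * rightReg μ h = rightReg μ h * leftReg μ g := by
  ext ξ
  filter_upwards [coeFn_leftReg g (rightReg μ h ξ), coeFn_rightReg h (leftReg μ g ξ),
    (quasiMeasurePreserving_mul_left' g⁻¹).ae_eq_comp (coeFn_rightReg h ξ),
    (quasiMeasurePreserving_mul_right μ h).ae_eq_comp (coeFn_leftReg g ξ)] with x h1 h2 h3 h4
  simp only [Function.comp_apply] at h3 h4
  rw [mul_apply_eq_comp, mul_apply_eq_comp, h1, h2, h3, h4, mul_assoc]

theorem isUnitaryRep_adjReg : IsUnitaryRep (adjReg μ) :=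
  isUnitaryRep_leftReg.mul isUnitaryRep_rightReg leftReg_mul_rightReg

/-! ### The coproduct of the group von Neumann algebra -/

theorem leftReg_star_mem : ∀ x ∈ Set.range (leftReg μ), star x ∈ Set.range (leftReg μ) := by
  rintro _ ⟨g, rfl⟩
  exact ⟨g⁻¹, (isUnitaryRep_leftReg.adjoint_eq g).symm⟩

theorem leftReg_mem_groupVN (g : G) : leftReg μ g ∈ groupVN μ :=
  mem_generated_of_mem leftReg_star_mem ⟨g, rfl⟩

/-- A decomposable operator with unitary values is unitary. -/
theorem IsUnitaryRep.decomposable_mul_adjoint {U : G → (K →L[ℂ] K)} (hU : IsUnitaryRep U) :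
    decomposable μ U * adjoint (decomposable μ U) = 1 := by
  have h1 : adjoint (decomposable μ U) = decomposable μ fun g => adjoint (U g) :=
    hU.isStrongCont.isBddMeas.star_decomposable
  rw [h1, hU.isStrongCont.isBddMeas.decomposable_mul hU.isStrongCont_adjoint
    (hU.isStrongCont.mul hU.isStrongCont_adjoint).isBddMeas]
  simp only [hU.self_mul_adjoint]
  rw [decomposable_const, opTensor_one]

theorem IsUnitaryRep.adjoint_mul_decomposable {U : G → (K →L[ℂ] K)} (hU : IsUnitaryRep U) :
    adjoint (decomposable μ U) * decomposable μ U = 1 := by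
  have h1 : adjoint (decomposable μ U) = decomposable μ fun g => adjoint (U g) :=
    hU.isStrongCont.isBddMeas.star_decomposable
  rw [h1, hU.isStrongCont_adjoint.isBddMeas.decomposable_mul hU.isStrongCont
    (hU.isStrongCont_adjoint.mul hU.isStrongCont).isBddMeas]
  simp only [hU.adjoint_mul_self]
  rw [decomposable_const, opTensor_one]

theorem flip_unitary : adjoint (flip H K) ∘L flip H K = .id ℂ _ := by
  rw [adjoint_flip, flip_comp_flip]

theorem flip_unitary' : flip H K ∘L adjoint (flip H K) = .id ℂ _ := by
  rw [adjoint_flip, flip_comp_flip]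

theorem adjoint_fundamentalUnitary : adjoint (fundamentalUnitary μ) =
    conjBy (flip (L2 μ) (L2 μ)) (adjoint (decomposable μ (leftReg μ))) :=
  star_conjBy _ _

theorem adjoint_mul_fundamentalUnitary :
    adjoint (fundamentalUnitary μ) * fundamentalUnitary μ = 1 := by
  rw [adjoint_fundamentalUnitary, fundamentalUnitary, ← conjBy_mul flip_unitary,
    isUnitaryRep_leftReg.adjoint_mul_decomposable, conjBy_one flip_unitary']

theorem fundamentalUnitary_mul_adjoint :
    fundamentalUnitary μ * adjoint (fundamentalUnitary μ) = 1 := by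
  rw [adjoint_fundamentalUnitary, fundamentalUnitary, ← conjBy_mul flip_unitary,
    isUnitaryRep_leftReg.decomposable_mul_adjoint, conjBy_one flip_unitary']

/-- The substitution `s ↦ g s` in the integral for the coefficients. -/
theorem decomposable_leftReg_mul (g : G) :
    decomposable μ (leftReg μ) * opTensor 1 (leftReg μ g) =
      opTensor (leftReg μ g) (leftReg μ g) * decomposable μ (leftReg μ) := by
  have hb := (isUnitaryRep_leftReg (μ := μ)).isStrongCont.isBddMeas
  refine clm_ext_inner_tmul fun x f y k => ?_
  rw [mul_apply_eq_comp, mul_apply_eq_comp, opTensor_tmul, one_apply_eq_self, hb.isDecomposed,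
    ← adjoint_inner_left, adjoint_opTensor, opTensor_tmul, hb.isDecomposed,
    isUnitaryRep_leftReg.adjoint_eq,
    ← integral_mul_left_eq_self (μ := μ) (fun s => (starRingEnd ℂ) (f s) * (leftReg μ g k) s *
      ⟪x, leftReg μ s y⟫_ℂ) g]
  refine integral_congr_ae ?_
  filter_upwards [coeFn_leftReg g⁻¹ f,
    (quasiMeasurePreserving_mul_left' g).ae_eq_comp (coeFn_leftReg g k)] with s h1 h2
  simp only [Function.comp_apply, inv_mul_cancel_left] at h2
  rw [h1, h2, inv_inv, isUnitaryRep_leftReg.map_mul, ← isUnitaryRep_leftReg.adjoint_eq,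
    adjoint_inner_left, mul_apply_eq_comp]

/-- The identity `W (λ(g) ⊗ 1) = (λ(g) ⊗ λ(g)) W`, that is, `Γ̂(λ(g)) = λ(g) ⊗ λ(g)`. -/
theorem fundamentalUnitary_mul (g : G) :
    fundamentalUnitary μ * opTensor (leftReg μ g) 1 =
      opTensor (leftReg μ g) (leftReg μ g) * fundamentalUnitary μ := by
  rw [fundamentalUnitary, ← conjBy_flip_opTensor (1 : L2 μ →L[ℂ] L2 μ) (leftReg μ g),
    ← conjBy_flip_opTensor (leftReg μ g) (leftReg μ g), ← conjBy_mul flip_unitary,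
    ← conjBy_mul flip_unitary, decomposable_leftReg_mul]

theorem conjBy_eq_mul (U X : K →L[ℂ] K) : conjBy U X = U * X * adjoint U := rfl

/-- The coproduct of `𝓛(G)` intertwines the conjugations by `λ(g)` and by `λ(g) ⊗ λ(g)`. -/
theorem conjBy_fundamentalUnitary_conjBy (g : G) (n : L2 μ →L[ℂ] L2 μ) :
    conjBy (fundamentalUnitary μ) (opTensor (conjBy (leftReg μ g) n) 1) =
      conjBy (opTensor (leftReg μ g) (leftReg μ g))
        (conjBy (fundamentalUnitary μ) (opTensor n 1)) := by
  have h1 : opTensor (conjBy (leftReg μ g) n) (1 : L2 μ →L[ℂ] L2 μ) =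
      conjBy (opTensor (leftReg μ g) (1 : L2 μ →L[ℂ] L2 μ)) (opTensor n 1) := by
    rw [conjBy_eq_mul, conjBy_eq_mul, adjoint_opTensor, opTensor_mul, opTensor_mul,
      ← ContinuousLinearMap.star_eq_adjoint (1 : L2 μ →L[ℂ] L2 μ), star_one, mul_one, mul_one]
  rw [h1, conjBy_conjBy, conjBy_conjBy]
  congr 1
  exact fundamentalUnitary_mul g

/-- The coproduct of an element of `𝓛(G)` commutes with `ρ(h) ⊗ 1`. -/
theorem groupCoproduct_commute_rightReg {n : L2 μ →L[ℂ] L2 μ} (hn : n ∈ groupVN μ) (h : G) :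
    opTensor (rightReg μ h) 1 * conjBy (fundamentalUnitary μ) (opTensor n 1) =
      conjBy (fundamentalUnitary μ) (opTensor n 1) * opTensor (rightReg μ h) 1 := by
  set W := fundamentalUnitary μ with hW
  have h1 : adjoint W * W = 1 := adjoint_mul_fundamentalUnitary
  have h2 : W * adjoint W = 1 := fundamentalUnitary_mul_adjoint
  -- It suffices that `n ⊗ 1` commutes with `X = W* (ρ(h) ⊗ 1) W`, which needs to be checked only
  -- for the generators `n = λ(g)`.
  set X := adjoint W * opTensor (rightReg μ h) 1 * W with hX
  have h3 : opTensor n 1 * X = X * opTensor n 1 := by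
    refine commute_of_generated leftReg_star_mem ?_ hn
    rintro _ ⟨g, rfl⟩
    have e1 : W * opTensor (leftReg μ g) 1 = opTensor (leftReg μ g) (leftReg μ g) * W :=
      fundamentalUnitary_mul g
    have e2 : opTensor (leftReg μ g) 1 * adjoint W =
        adjoint W * opTensor (leftReg μ g) (leftReg μ g) := by
      calc opTensor (leftReg μ g) 1 * adjoint W
          = adjoint W * (W * opTensor (leftReg μ g) 1) * adjoint W := by
            rw [← mul_assoc, h1, one_mul]
        _ = adjoint W * opTensor (leftReg μ g) (leftReg μ g) * (W * adjoint W) := by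
            rw [e1]; simp only [mul_assoc]
        _ = _ := by rw [h2, mul_one]
    calc opTensor (leftReg μ g) 1 * X
        = adjoint W * (opTensor (leftReg μ g) (leftReg μ g) * opTensor (rightReg μ h) 1) * W := by
          rw [hX]; simp only [← mul_assoc]; rw [e2]
      _ = adjoint W * (opTensor (rightReg μ h) 1 * opTensor (leftReg μ g) (leftReg μ g)) * W := by
          rw [opTensor_mul, opTensor_mul, leftReg_mul_rightReg, mul_one, one_mul]
      _ = X * opTensor (leftReg μ g) 1 := by
          rw [hX]; simp only [mul_assoc]; rw [e1]
  have h4 : W * X = opTensor (rightReg μ h) 1 * W := by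
    rw [hX]; simp only [← mul_assoc]; rw [h2, one_mul]
  have h5 : X * adjoint W = adjoint W * opTensor (rightReg μ h) 1 := by
    rw [hX, mul_assoc, h2, mul_one]
  rw [conjBy_eq_mul]
  calc opTensor (rightReg μ h) 1 * (W * opTensor n 1 * adjoint W)
      = (opTensor (rightReg μ h) 1 * W) * (opTensor n 1 * adjoint W) := by simp only [mul_assoc]
    _ = W * (opTensor n 1 * X) * adjoint W := by rw [← h4, h3]; simp only [mul_assoc]
    _ = W * opTensor n 1 * adjoint W * opTensor (rightReg μ h) 1 := by
        simp only [mul_assoc]; rw [h5]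

end

/-! ### Amplifications -/

section Amplification

variable {H K L H' K' : Type*}
  [NormedAddCommGroup H] [InnerProductSpace ℂ H] [CompleteSpace H]
  [NormedAddCommGroup K] [InnerProductSpace ℂ K] [CompleteSpace K]
  [NormedAddCommGroup L] [InnerProductSpace ℂ L] [CompleteSpace L]
  [NormedAddCommGroup H'] [InnerProductSpace ℂ H'] [CompleteSpace H']
  [NormedAddCommGroup K'] [InnerProductSpace ℂ K'] [CompleteSpace K']

theorem IsAmplification.amplify_eq {M : VonNeumannAlgebra H}
    {φ : M.toStarSubalgebra → (H' →L[ℂ] H')} {X : H ⊗ʰ K →L[ℂ] H ⊗ʰ K}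
    {Y : H' ⊗ʰ K →L[ℂ] H' ⊗ʰ K} (h : IsAmplification M φ X Y) : amplify M φ X = Y := by
  have hex : ∃ Y, IsAmplification M φ X Y := ⟨Y, h⟩
  rw [amplify, dif_pos hex]
  refine ext_slice fun ζ η => ?_
  obtain ⟨_, h1⟩ := hex.choose_spec ζ η
  obtain ⟨_, h2⟩ := h ζ η
  rw [h1, h2]

theorem amplifyLeft_eq {N : VonNeumannAlgebra K} {ψ : N.toStarSubalgebra → (K' →L[ℂ] K')}
    {X : H ⊗ʰ K →L[ℂ] H ⊗ʰ K} {Y : H ⊗ʰ K' →L[ℂ] H ⊗ʰ K'}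
    (h : ∀ ξ ξ', ∃ hm : sliceLeft X ξ ξ' ∈ N.toStarSubalgebra,
      sliceLeft Y ξ ξ' = ψ ⟨sliceLeft X ξ ξ', hm⟩) : amplifyLeft N ψ X = Y := by
  have h1 : IsAmplification N ψ (conjBy (flip H K) X) (conjBy (flip H K') Y) := h
  rw [amplifyLeft, h1.amplify_eq, conjBy_flip_conjBy_flip]

theorem slice_conjBy_opTensor_one (U : H →L[ℂ] H') (X : H ⊗ʰ K →L[ℂ] H ⊗ʰ K) (ζ η : K) :
    slice (conjBy (opTensor U (1 : K →L[ℂ] K)) X) ζ η = conjBy U (slice X ζ η) :=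
  clm_ext_inner fun x y => by
    have h1 : adjoint (1 : K →L[ℂ] K) = 1 := star_one _
    rw [inner_slice, inner_conjBy, inner_conjBy, inner_slice, adjoint_opTensor, opTensor_tmul,
      opTensor_tmul, h1, one_apply_eq_self, one_apply_eq_self]

theorem sliceLeft_conjBy_one_opTensor (U : K →L[ℂ] K') (X : H ⊗ʰ K →L[ℂ] H ⊗ʰ K) (ξ ξ' : H) :
    sliceLeft (conjBy (opTensor (1 : H →L[ℂ] H) U) X) ξ ξ' = conjBy U (sliceLeft X ξ ξ') :=
  clm_ext_inner fun x y => by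
    have h1 : adjoint (1 : H →L[ℂ] H) = 1 := star_one _
    rw [inner_sliceLeft, inner_conjBy, inner_conjBy, inner_sliceLeft, adjoint_opTensor,
      opTensor_tmul, opTensor_tmul, h1, one_apply_eq_self, one_apply_eq_self]

/-- The unitary operator `(x ⊗ z) ⊗ y ↦ (x ⊗ y) ⊗ z`. -/
def swapRight (H L K : Type*) [NormedAddCommGroup H] [InnerProductSpace ℂ H] [CompleteSpace H]
    [NormedAddCommGroup L] [InnerProductSpace ℂ L] [CompleteSpace L]
    [NormedAddCommGroup K] [InnerProductSpace ℂ K] [CompleteSpace K] :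
    (H ⊗ʰ L) ⊗ʰ K →L[ℂ] (H ⊗ʰ K) ⊗ʰ L :=
  adjoint (assoc H K L) ∘L opTensor (1 : H →L[ℂ] H) (flip L K) ∘L assoc H L K

theorem adjoint_swapRight : adjoint (swapRight H L K) = swapRight H K L := by
  have h1 : adjoint (1 : H →L[ℂ] H) = 1 := star_one _
  rw [swapRight, swapRight, ContinuousLinearMap.adjoint_comp, ContinuousLinearMap.adjoint_comp,
    adjoint_opTensor, adjoint_flip, ContinuousLinearMap.adjoint_adjoint, h1,
    ContinuousLinearMap.comp_assoc]

theorem swapRight_tmul (x : H) (z : L) (y : K) :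
    swapRight H L K (tmul (tmul x z) y) = tmul (tmul x y) z := by
  simp [swapRight, assoc_tmul, opTensor_tmul, flip_tmul, adjoint_assoc_tmul]

/-- The operator `X₁₃` on `H ⊗ K ⊗ L` that acts like `X` on the legs `H` and `L`. -/
def leg13 (K : Type*) [NormedAddCommGroup K] [InnerProductSpace ℂ K] [CompleteSpace K]
    (X : H ⊗ʰ L →L[ℂ] H ⊗ʰ L) : (H ⊗ʰ K) ⊗ʰ L →L[ℂ] (H ⊗ʰ K) ⊗ʰ L :=
  conjBy (swapRight H L K) (opTensor X 1)

theorem inner_leg13 (X : H ⊗ʰ L →L[ℂ] H ⊗ʰ L) (x x' : H) (y y' : K) (z z' : L) :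
    ⟪tmul (tmul x y) z, leg13 K X (tmul (tmul x' y') z')⟫_ℂ =
      ⟪tmul x z, X (tmul x' z')⟫_ℂ * ⟪y, y'⟫_ℂ := by
  rw [leg13, inner_conjBy, adjoint_swapRight, swapRight_tmul, swapRight_tmul, opTensor_tmul,
    inner_tmul, one_apply_eq_self]

theorem slice_leg13 (X : H ⊗ʰ L →L[ℂ] H ⊗ʰ L) (ζ η : L) :
    slice (leg13 K X) ζ η = opTensor (slice X ζ η) 1 :=
  clm_ext_inner_tmul fun x y x' y' => by
    rw [inner_slice, inner_leg13, opTensor_tmul, inner_tmul, inner_slice, one_apply_eq_self]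

theorem sliceLeft_conjBy_assoc_leg13 (X : H ⊗ʰ L →L[ℂ] H ⊗ʰ L) (ξ ξ' : H) :
    sliceLeft (conjBy (assoc H K L) (leg13 K X)) ξ ξ' = opTensor 1 (sliceLeft X ξ ξ') :=
  clm_ext_inner_tmul fun x y x' y' => by
    rw [inner_sliceLeft, inner_conjBy, adjoint_assoc_tmul, adjoint_assoc_tmul, inner_leg13,
      opTensor_tmul, inner_tmul, inner_sliceLeft, one_apply_eq_self, mul_comm]

theorem sliceLeft_conjBy_assoc_opTensor (X : H ⊗ʰ K →L[ℂ] H ⊗ʰ K) (b : L →L[ℂ] L) (ξ ξ' : H) :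
    sliceLeft (conjBy (assoc H K L) (opTensor X b)) ξ ξ' = opTensor (sliceLeft X ξ ξ') b :=
  clm_ext_inner_tmul fun x y x' y' => by
    rw [inner_sliceLeft, inner_conjBy, adjoint_assoc_tmul, adjoint_assoc_tmul, opTensor_tmul,
      opTensor_tmul, inner_tmul, inner_tmul, inner_sliceLeft]

/-- The amplification of `Z ↦ Z₁₃` to `X` exists. -/
theorem exists_sliceLeft_leg13 (X : H' ⊗ʰ (H ⊗ʰ L) →L[ℂ] H' ⊗ʰ (H ⊗ʰ L)) :
    ∃ Y : H' ⊗ʰ ((H ⊗ʰ K) ⊗ʰ L) →L[ℂ] H' ⊗ʰ ((H ⊗ʰ K) ⊗ʰ L),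
      ∀ ξ ξ', sliceLeft Y ξ ξ' = leg13 K (sliceLeft X ξ ξ') :=
  ⟨conjBy (opTensor 1 (swapRight H L K)) (conjBy (assoc H' (H ⊗ʰ L) K) (opTensor X 1)),
    fun ξ ξ' => by
      rw [sliceLeft_conjBy_one_opTensor, sliceLeft_conjBy_assoc_opTensor, leg13]⟩

end Amplification

section

variable {G : Type*} [Group G] [TopologicalSpace G] [IsTopologicalGroup G] [LocallyCompactSpace G]
  [MeasurableSpace G] [BorelSpace G] {μ : Measure G} [μ.IsHaarMeasure] [μ.Regular]
  {H K K' : Type*} [NormedAddCommGroup H] [InnerProductSpace ℂ H] [CompleteSpace H]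
  [NormedAddCommGroup K] [InnerProductSpace ℂ K] [CompleteSpace K]
  [NormedAddCommGroup K'] [InnerProductSpace ℂ K'] [CompleteSpace K']

/-! ### The coproduct of the dual of the quantum double -/

/-- `(Γ̂ ⊗ Γ)(X)` for an arbitrary operator `X`, with the implementations of `Γ̂` and `Γ`. -/
def tensorCoproduct (X : L2 μ ⊗ʰ L2 μ →L[ℂ] L2 μ ⊗ʰ L2 μ) :
    (L2 μ ⊗ʰ L2 μ) ⊗ʰ (L2 μ ⊗ʰ L2 μ) →L[ℂ] (L2 μ ⊗ʰ L2 μ) ⊗ʰ (L2 μ ⊗ʰ L2 μ) :=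
  conjBy (opTensor 1 (adjoint (fundamentalUnitary μ)))
    (conjBy (assoc (L2 μ ⊗ʰ L2 μ) (L2 μ) (L2 μ))
      (leg13 (L2 μ) (conjBy (opTensor (fundamentalUnitary μ) 1) (leg13 (L2 μ) X))))

/-- Both coproducts are implemented by a unitary operator, so their tensor product is as well. -/
theorem tensorMap_eq_tensorCoproduct {X : L2 μ ⊗ʰ L2 μ →L[ℂ] L2 μ ⊗ʰ L2 μ}
    (hX : X ∈ dualDouble μ) : tensorMap (groupVN μ) (linfVN μ) (groupCoproduct μ)
      (linfCoproduct μ) X = tensorCoproduct X := by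
  set Z := conjBy (opTensor (fundamentalUnitary μ) (1 : L2 μ →L[ℂ] L2 μ)) (leg13 (L2 μ) X) with hZ
  have hsl : ∀ ζ η, slice Z ζ η = conjBy (fundamentalUnitary μ) (opTensor (slice X ζ η) 1) :=
    fun ζ η => by rw [hZ, slice_conjBy_opTensor_one, slice_leg13]
  have h1 : amplify (groupVN μ) (groupCoproduct μ) X = Z :=
    IsAmplification.amplify_eq fun ζ η => ⟨slice_mem hX ζ η, hsl ζ η⟩
  have h2 : ∀ ξ ξ', sliceLeft Z ξ ξ' ∈ linfVN μ :=
    sliceLeft_mem_of_commute fun T hT => ext_slice fun ζ η => by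
      rw [slice_one_mul, slice_mul_one, hsl, hsl, ← slice_one_mul, ← slice_mul_one,
        commute_right_of_mem_vnTensor hX hT]
  rw [tensorMap, h1]
  refine amplifyLeft_eq fun ξ ξ' => ⟨h2 ξ ξ', ?_⟩
  rw [tensorCoproduct, sliceLeft_conjBy_one_opTensor, sliceLeft_conjBy_assoc_leg13]
  rfl

/-- The coproduct of the dual of the quantum double, extended to all operators. -/
def doubleCoproduct (X : L2 μ ⊗ʰ L2 μ →L[ℂ] L2 μ ⊗ʰ L2 μ) :
    (L2 μ ⊗ʰ L2 μ) ⊗ʰ (L2 μ ⊗ʰ L2 μ) →L[ℂ] (L2 μ ⊗ʰ L2 μ) ⊗ʰ (L2 μ ⊗ʰ L2 μ) :=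
  conjBy (twistUnitary μ) (conjBy (midSwap (L2 μ)) (tensorCoproduct X))

theorem dualDoubleCoproduct_eq (x : (dualDouble μ).toStarSubalgebra) :
    dualDoubleCoproduct μ x = doubleCoproduct (x : L2 μ ⊗ʰ L2 μ →L[ℂ] L2 μ ⊗ʰ L2 μ) := by
  rw [dualDoubleCoproduct, tensorMap_eq_tensorCoproduct x.2, doubleCoproduct]

/-- The amplification of the coproduct exists, as it is spatially implemented. -/
theorem exists_sliceLeft_doubleCoproduct
    (X : H ⊗ʰ (L2 μ ⊗ʰ L2 μ) →L[ℂ] H ⊗ʰ (L2 μ ⊗ʰ L2 μ)) :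
    ∃ Y : H ⊗ʰ ((L2 μ ⊗ʰ L2 μ) ⊗ʰ (L2 μ ⊗ʰ L2 μ)) →L[ℂ]
        H ⊗ʰ ((L2 μ ⊗ʰ L2 μ) ⊗ʰ (L2 μ ⊗ʰ L2 μ)),
      ∀ ξ ξ', sliceLeft Y ξ ξ' = doubleCoproduct (sliceLeft X ξ ξ') := by
  obtain ⟨Y₁, h₁⟩ := exists_sliceLeft_leg13 (K := L2 μ) X
  obtain ⟨Y₂, h₂⟩ := exists_sliceLeft_leg13 (K := L2 μ)
    (conjBy (opTensor (1 : H →L[ℂ] H)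
      (opTensor (fundamentalUnitary μ) (1 : L2 μ →L[ℂ] L2 μ))) Y₁)
  refine ⟨conjBy (opTensor (1 : H →L[ℂ] H) (twistUnitary μ))
    (conjBy (opTensor (1 : H →L[ℂ] H) (midSwap (L2 μ)))
    (conjBy (opTensor (1 : H →L[ℂ] H) (opTensor (1 : L2 μ ⊗ʰ L2 μ →L[ℂ] L2 μ ⊗ʰ L2 μ)
      (adjoint (fundamentalUnitary μ))))
      (conjBy (opTensor (1 : H →L[ℂ] H) (assoc (L2 μ ⊗ʰ L2 μ) (L2 μ) (L2 μ))) Y₂))), fun ξ ξ' => ?_⟩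
  simp only [sliceLeft_conjBy_one_opTensor, h₁, h₂]
  rfl

theorem norm_opTensor_one_le (a : H →L[ℂ] H) :
    ‖opTensor a (1 : L2 μ →L[ℂ] L2 μ)‖ ≤ ‖a‖ := by
  have h : IsStrongCont fun _ : G => a := isStrongCont_const a
  rw [← decomposable_const]
  exact h.isBddMeas.norm_decomposable_le fun _ => le_rfl

theorem IsWeakCont.opTensor_one {F : G → (H →L[ℂ] H)} (hF : IsWeakCont F) :
    IsWeakCont fun g => opTensor (F g) (1 : L2 μ →L[ℂ] L2 μ) := by
  obtain ⟨C, hC⟩ := hF.bdd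
  have hC' : ∀ g, ‖opTensor (F g) (1 : L2 μ →L[ℂ] L2 μ)‖ ≤ C := fun g =>
    (norm_opTensor_one_le _).trans (hC g)
  refine ⟨⟨C, hC'⟩, isWeakCont_of_total ((total_univ (E := H)).tmul (total_univ (E := L2 μ)))
    ((total_univ (E := H)).tmul (total_univ (E := L2 μ))) hC' ?_⟩
  rintro _ ⟨x, -, y, -, rfl⟩ _ ⟨x', -, y', -, rfl⟩
  simp only [opTensor_tmul, inner_tmul]
  exact (hF.cont x x').mul continuous_const

theorem IsWeakCont.conjBy {F : G → (H →L[ℂ] H)} (hF : IsWeakCont F) (U : H →L[ℂ] K) :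
    IsWeakCont fun g => conjBy U (F g) where
  bdd := by
    obtain ⟨C, hC⟩ := hF.bdd
    refine ⟨‖U‖ * (C * ‖adjoint U‖), fun g => ?_⟩
    refine (ContinuousLinearMap.opNorm_comp_le _ _).trans ?_
    gcongr
    exact (ContinuousLinearMap.opNorm_comp_le _ _).trans (by gcongr; exact hC g)
  cont x y := by simpa only [inner_conjBy] using hF.cont _ _

theorem IsBddMeas.slice_decomposable_eq {F : G → (H →L[ℂ] H)} (hF : IsBddMeas F) (f k : L2 μ)
    (x y : H) : ⟪x, slice (decomposable μ F) f k y⟫_ℂ =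
      ∫ g, starRingEnd ℂ (f g) * k g * ⟪x, F g y⟫_ℂ ∂μ := by
  rw [inner_slice, hF.isDecomposed]

theorem leg13_decomposable {F : G → (H →L[ℂ] H)} (hF : IsWeakCont F) :
    leg13 (L2 μ) (decomposable μ F) = decomposable μ fun g => opTensor (F g) 1 := by
  refine ext_slice fun f k => clm_ext_inner_tmul fun x y x' y' => ?_
  rw [slice_leg13, opTensor_tmul, inner_tmul, hF.isBddMeas.slice_decomposable_eq,
    hF.opTensor_one.isBddMeas.slice_decomposable_eq, ← integral_mul_const]
  refine integral_congr_ae (.of_forall fun g => ?_)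
  simp only [opTensor_tmul, inner_tmul]
  ring

theorem IsWeakCont.conjBy_opTensor_decomposable {F : G → (H →L[ℂ] H)} (hF : IsWeakCont F)
    (U : H →L[ℂ] K) : DualDouble.conjBy (opTensor U (1 : L2 μ →L[ℂ] L2 μ)) (decomposable μ F) =
      decomposable μ fun g => DualDouble.conjBy U (F g) :=
  ((hF.isBddMeas.isDecomposed.conjBy_opTensor U).eq_decomposable).symm

/-- Conjugation of a decomposable operator by a decomposable unitary operator. -/
theorem IsUnitaryRep.conjBy_decomposable {U : G → (K →L[ℂ] K)} (hU : IsUnitaryRep U)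
    {F : G → (K →L[ℂ] K)} (hF : IsWeakCont F) :
    IsWeakCont (fun g => conjBy (U g) (F g)) ∧
    conjBy (decomposable μ U) (decomposable μ F) = decomposable μ fun g => conjBy (U g) (F g) := by
  obtain ⟨C, hC⟩ := hF.bdd
  have hC0 : 0 ≤ C := (norm_nonneg _).trans (hC 1)
  have hUn : ∀ g, ‖U g‖ ≤ 1 := fun g =>
    ContinuousLinearMap.opNorm_le_bound _ zero_le_one fun ξ => by rw [hU.norm_map, one_mul]
  have hw : IsWeakCont fun g => conjBy (U g) (F g) := by
    refine ⟨⟨C, fun g => ?_⟩, fun x y => ?_⟩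
    · calc ‖conjBy (U g) (F g)‖ ≤ ‖U g‖ * (‖F g‖ * ‖adjoint (U g)‖) :=
            (ContinuousLinearMap.opNorm_comp_le _ _).trans
              (mul_le_mul_of_nonneg_left (ContinuousLinearMap.opNorm_comp_le _ _) (norm_nonneg _))
        _ ≤ 1 * (C * 1) := by
            rw [hU.adjoint_eq]
            gcongr
            · exact hUn g
            · exact hC g
            · exact hUn _
        _ = C := by ring
    · simp only [inner_conjBy]
      have h1 := hU.isStrongCont_adjoint.cont x
      have h2 := hU.isStrongCont_adjoint.cont y
      rw [continuous_iff_continuousAt]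
      intro g₀
      have h3 : Filter.Tendsto (fun g => ‖adjoint (U g) x - adjoint (U g₀) x‖ *
          (C * ‖adjoint (U g) y‖) + ‖adjoint (U g₀) x‖ * (C * ‖adjoint (U g) y -
          adjoint (U g₀) y‖) + ‖⟪adjoint (U g₀) x, F g (adjoint (U g₀) y)⟫_ℂ -
          ⟪adjoint (U g₀) x, F g₀ (adjoint (U g₀) y)⟫_ℂ‖) (nhds g₀) (nhds 0) := by
        have : Continuous fun g => ‖adjoint (U g) x - adjoint (U g₀) x‖ *
          (C * ‖adjoint (U g) y‖) + ‖adjoint (U g₀) x‖ * (C * ‖adjoint (U g) y -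
          adjoint (U g₀) y‖) + ‖⟪adjoint (U g₀) x, F g (adjoint (U g₀) y)⟫_ℂ -
          ⟪adjoint (U g₀) x, F g₀ (adjoint (U g₀) y)⟫_ℂ‖ :=
          (((h1.sub continuous_const).norm.mul (continuous_const.mul h2.norm)).add
            (continuous_const.mul (continuous_const.mul (h2.sub continuous_const).norm))).add
            ((hF.cont _ _).sub continuous_const).norm
        simpa using this.tendsto g₀
      rw [ContinuousAt, tendsto_iff_norm_sub_tendsto_zero]
      refine squeeze_zero (fun _ => norm_nonneg _) (fun g => ?_) h3
      have e : ⟪adjoint (U g) x, F g (adjoint (U g) y)⟫_ℂ -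
          ⟪adjoint (U g₀) x, F g₀ (adjoint (U g₀) y)⟫_ℂ =
          ⟪adjoint (U g) x - adjoint (U g₀) x, F g (adjoint (U g) y)⟫_ℂ +
          ⟪adjoint (U g₀) x, F g (adjoint (U g) y - adjoint (U g₀) y)⟫_ℂ +
          (⟪adjoint (U g₀) x, F g (adjoint (U g₀) y)⟫_ℂ -
          ⟪adjoint (U g₀) x, F g₀ (adjoint (U g₀) y)⟫_ℂ) := by
        rw [inner_sub_left, map_sub, inner_sub_right]; ring
      rw [e]
      refine (norm_add_le _ _).trans (add_le_add ((norm_add_le _ _).trans (add_le_add ?_ ?_))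
        le_rfl)
      · exact (norm_inner_le_norm _ _).trans (by gcongr; exact (F g).le_of_opNorm_le (hC g) _)
      · exact (norm_inner_le_norm _ _).trans (by gcongr; exact (F g).le_of_opNorm_le (hC g) _)
  refine ⟨hw, clm_ext_inner fun v w => ?_⟩
  have h1 : adjoint (decomposable μ U) = decomposable μ fun g => adjoint (U g) :=
    hU.isStrongCont.isBddMeas.star_decomposable
  rw [inner_conjBy, h1, hF.isBddMeas.inner_decomposable, hw.isBddMeas.inner_decomposable]
  refine integral_congr_ae ?_
  filter_upwards [hU.isStrongCont_adjoint.coeFn_decomposable v,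
    hU.isStrongCont_adjoint.coeFn_decomposable w] with g h2 h3
  rw [h2, h3, inner_conjBy]

theorem IsUnitaryRep.opTensor_one {U : G → (K →L[ℂ] K)} (hU : IsUnitaryRep U) :
    IsUnitaryRep fun g => opTensor (U g) (1 : K' →L[ℂ] K') := by
  have hn : ∀ g (ξ : K ⊗ʰ K'), ‖opTensor (U g) (1 : K' →L[ℂ] K') ξ‖ = ‖ξ‖ := fun g => by
    refine (ContinuousLinearMap.norm_map_iff_adjoint_comp_self _).2 ?_
    have h1 : adjoint (1 : K' →L[ℂ] K') = 1 := star_one _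
    rw [adjoint_opTensor, h1]
    have := opTensor_mul (adjoint (U g)) (U g) (1 : K' →L[ℂ] K') 1
    rw [hU.adjoint_mul_self, one_mul, DualDouble.opTensor_one] at this
    exact this
  refine ⟨by rw [hU.map_one, DualDouble.opTensor_one],
    fun g h => by rw [hU.map_mul, opTensor_mul, one_mul], hn,
    continuous_of_total hn ((total_univ (E := K)).tmul (total_univ (E := K')))
      ((total_univ (E := K)).tmul (total_univ (E := K'))) ?_⟩
  rintro _ ⟨x, -, y, -, rfl⟩ _ ⟨x', -, y', -, rfl⟩
  simp only [opTensor_tmul, inner_tmul]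
  exact (continuous_const.inner (hU.cont x')).mul continuous_const

end

section

variable {G : Type*} [Group G] [TopologicalSpace G] [IsTopologicalGroup G] [LocallyCompactSpace G]
  [MeasurableSpace G] [BorelSpace G] {μ : Measure G} [μ.IsHaarMeasure] [μ.Regular]
  {H K : Type*} [NormedAddCommGroup H] [InnerProductSpace ℂ H] [CompleteSpace H]
  [NormedAddCommGroup K] [InnerProductSpace ℂ K] [CompleteSpace K]

theorem conjBy_conjBy_conjBy {V : H →L[ℂ] K} (hV : adjoint V ∘L V = .id ℂ H) (U X : H →L[ℂ] H) :
    conjBy (conjBy V U) (conjBy V X) = conjBy V (conjBy U X) := by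
  rw [conjBy_eq_mul (conjBy V U), ← ContinuousLinearMap.star_eq_adjoint, star_conjBy,
    ← conjBy_mul hV, ← conjBy_mul hV]
  rfl

theorem adjoint_midSwap : adjoint (midSwap K) = midSwap K :=
  clm_ext_inner fun v w => by rw [adjoint_inner_right, inner_midSwap]

/-- The coefficients of `Γ(c)`, for a continuous function `c`, at continuous functions of compact
support: `Γ(c)` is multiplication by `(s, t) ↦ c(s t)`. -/
theorem inner_conjBy_adjoint_fundamentalUnitary {C : L2 μ →L[ℂ] L2 μ} {c : G → ℂ}
    (hc : Continuous c) (hC : ∀ f k : L2 μ, ⟪f, C k⟫_ℂ = ∫ g, starRingEnd ℂ (f g) * k g * c g ∂μ)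
    {f₁ f₂ : L2 μ} (hf₁ : IsCc μ f₁) (hf₂ : IsCc μ f₂) {k₁ k₂ : L2 μ} (hk₁ : IsCc μ k₁)
    (hk₂ : IsCc μ k₂) :
    ⟪(tmul f₁ f₂ : L2 μ ⊗ʰ L2 μ), conjBy (adjoint (fundamentalUnitary μ)) (opTensor 1 C)
      (tmul k₁ k₂)⟫_ℂ = ∫ t, starRingEnd ℂ (f₂ t) * k₂ t *
        ∫ s, starRingEnd ℂ (f₁ s) * k₁ s * c (s * t) ∂μ ∂μ := by
  have hW : ∀ f k : L2 μ, fundamentalUnitary μ (tmul f k) =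
      flip (L2 μ) (L2 μ) (decomposable μ (leftReg μ) (tmul k f)) := fun f k => by
    rw [fundamentalUnitary, conjBy, ContinuousLinearMap.comp_apply,
      ContinuousLinearMap.comp_apply, adjoint_flip, flip_tmul]
  have hS := (isUnitaryRep_leftReg (μ := μ)).isStrongCont
  have hflip : ∀ a b : L2 μ ⊗ʰ L2 μ, ⟪flip (L2 μ) (L2 μ) a, opTensor 1 C (flip (L2 μ) (L2 μ) b)⟫_ℂ =
      ⟪a, opTensor C (1 : L2 μ →L[ℂ] L2 μ) b⟫_ℂ := fun a b => by
    rw [← conjBy_flip_opTensor (1 : L2 μ →L[ℂ] L2 μ) C, inner_conjBy, adjoint_flip]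
  rw [inner_conjBy, ContinuousLinearMap.adjoint_adjoint, hW, hW, hflip,
    ← decomposable_const (μ := μ),
    (isStrongCont_const (G := G) C).isBddMeas.inner_decomposable]
  -- In `L²(G, L²(G))` the operator `W` acts by translations; the substitution `t ↦ s t` gives the
  -- integrals in the opposite order, and compact supports allow to interchange them.
  have h1 : ∫ s, ⟪toL2 μ (decomposable μ (leftReg μ) (tmul f₂ f₁)) s,
      C (toL2 μ (decomposable μ (leftReg μ) (tmul k₂ k₁)) s)⟫_ℂ ∂μ =
      ∫ s, starRingEnd ℂ (f₁ s) * k₁ s *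
        ∫ t, starRingEnd ℂ (f₂ t) * k₂ t * c (s * t) ∂μ ∂μ := by
    refine integral_congr_ae ?_
    filter_upwards [hS.coeFn_decomposable (tmul f₂ f₁), hS.coeFn_decomposable (tmul k₂ k₁),
      coeFn_toL2_tmul μ f₂ f₁, coeFn_toL2_tmul μ k₂ k₁] with s h1 h2 h3 h4
    rw [h1, h2, h3, h4, map_smul, map_smul, map_smul, inner_smul_left, inner_smul_right, hC,
      mul_assoc, ← integral_mul_left_eq_self (μ := μ) (fun t => starRingEnd ℂ (leftReg μ s f₂ t) *
        leftReg μ s k₂ t * c t) s]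
    congr 2
    refine integral_congr_ae ?_
    filter_upwards [(quasiMeasurePreserving_mul_left' s).ae_eq_comp (coeFn_leftReg s f₂),
      (quasiMeasurePreserving_mul_left' s).ae_eq_comp (coeFn_leftReg s k₂)] with t h5 h6
    simp only [Function.comp_apply, inv_mul_cancel_left] at h5 h6
    rw [h5, h6]
  rw [h1]
  obtain ⟨f₁', hf₁c, hf₁s, hf₁e⟩ := hf₁
  obtain ⟨f₂', hf₂c, hf₂s, hf₂e⟩ := hf₂
  obtain ⟨k₁', hk₁c, -, hk₁e⟩ := hk₁
  obtain ⟨k₂', hk₂c, -, hk₂e⟩ := hk₂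
  have e1 : ∫ s, starRingEnd ℂ (f₁ s) * k₁ s *
        ∫ t, starRingEnd ℂ (f₂ t) * k₂ t * c (s * t) ∂μ ∂μ =
      ∫ s, ∫ t, starRingEnd ℂ (f₁' s) * k₁' s *
        (starRingEnd ℂ (f₂' t) * k₂' t * c (s * t)) ∂μ ∂μ := by
    refine integral_congr_ae ?_
    filter_upwards [hf₁e, hk₁e] with s h1 h2
    rw [h1, h2, integral_const_mul]
    congr 1
    refine integral_congr_ae ?_
    filter_upwards [hf₂e, hk₂e] with t h1 h2
    rw [h1, h2]
  have e2 : ∫ t, starRingEnd ℂ (f₂ t) * k₂ t *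
        ∫ s, starRingEnd ℂ (f₁ s) * k₁ s * c (s * t) ∂μ ∂μ =
      ∫ t, ∫ s, starRingEnd ℂ (f₁' s) * k₁' s *
        (starRingEnd ℂ (f₂' t) * k₂' t * c (s * t)) ∂μ ∂μ := by
    refine integral_congr_ae ?_
    filter_upwards [hf₂e, hk₂e] with t h1 h2
    rw [h1, h2, ← integral_const_mul]
    refine integral_congr_ae ?_
    filter_upwards [hf₁e, hk₁e] with s h1 h2
    rw [h1, h2]
    ring
  rw [e1, e2]
  refine integral_integral_swap_of_hasCompactSupport ?_ ?_
  · have h1 : Continuous fun p : G × G => starRingEnd ℂ (f₁' p.1) * k₁' p.1 :=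
      ((Complex.continuous_conj.comp (hf₁c.comp continuous_fst)).mul (hk₁c.comp continuous_fst))
    have h2 : Continuous fun p : G × G => starRingEnd ℂ (f₂' p.2) * k₂' p.2 :=
      ((Complex.continuous_conj.comp (hf₂c.comp continuous_snd)).mul (hk₂c.comp continuous_snd))
    exact h1.mul (h2.mul (hc.comp (continuous_fst.mul continuous_snd)))
  · refine HasCompactSupport.intro' (hf₁s.isCompact.prod hf₂s.isCompact)
      ((isClosed_tsupport _).prod (isClosed_tsupport _)) ?_
    rintro ⟨s, t⟩ hst
    simp only [Function.uncurry_apply_pair]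
    by_cases hs : s ∈ tsupport f₁'
    · have ht : t ∉ tsupport f₂' := fun ht => hst ⟨hs, ht⟩
      rw [image_eq_zero_of_notMem_tsupport ht]
      simp
    · rw [image_eq_zero_of_notMem_tsupport hs]
      simp

/-- The decomposable operator given by `s ↦ F(s t)`, with the variable `s` in the middle leg. -/
def translateLeg (μ : Measure G) [μ.IsHaarMeasure] [μ.Regular]
    (F : G → (L2 μ ⊗ʰ L2 μ →L[ℂ] L2 μ ⊗ʰ L2 μ)) (t : G) :
    (L2 μ ⊗ʰ L2 μ) ⊗ʰ L2 μ →L[ℂ] (L2 μ ⊗ʰ L2 μ) ⊗ʰ L2 μ :=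
  conjBy (swapRight (L2 μ) (L2 μ) (L2 μ)) (decomposable μ fun s => F (s * t))

theorem IsWeakCont.translate {F : G → (H →L[ℂ] H)} (hF : IsWeakCont F) (t : G) :
    IsWeakCont fun s => F (s * t) where
  bdd := hF.bdd.imp fun _ h _ => h _
  cont x y := (hF.cont x y).comp (continuous_mul_const t)

theorem inner_translateLeg {F : G → (L2 μ ⊗ʰ L2 μ →L[ℂ] L2 μ ⊗ʰ L2 μ)} (hF : IsWeakCont F) (t : G)
    (a b a' b' f k : L2 μ) : ⟪(tmul (tmul a f) b : (L2 μ ⊗ʰ L2 μ) ⊗ʰ L2 μ),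
      translateLeg μ F t (tmul (tmul a' k) b')⟫_ℂ =
      ∫ s, starRingEnd ℂ (f s) * k s * ⟪tmul a b, F (s * t) (tmul a' b')⟫_ℂ ∂μ := by
  rw [translateLeg, inner_conjBy, adjoint_swapRight, swapRight_tmul, swapRight_tmul,
    (hF.translate t).isBddMeas.isDecomposed]

theorem isWeakCont_translateLeg {F : G → (L2 μ ⊗ʰ L2 μ →L[ℂ] L2 μ ⊗ʰ L2 μ)} (hF : IsWeakCont F) :
    IsWeakCont (translateLeg μ F) := by
  obtain ⟨C, hC⟩ := hF.bdd
  have hC0 : 0 ≤ C := (norm_nonneg _).trans (hC 1)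
  have hC' : ∀ t, ‖translateLeg μ F t‖ ≤ ‖swapRight (L2 μ) (L2 μ) (L2 μ)‖ *
      (C * ‖adjoint (swapRight (L2 μ) (L2 μ) (L2 μ))‖) := fun t => by
    refine (ContinuousLinearMap.opNorm_comp_le _ _).trans ?_
    gcongr
    refine (ContinuousLinearMap.opNorm_comp_le _ _).trans ?_
    gcongr
    exact (hF.translate t).isBddMeas.norm_decomposable_le fun s => hC _
  have hT := ((total_univ (E := L2 μ)).tmul (total_isCc (μ := μ))).tmul (total_univ (E := L2 μ))
  refine ⟨⟨_, hC'⟩, isWeakCont_of_total hT hT hC' ?_⟩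
  rintro _ ⟨_, ⟨a, -, f, ⟨f', hf1, hf2, hf3⟩, rfl⟩, b, -, rfl⟩
    _ ⟨_, ⟨a', -, k, ⟨k', hk1, hk2, hk3⟩, rfl⟩, b', -, rfl⟩
  simp only [inner_translateLeg hF]
  have e : ∀ t, ∫ s, starRingEnd ℂ (f s) * k s * ⟪tmul a b, F (s * t) (tmul a' b')⟫_ℂ ∂μ =
      ∫ s, (starRingEnd ℂ (f' s) * k' s) * ⟪tmul a b, F (s * t) (tmul a' b')⟫_ℂ ∂μ := fun t => by
    refine integral_congr_ae ?_
    filter_upwards [hf3, hk3] with s h1 h2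
    rw [h1, h2]
  simp only [e]
  refine continuous_integral_of_hasCompactSupport ((Complex.continuous_conj.comp hf1).mul hk1)
    hk2.mul_left ?_
  exact (hF.cont _ _).comp (continuous_snd.mul continuous_fst)

/-- After the exchange of the middle legs, `(Γ̂ ⊗ Γ)(n)` is given by the function
`(s, t) ↦ Γ̂(n(s t))`. -/
theorem conjBy_midSwap_tensorCoproduct {n : G → (L2 μ →L[ℂ] L2 μ)} (hn : IsWeakCont n) :
    conjBy (midSwap (L2 μ)) (tensorCoproduct (decomposable μ n)) =
      conjBy (assoc (L2 μ ⊗ʰ L2 μ) (L2 μ) (L2 μ)) (decomposable μ (translateLeg μ fun g =>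
        conjBy (fundamentalUnitary μ) (opTensor (n g) 1))) := by
  have hN := hn.opTensor_one.conjBy (fundamentalUnitary μ)
  have hT := ((total_univ (E := L2 μ)).tmul (total_isCc (μ := μ))).tmul
    ((total_univ (E := L2 μ)).tmul (total_isCc (μ := μ)))
  refine hT.clm_ext hT ?_
  rintro _ ⟨_, ⟨a, -, f₁, hf₁, rfl⟩, _, ⟨b, -, f₂, hf₂, rfl⟩, rfl⟩
    _ ⟨_, ⟨a', -, k₁, hk₁, rfl⟩, _, ⟨b', -, k₂, hk₂, rfl⟩, rfl⟩
  rw [inner_conjBy, inner_conjBy, adjoint_midSwap, midSwap_tmul, midSwap_tmul, adjoint_assoc_tmul,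
    adjoint_assoc_tmul, (isWeakCont_translateLeg hN).isBddMeas.isDecomposed, ← inner_sliceLeft,
    tensorCoproduct, sliceLeft_conjBy_one_opTensor, sliceLeft_conjBy_assoc_leg13,
    leg13_decomposable hn, hn.opTensor_one.conjBy_opTensor_decomposable]
  simp only [inner_translateLeg hN]
  refine inner_conjBy_adjoint_fundamentalUnitary (hN.cont (tmul a b) (tmul a' b')) ?_ hf₁ hf₂
    hk₁ hk₂
  intro f k
  rw [inner_sliceLeft, hN.isBddMeas.isDecomposed]

/-- On the range of `Γ̂`, conjugation by `u_t ⊗ 1` is the same as by `λ(t) ⊗ 1`. -/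
theorem inner_adjoint_adjReg {n : L2 μ →L[ℂ] L2 μ} (hn : n ∈ groupVN μ) (t : G)
    (p q p' q' : L2 μ) :
    ⟪tmul (adjoint (adjReg μ t) p) q, conjBy (fundamentalUnitary μ) (opTensor n 1)
      (tmul (adjoint (adjReg μ t) p') q')⟫_ℂ =
    ⟪tmul (adjoint (leftReg μ t) p) q, conjBy (fundamentalUnitary μ) (opTensor n 1)
      (tmul (adjoint (leftReg μ t) p') q')⟫_ℂ := by
  have h1 : adjoint (1 : L2 μ →L[ℂ] L2 μ) = 1 := star_one _
  have e : ∀ p q : L2 μ, (tmul (adjoint (adjReg μ t) p) q : L2 μ ⊗ʰ L2 μ) =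
      adjoint (opTensor (rightReg μ t) (1 : L2 μ →L[ℂ] L2 μ)) (tmul (adjoint (leftReg μ t) p) q) :=
    fun p q => by
    rw [adjoint_opTensor, opTensor_tmul, h1, one_apply_eq_self, adjReg,
      ContinuousLinearMap.adjoint_comp, ContinuousLinearMap.comp_apply]
  rw [e, e, adjoint_inner_left, ← mul_apply_eq_comp, ← mul_apply_eq_comp,
    groupCoproduct_commute_rightReg hn, mul_assoc, adjoint_opTensor, opTensor_mul,
    isUnitaryRep_rightReg.self_mul_adjoint, h1, one_mul, opTensor_one, mul_one]

/-- The coefficients of the coproduct of the dual of the quantum double at an element of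
`𝓛(G) ⊗ L^∞(G)` that is given by a continuous function. -/
theorem inner_doubleCoproduct {n : G → (L2 μ →L[ℂ] L2 μ)} (hn : IsWeakCont n)
    (hnG : ∀ g, n g ∈ groupVN μ) (p₁ p₂ p₁' p₂' f₁ f₂ k₁ k₂ : L2 μ) :
    ⟪(tmul (tmul p₁ f₁) (tmul p₂ f₂) : (L2 μ ⊗ʰ L2 μ) ⊗ʰ (L2 μ ⊗ʰ L2 μ)),
      doubleCoproduct (decomposable μ n) (tmul (tmul p₁' k₁) (tmul p₂' k₂))⟫_ℂ =
      ∫ t, starRingEnd ℂ (f₂ t) * k₂ t * ∫ s, starRingEnd ℂ (f₁ s) * k₁ s *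
        ⟪tmul (adjoint (leftReg μ t) p₁) p₂,
          conjBy (fundamentalUnitary μ) (opTensor (n (s * t)) 1)
            (tmul (adjoint (leftReg μ t) p₁') p₂')⟫_ℂ ∂μ ∂μ := by
  have hN := hn.opTensor_one.conjBy (fundamentalUnitary μ)
  have h1 : adjoint (1 : L2 μ →L[ℂ] L2 μ) = 1 := star_one _
  have hU : IsUnitaryRep fun h => opTensor (opTensor (adjReg μ h) (1 : L2 μ →L[ℂ] L2 μ))
      (1 : L2 μ →L[ℂ] L2 μ) := isUnitaryRep_adjReg.opTensor_one.opTensor_one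
  obtain ⟨hw, he⟩ := hU.conjBy_decomposable (μ := μ) (isWeakCont_translateLeg hN)
  have ht : twistUnitary μ = conjBy (assoc (L2 μ ⊗ʰ L2 μ) (L2 μ) (L2 μ)) (decomposable μ fun h =>
      opTensor (opTensor (adjReg μ h) (1 : L2 μ →L[ℂ] L2 μ)) (1 : L2 μ →L[ℂ] L2 μ)) := rfl
  rw [doubleCoproduct, conjBy_midSwap_tensorCoproduct hn, ht,
    conjBy_conjBy_conjBy adjoint_assoc_comp_assoc, he, inner_conjBy, adjoint_assoc_tmul,
    adjoint_assoc_tmul, hw.isBddMeas.isDecomposed]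
  refine integral_congr_ae (.of_forall fun t => ?_)
  beta_reduce
  congr 1
  rw [inner_conjBy, adjoint_opTensor, adjoint_opTensor, opTensor_tmul, opTensor_tmul,
    opTensor_tmul, opTensor_tmul, h1, one_apply_eq_self, one_apply_eq_self, one_apply_eq_self,
    one_apply_eq_self, inner_translateLeg hN]
  refine integral_congr_ae (.of_forall fun s => ?_)
  beta_reduce
  rw [inner_adjoint_adjReg (hnG _)]

end

/-! ### The family of homomorphisms behind `Δ` -/

section

variable {G : Type*} [Group G] [TopologicalSpace G] [IsTopologicalGroup G] [LocallyCompactSpace G]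
  [MeasurableSpace G] [BorelSpace G] {μ : Measure G} [μ.IsHaarMeasure] [μ.Regular]
  {H K H' K' : Type*} [NormedAddCommGroup H] [InnerProductSpace ℂ H] [CompleteSpace H]
  [NormedAddCommGroup K] [InnerProductSpace ℂ K] [CompleteSpace K]
  [NormedAddCommGroup H'] [InnerProductSpace ℂ H'] [CompleteSpace H']
  [NormedAddCommGroup K'] [InnerProductSpace ℂ K'] [CompleteSpace K']
  {A : VonNeumannAlgebra H}

theorem adjoint_one_eq : adjoint (1 : H →L[ℂ] H) = 1 := star_one _

/-- Conjugation by a unitary operator as a *-homomorphism. -/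
def conjHom (U : H →L[ℂ] K) (h : adjoint U ∘L U = .id ℂ H) (h' : U ∘L adjoint U = .id ℂ K) :
    (H →L[ℂ] H) →⋆ₐ[ℂ] (K →L[ℂ] K) where
  toFun := conjBy U
  map_one' := conjBy_one h'
  map_mul' := conjBy_mul h
  map_zero' := by ext; simp [conjBy]
  map_add' := conjBy_add U
  commutes' c := by
    rw [Algebra.algebraMap_eq_smul_one, Algebra.algebraMap_eq_smul_one, conjBy_smul, conjBy_one h']
  map_star' X := (star_conjBy U X).symm

theorem conjBy_zero (U : H →L[ℂ] K) : conjBy U 0 = 0 := by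
  ext; simp [conjBy]

theorem conjBy_injective {U : H →L[ℂ] K} (h : adjoint U ∘L U = .id ℂ H) :
    Function.Injective (conjBy U) := fun X Y hXY => by
  have h1 : ∀ X, conjBy (adjoint U) (conjBy U X) = X := fun X => by
    rw [conjBy_conjBy, h, conjBy_id]
  rw [← h1 X, hXY, h1]

theorem slice_conjBy_one_opTensor (U : K →L[ℂ] K') (X : H ⊗ʰ K →L[ℂ] H ⊗ʰ K) (ζ η : K') :
    slice (conjBy (opTensor (1 : H →L[ℂ] H) U) X) ζ η = slice X (adjoint U ζ) (adjoint U η) :=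
  clm_ext_inner fun x y => by
    rw [inner_slice, inner_conjBy, inner_slice, adjoint_opTensor, opTensor_tmul,
      opTensor_tmul, adjoint_one_eq, one_apply_eq_self, one_apply_eq_self]

theorem IsUnitaryRep.one_opTensor {U : G → (K →L[ℂ] K)} (hU : IsUnitaryRep U) :
    IsUnitaryRep fun g => opTensor (1 : H →L[ℂ] H) (U g) := by
  have hn : ∀ g (ξ : H ⊗ʰ K), ‖opTensor (1 : H →L[ℂ] H) (U g) ξ‖ = ‖ξ‖ := fun g => by
    refine (ContinuousLinearMap.norm_map_iff_adjoint_comp_self _).2 ?_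
    rw [adjoint_opTensor, adjoint_one_eq]
    have := opTensor_mul (1 : H →L[ℂ] H) 1 (adjoint (U g)) (U g)
    rw [hU.adjoint_mul_self, one_mul, DualDouble.opTensor_one] at this
    exact this
  refine ⟨by rw [hU.map_one, DualDouble.opTensor_one],
    fun g h => by rw [hU.map_mul, opTensor_mul, one_mul], hn,
    continuous_of_total hn ((total_univ (E := H)).tmul (total_univ (E := K)))
      ((total_univ (E := H)).tmul (total_univ (E := K))) ?_⟩
  rintro _ ⟨x, -, y, -, rfl⟩ _ ⟨x', -, y', -, rfl⟩
  simp only [opTensor_tmul, inner_tmul]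
  exact continuous_const.mul (continuous_const.inner (hU.cont y'))

section Junk

theorem slice_zero (ζ η : K) : slice (0 : H ⊗ʰ K →L[ℂ] H ⊗ʰ K) ζ η = 0 := by
  ext; simp [slice]

theorem isAmplification_zero {M : VonNeumannAlgebra H}
    {φ : M.toStarSubalgebra → (H' →L[ℂ] H')} (h0 : φ 0 = 0) :
    IsAmplification (K := K) M φ 0 0 := fun ζ η => by
  have h1 : slice (0 : H ⊗ʰ K →L[ℂ] H ⊗ʰ K) ζ η ∈ M.toStarSubalgebra := by
    rw [slice_zero]; exact zero_mem _
  refine ⟨h1, ?_⟩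
  have h2 : (⟨slice (0 : H ⊗ʰ K →L[ℂ] H ⊗ʰ K) ζ η, h1⟩ : M.toStarSubalgebra) = 0 :=
    Subtype.ext (slice_zero ζ η)
  rw [h2, h0, slice_zero]

theorem tensorMap_zero {M : VonNeumannAlgebra H} {N : VonNeumannAlgebra K}
    {φ : M.toStarSubalgebra → (H' →L[ℂ] H')} {ψ : N.toStarSubalgebra → (K' →L[ℂ] K')}
    (hφ : φ 0 = 0) (hψ : ψ 0 = 0) : tensorMap M N φ ψ 0 = 0 := by
  rw [tensorMap, (isAmplification_zero hφ).amplify_eq, amplifyLeft, conjBy_zero,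
    (isAmplification_zero hψ).amplify_eq, conjBy_zero]

/-- A nonzero value of `amplify` is an amplification. -/
theorem isAmplification_of_ne_zero {M : VonNeumannAlgebra H}
    {φ : M.toStarSubalgebra → (H' →L[ℂ] H')} {X : H ⊗ʰ K →L[ℂ] H ⊗ʰ K}
    (h : amplify M φ X ≠ 0) : IsAmplification M φ X (amplify M φ X) := by
  by_cases hex : ∃ Y, IsAmplification M φ X Y
  · rw [amplify, dif_pos hex]
    exact hex.choose_spec
  · rw [amplify, dif_neg hex] at h
    exact absurd rfl h

end Junk

section Twist

variable (φ : A.toStarSubalgebra →⋆ₐ[ℂ] (H ⊗ʰ L2 μ →L[ℂ] H ⊗ʰ L2 μ))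
  (α : G →* (A.toStarSubalgebra ≃⋆ₐ[ℂ] A.toStarSubalgebra))

theorem one_opTensor_leftReg_unitary (g : G) :
    adjoint (opTensor (1 : H →L[ℂ] H) (leftReg μ g⁻¹)) ∘L opTensor (1 : H →L[ℂ] H) (leftReg μ g⁻¹) =
      .id ℂ _ :=
  (isUnitaryRep_leftReg (μ := μ)).one_opTensor.adjoint_mul_self g⁻¹

theorem one_opTensor_leftReg_unitary' (g : G) :
    opTensor (1 : H →L[ℂ] H) (leftReg μ g⁻¹) ∘L adjoint (opTensor (1 : H →L[ℂ] H) (leftReg μ g⁻¹)) =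
      .id ℂ _ :=
  (isUnitaryRep_leftReg (μ := μ)).one_opTensor.self_mul_adjoint g⁻¹

/-- The *-homomorphism `β_g(x) = (1 ⊗ λ(g)*) δ(α_g(x)) (1 ⊗ λ(g))`, which by covariance is equal to
`(α_g ⊗ id) ∘ δ`. -/
def twist (g : G) : A.toStarSubalgebra →⋆ₐ[ℂ] (H ⊗ʰ L2 μ →L[ℂ] H ⊗ʰ L2 μ) :=
  (conjHom (opTensor (1 : H →L[ℂ] H) (leftReg μ g⁻¹)) (one_opTensor_leftReg_unitary g)
    (one_opTensor_leftReg_unitary' g)).comp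
    (φ.comp ((α g : A.toStarSubalgebra ≃⋆ₐ[ℂ] A.toStarSubalgebra) :
      A.toStarSubalgebra →⋆ₐ[ℂ] A.toStarSubalgebra))

theorem twist_apply (g : G) (x : A.toStarSubalgebra) :
    twist φ α g x = conjBy (opTensor (1 : H →L[ℂ] H) (leftReg μ g⁻¹)) (φ (α g x)) := rfl

theorem twist_one (x : A.toStarSubalgebra) : twist φ α 1 x = φ x := by
  rw [twist_apply, inv_one, isUnitaryRep_leftReg.map_one, opTensor_one, map_one]
  exact conjBy_id _

variable {φ α}

theorem twist_comp (s t : G) (x : A.toStarSubalgebra) :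
    twist φ α s (α t x) = conjBy (opTensor (1 : H →L[ℂ] H) (leftReg μ t)) (twist φ α (s * t) x) := by
  rw [twist_apply, twist_apply, conjBy_conjBy]
  have h1 : opTensor (1 : H →L[ℂ] H) (leftReg μ t) ∘L opTensor (1 : H →L[ℂ] H)
      (leftReg μ (s * t)⁻¹) = opTensor (1 : H →L[ℂ] H) (leftReg μ s⁻¹) := by
    have := opTensor_mul (1 : H →L[ℂ] H) 1 (leftReg μ t) (leftReg μ (s * t)⁻¹)
    rw [← isUnitaryRep_leftReg.map_mul, mul_inv_rev, mul_inv_cancel_left, one_mul] at this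
    exact (by rw [mul_inv_rev]; exact this)
  rw [h1, map_mul]
  rfl

theorem isNormal_twist (hφ : IsNormal A φ) (g : G) : IsNormal A (twist φ α g) :=
  (hφ.comp (α g)).conjBy _

theorem isStrongCont_action (hα : IsContinuousAction A α) (x : A.toStarSubalgebra) :
    IsStrongCont fun g => (α g x : H →L[ℂ] H) :=
  isStrongCont_of_starAlgHom (β := fun g => A.toStarSubalgebra.subtype.comp
    ((α g : A.toStarSubalgebra ≃⋆ₐ[ℂ] A.toStarSubalgebra) :
      A.toStarSubalgebra →⋆ₐ[ℂ] A.toStarSubalgebra)) hα x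

theorem continuous_twist (hφ : IsNormal A φ) (hα : IsContinuousAction A α)
    (x : A.toStarSubalgebra) (v w : H ⊗ʰ L2 μ) : Continuous fun g => ⟪v, twist φ α g x w⟫_ℂ := by
  have h1 := hφ.isStrongCont (isStrongCont_action hα x)
  have h2 := (isUnitaryRep_leftReg (μ := μ)).one_opTensor (H := H)
  simp only [twist_apply, inner_conjBy, h2.adjoint_eq, inv_inv]
  exact (h2.cont v).inner (h1.continuous_comp continuous_id (h2.cont w))

theorem twist_mem (hm : ∀ x, φ x ∈ vnTensor A (groupVN μ)) (g : G) (x : A.toStarSubalgebra) :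
    twist φ α g x ∈ vnTensor A (groupVN μ) := by
  have h : opTensor (1 : H →L[ℂ] H) (leftReg μ g⁻¹) ∈ vnTensor A (groupVN μ) :=
    opTensor_mem (one_mem A) (leftReg_mem_groupVN _)
  rw [twist_apply, conjBy_eq_mul]
  exact mul_mem (mul_mem h (hm _)) (star_mem h)

/-- This settles the case in which `amplify` may take its default value. -/
theorem eq_zero_of_covariant (hcov : IsCovariant μ A α φ) {g : G} {x : A.toStarSubalgebra}
    (h : φ (α g x) = 0) : φ x = 0 := by
  have h1 := hcov g⁻¹ (α g x)
  have h2 : α g⁻¹ (α g x) = x := by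
    have : (α g⁻¹ * α g) x = x := by rw [← map_mul, inv_mul_cancel, map_one]; rfl
    exact this
  rw [h2, h, tensorMap_zero] at h1
  · exact h1
  · simp
  · exact conjBy_zero _

/-- The covariance condition: the slices of `β_g(x)` are those of `(α_g ⊗ id)(δ(x))`. -/
theorem slice_twist (hm : ∀ x, φ x ∈ vnTensor A (groupVN μ)) (hcov : IsCovariant μ A α φ) (g : G)
    (x : A.toStarSubalgebra) (ζ η : L2 μ) :
    slice (twist φ α g x) ζ η = α g ⟨slice (φ x) ζ η, slice_mem (hm x) ζ η⟩ := by
  -- If `φ (α g x) ≠ 0`, neither amplification in the covariance condition is the default value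
  -- `0`, and so both satisfy their slice equations.
  by_cases h0 : φ (α g x) = 0
  · have h1 := eq_zero_of_covariant hcov h0
    have h2 : (⟨slice (φ x) ζ η, slice_mem (hm x) ζ η⟩ : A.toStarSubalgebra) = 0 :=
      Subtype.ext (by change slice (φ x) ζ η = 0; rw [h1]; exact slice_zero ζ η)
    rw [h2, map_zero, twist_apply, h0, conjBy_zero, slice_zero]
    rfl
  · have hc := hcov g x
    set Y := amplify A (fun a => (α g a : H →L[ℂ] H)) (φ x) with hY
    set ψ : (groupVN μ).toStarSubalgebra → (L2 μ →L[ℂ] L2 μ) :=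
      fun y => conjBy (leftReg μ g) (y : L2 μ →L[ℂ] L2 μ) with hψ
    have hψ0 : ψ 0 = 0 := conjBy_zero _
    have hc' : φ (α g x) = conjBy (flip (L2 μ) H) (amplify (groupVN μ) ψ
      (conjBy (flip H (L2 μ)) Y)) := hc
    have hZ : amplify (groupVN μ) ψ (conjBy (flip H (L2 μ)) Y) ≠ 0 := fun h => by
      rw [h, conjBy_zero] at hc'; exact h0 hc'
    have hY0 : Y ≠ 0 := fun h => by
      rw [h, conjBy_zero, (isAmplification_zero hψ0).amplify_eq] at hZ
      exact hZ rfl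
    have hYa := isAmplification_of_ne_zero hY0
    have hZa := isAmplification_of_ne_zero hZ
    have hZe : amplify (groupVN μ) ψ (conjBy (flip H (L2 μ)) Y) =
        conjBy (opTensor (leftReg μ g) (1 : H →L[ℂ] H)) (conjBy (flip H (L2 μ)) Y) := by
      refine ext_slice fun ζ η => ?_
      obtain ⟨_, h1⟩ := hZa ζ η
      rw [h1, slice_conjBy_opTensor_one]
    have hφY : φ (α g x) = conjBy (opTensor (1 : H →L[ℂ] H) (leftReg μ g)) Y := by
      rw [hc', hZe]
      refine ext_sliceLeft fun ξ ξ' => ?_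
      rw [slice_conjBy_flip, slice_conjBy_opTensor_one, sliceLeft_conjBy_one_opTensor]
      rfl
    have hYt : twist φ α g x = Y := by
      rw [twist_apply, hφY, conjBy_conjBy]
      have h1 : opTensor (1 : H →L[ℂ] H) (leftReg μ g⁻¹) ∘L opTensor (1 : H →L[ℂ] H) (leftReg μ g) =
          .id ℂ _ := by
        have := opTensor_mul (1 : H →L[ℂ] H) 1 (leftReg μ g⁻¹) (leftReg μ g)
        rw [← isUnitaryRep_leftReg.map_mul, inv_mul_cancel, isUnitaryRep_leftReg.map_one, one_mul,
          opTensor_one] at this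
        exact this
      rw [h1, conjBy_id]
    rw [hYt]
    obtain ⟨_, h1⟩ := hYa ζ η
    exact h1

theorem eq_zero_of_opTensor_one {s : K →L[ℂ] K} (h : opTensor s (1 : K →L[ℂ] K) = 0) : s = 0 :=
  clm_ext_inner fun p q => by
    by_cases hq : q = 0
    · simp [hq]
    · have h1 : ⟪(tmul p q : K ⊗ʰ K), opTensor s (1 : K →L[ℂ] K) (tmul q q)⟫_ℂ = 0 := by
        rw [h]; simp
      rw [opTensor_tmul, inner_tmul, one_apply_eq_self, mul_eq_zero] at h1
      simpa using h1.resolve_right (inner_self_ne_zero.2 hq)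

/-- The coassociativity of `δ` in terms of matrix coefficients. -/
theorem inner_coaction (hδ : IsCoaction A (groupVN μ) (groupCoproduct μ) φ)
    (x y : A.toStarSubalgebra) {p p' : L2 μ} (hy : (y : H →L[ℂ] H) = slice (φ x) p p')
    (ξ ξ' : H) (q q' : L2 μ) :
    ⟪(tmul ξ q : H ⊗ʰ L2 μ), φ y (tmul ξ' q')⟫_ℂ =
      ⟪tmul q p, conjBy (fundamentalUnitary μ) (opTensor (sliceLeft (φ x) ξ ξ') 1)
        (tmul q' p')⟫_ℂ := by
  have h1 := hδ.coassoc x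
  set Y := conjBy (opTensor (1 : H →L[ℂ] H) (fundamentalUnitary μ))
    (conjBy (assoc H (L2 μ) (L2 μ)) (opTensor (φ x) (1 : L2 μ →L[ℂ] L2 μ))) with hY
  have hYs : ∀ ξ ξ', sliceLeft Y ξ ξ' =
      conjBy (fundamentalUnitary μ) (opTensor (sliceLeft (φ x) ξ ξ') 1) := fun ξ ξ' => by
    rw [hY, sliceLeft_conjBy_one_opTensor, sliceLeft_conjBy_assoc_opTensor]
  have h2 : amplifyLeft (groupVN μ) (groupCoproduct μ) (φ x) = Y :=
    amplifyLeft_eq fun ξ ξ' => ⟨sliceLeft_mem (hδ.mem_vnTensor x) ξ ξ', hYs ξ ξ'⟩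
  rw [h2] at h1
  have h3 : IsAmplification A φ (φ x) (amplify A φ (φ x)) := by
    -- If `amplify A φ (φ x)` is zero, possibly by default, then coassociativity gives `Γ̂ = 0` on
    -- the slices of `φ x`, so that `φ x = 0` because `Γ̂` is injective.
    by_cases h0 : amplify A φ (φ x) = 0
    · rw [h0, conjBy_zero] at h1
      have h4 : φ x = 0 := by
        refine ext_sliceLeft fun ξ ξ' => ?_
        have h5 := hYs ξ ξ'
        have h6 : sliceLeft (0 : H ⊗ʰ (L2 μ ⊗ʰ L2 μ) →L[ℂ] H ⊗ʰ (L2 μ ⊗ʰ L2 μ)) ξ ξ' = 0 := by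
          rw [sliceLeft, conjBy_zero, slice_zero]
        have h7 : sliceLeft (0 : H ⊗ʰ L2 μ →L[ℂ] H ⊗ʰ L2 μ) ξ ξ' = 0 := by
          rw [sliceLeft, conjBy_zero, slice_zero]
        rw [← h1, h6, ← conjBy_zero (fundamentalUnitary μ)] at h5
        rw [h7]
        exact eq_zero_of_opTensor_one
          (conjBy_injective adjoint_mul_fundamentalUnitary h5.symm)
      rw [h0, h4]
      exact isAmplification_zero (map_zero φ)
    · exact isAmplification_of_ne_zero h0
  obtain ⟨_, h4⟩ := h3 p p'
  have h5 : φ y = slice (amplify A φ (φ x)) p p' := by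
    rw [h4]
    exact congrArg φ (Subtype.ext hy)
  rw [h5, inner_slice, ← hYs, ← h1, inner_sliceLeft, inner_conjBy, adjoint_assoc_tmul,
    adjoint_assoc_tmul]

/-- The coefficients of `β_g` at a slice of `δ(x)`. -/
theorem inner_twist (hδ : IsCoaction A (groupVN μ) (groupCoproduct μ) φ)
    (hcov : IsCovariant μ A α φ) (g : G)
    (x y : A.toStarSubalgebra) {p p' : L2 μ} (hy : (y : H →L[ℂ] H) = slice (φ x) p p')
    (ξ ξ' : H) (q q' : L2 μ) :
    ⟪(tmul ξ q : H ⊗ʰ L2 μ), twist φ α g y (tmul ξ' q')⟫_ℂ =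
      ⟪tmul q p, conjBy (fundamentalUnitary μ) (opTensor (sliceLeft (twist φ α g x) ξ ξ') 1)
        (tmul q' p')⟫_ℂ := by
  have h1 : (α g y : H →L[ℂ] H) = slice (φ (α g x)) (leftReg μ g p) (leftReg μ g p') := by
    have h2 := slice_twist hδ.mem_vnTensor hcov g x p p'
    have h3 : (⟨slice (φ x) p p', slice_mem (hδ.mem_vnTensor x) p p'⟩ : A.toStarSubalgebra) = y :=
      Subtype.ext hy.symm
    rw [h3, twist_apply, slice_conjBy_one_opTensor, isUnitaryRep_leftReg.adjoint_eq, inv_inv] at h2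
    exact h2.symm
  rw [twist_apply, inner_conjBy, adjoint_opTensor, opTensor_tmul, opTensor_tmul, adjoint_one_eq,
    one_apply_eq_self, one_apply_eq_self, isUnitaryRep_leftReg.adjoint_eq, inv_inv,
    inner_coaction hδ (α g x) (α g y) h1, twist_apply, sliceLeft_conjBy_one_opTensor,
    conjBy_fundamentalUnitary_conjBy, inner_conjBy (opTensor (leftReg μ g⁻¹) (leftReg μ g⁻¹)),
    adjoint_opTensor, opTensor_tmul, opTensor_tmul, isUnitaryRep_leftReg.adjoint_eq, inv_inv]

end Twist

end

/-! ### The coaction of the dual of the quantum double -/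

section

variable {G : Type*} [Group G] [TopologicalSpace G] [IsTopologicalGroup G] [LocallyCompactSpace G]
  [MeasurableSpace G] [BorelSpace G] {μ : Measure G} [μ.IsHaarMeasure] [μ.Regular]
  {H K H' : Type*} [NormedAddCommGroup H] [InnerProductSpace ℂ H] [CompleteSpace H]
  [NormedAddCommGroup K] [InnerProductSpace ℂ K] [CompleteSpace K]
  [NormedAddCommGroup H'] [InnerProductSpace ℂ H'] [CompleteSpace H']
  {A : VonNeumannAlgebra H}

/-- Stated for semilinear maps with respect to an arbitrary function `σ`, so as to cover linear and
conjugate linear maps. -/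
theorem Total.eq_zero_of_bounded {E : Type*} [NormedAddCommGroup E] [NormedSpace ℂ E] {S : Set K}
    (hS : Total S) {f : K → E} {σ : ℂ → ℂ} (hadd : ∀ x y, f (x + y) = f x + f y)
    (hsmul : ∀ (c : ℂ) x, f (c • x) = σ c • f x) {C : ℝ} (hC : ∀ x, ‖f x‖ ≤ C * ‖x‖)
    (h : ∀ x ∈ S, f x = 0) (x : K) : f x = 0 := by
  have h0 : f 0 = 0 := norm_le_zero_iff.1 (by simpa using hC 0)
  let N : Submodule ℂ K :=
    { carrier := {x | f x = 0}
      add_mem' := fun {a b} ha hb => by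
        rw [Set.mem_ofPred] at ha hb ⊢
        rw [hadd, ha, hb, add_zero]
      zero_mem' := h0
      smul_mem' := fun c a ha => by
        rw [Set.mem_ofPred] at ha ⊢
        rw [hsmul, ha, smul_zero] }
  have hc : Continuous f :=
    AddMonoidHomClass.continuous_of_bound (AddMonoidHom.mk' f hadd) C hC
  exact hS.mem_of_isClosed N (isClosed_eq hc continuous_const) h x

/-- For a *-homomorphism, the slice equations of an amplification need only be checked on total
sets of vectors. -/
theorem isAmplification_of_total {M : VonNeumannAlgebra H}
    {φ : M.toStarSubalgebra →⋆ₐ[ℂ] (H' →L[ℂ] H')} {X : H ⊗ʰ K →L[ℂ] H ⊗ʰ K}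
    {Y : H' ⊗ʰ K →L[ℂ] H' ⊗ʰ K} (hX : ∀ ζ η, slice X ζ η ∈ M.toStarSubalgebra)
    {S T : Set K} (hS : Total S) (hT : Total T)
    (h : ∀ ζ ∈ S, ∀ η ∈ T, slice Y ζ η = φ ⟨slice X ζ η, hX ζ η⟩) : IsAmplification M φ X Y := by
  set d : K → K → (H' →L[ℂ] H') := fun ζ η => slice Y ζ η - φ ⟨slice X ζ η, hX ζ η⟩ with hd
  have hb : ∀ ζ η, ‖d ζ η‖ ≤ ‖ζ‖ * (‖Y‖ + ‖X‖) * ‖η‖ := fun ζ η => by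
    have h1 : ‖φ ⟨slice X ζ η, hX ζ η⟩‖ ≤ ‖ζ‖ * ‖X‖ * ‖η‖ :=
      (norm_starAlgHom_le φ _).trans (norm_slice_le X ζ η)
    calc ‖d ζ η‖ ≤ ‖slice Y ζ η‖ + ‖φ ⟨slice X ζ η, hX ζ η⟩‖ := norm_sub_le _ _
      _ ≤ ‖ζ‖ * ‖Y‖ * ‖η‖ + ‖ζ‖ * ‖X‖ * ‖η‖ := add_le_add (norm_slice_le Y ζ η) h1
      _ = _ := by ring
  have hl1 : ∀ ζ ζ' η, d (ζ + ζ') η = d ζ η + d ζ' η := fun ζ ζ' η => by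
    have e : φ ⟨slice X (ζ + ζ') η, hX _ _⟩ =
        φ ⟨slice X ζ η, hX _ _⟩ + φ ⟨slice X ζ' η, hX _ _⟩ := by
      rw [← map_add]; exact congrArg φ (Subtype.ext (slice_add_left X ζ ζ' η))
    simp only [hd]
    rw [e, slice_add_left, add_sub_add_comm]
  have hl2 : ∀ (c : ℂ) ζ η, d (c • ζ) η = (starRingEnd ℂ) c • d ζ η := fun c ζ η => by
    have e : φ ⟨slice X (c • ζ) η, hX _ _⟩ = (starRingEnd ℂ) c • φ ⟨slice X ζ η, hX _ _⟩ := by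
      rw [← map_smul]; exact congrArg φ (Subtype.ext (slice_smul_left X c ζ η))
    simp only [hd]
    rw [e, slice_smul_left, smul_sub]
  have hr1 : ∀ ζ η η', d ζ (η + η') = d ζ η + d ζ η' := fun ζ η η' => by
    have e : φ ⟨slice X ζ (η + η'), hX _ _⟩ =
        φ ⟨slice X ζ η, hX _ _⟩ + φ ⟨slice X ζ η', hX _ _⟩ := by
      rw [← map_add]; exact congrArg φ (Subtype.ext (slice_add_right X ζ η η'))
    simp only [hd]
    rw [e, slice_add_right, add_sub_add_comm]
  have hr2 : ∀ (c : ℂ) ζ η, d ζ (c • η) = c • d ζ η := fun c ζ η => by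
    have e : φ ⟨slice X ζ (c • η), hX _ _⟩ = c • φ ⟨slice X ζ η, hX _ _⟩ := by
      rw [← map_smul]; exact congrArg φ (Subtype.ext (slice_smul_right X c ζ η))
    simp only [hd]
    rw [e, slice_smul_right, smul_sub]
  have hS0 : ∀ ζ, ∀ η ∈ T, d ζ η = 0 := fun ζ η hη =>
    hS.eq_zero_of_bounded (f := fun ζ => d ζ η) (fun x y => hl1 x y η) (fun c x => hl2 c x η)
      (C := (‖Y‖ + ‖X‖) * ‖η‖) (fun x => (hb x η).trans (le_of_eq (by ring)))
      (fun ζ hζ => sub_eq_zero.2 (h ζ hζ η hη)) ζ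
  have h0 : ∀ ζ η, d ζ η = 0 := fun ζ η =>
    hT.eq_zero_of_bounded (f := d ζ) (σ := id) (hr1 ζ) (fun c x => hr2 c ζ x) (hb ζ) (hS0 ζ) η
  exact fun ζ η => ⟨hX ζ η, sub_eq_zero.1 (h0 ζ η)⟩

theorem IsWeakCont.sliceLeft {F : G → (H ⊗ʰ K →L[ℂ] H ⊗ʰ K)} (hF : IsWeakCont F) (ξ ξ' : H) :
    IsWeakCont fun g => sliceLeft (F g) ξ ξ' where
  bdd := by
    obtain ⟨C, hC⟩ := (hF.conjBy (flip H K)).bdd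
    exact ⟨‖ξ‖ * C * ‖ξ'‖, fun g => (norm_slice_le _ _ _).trans (by gcongr; exact hC g)⟩
  cont y y' := by simpa only [inner_sliceLeft] using hF.cont _ _

theorem IsWeakCont.slice {F : G → (H ⊗ʰ K →L[ℂ] H ⊗ʰ K)} (hF : IsWeakCont F) (ζ η : K) :
    IsWeakCont fun g => slice (F g) ζ η where
  bdd := by
    obtain ⟨C, hC⟩ := hF.bdd
    exact ⟨‖ζ‖ * C * ‖η‖, fun g => (norm_slice_le _ _ _).trans (by gcongr; exact hC g)⟩
  cont y y' := by simpa only [inner_slice] using hF.cont _ _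

/-- The coefficients of a decomposable operator on `L²(G, H ⊗ K)`, regarded as an operator on
`H ⊗ (K ⊗ L²(G))`. -/
theorem IsWeakCont.inner_conjBy_assoc_decomposable {F : G → (H ⊗ʰ K →L[ℂ] H ⊗ʰ K)}
    (hF : IsWeakCont F) (x x' : H) (y y' : K) (f k : L2 μ) :
    ⟪(tmul x (tmul y f) : H ⊗ʰ (K ⊗ʰ L2 μ)), DualDouble.conjBy (assoc H K (L2 μ)) (decomposable μ F)
      (tmul x' (tmul y' k))⟫_ℂ =
      ∫ g, starRingEnd ℂ (f g) * k g * ⟪tmul x y, F g (tmul x' y')⟫_ℂ ∂μ := by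
  rw [inner_conjBy, adjoint_assoc_tmul, adjoint_assoc_tmul, hF.isBddMeas.isDecomposed]

theorem IsWeakCont.sliceLeft_conjBy_assoc_decomposable {F : G → (H ⊗ʰ K →L[ℂ] H ⊗ʰ K)}
    (hF : IsWeakCont F) (ξ ξ' : H) :
    DualDouble.sliceLeft (DualDouble.conjBy (assoc H K (L2 μ)) (decomposable μ F)) ξ ξ' =
      decomposable μ fun g => DualDouble.sliceLeft (F g) ξ ξ' :=
  clm_ext_inner_tmul fun y f y' k => by
    rw [inner_sliceLeft, hF.inner_conjBy_assoc_decomposable,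
      (hF.sliceLeft ξ ξ').isBddMeas.isDecomposed]
    simp only [inner_sliceLeft]

theorem IsWeakCont.slice_conjBy_assoc_decomposable {F : G → (H ⊗ʰ K →L[ℂ] H ⊗ʰ K)}
    (hF : IsWeakCont F) (p q : K) (f k : L2 μ) :
    DualDouble.slice (DualDouble.conjBy (assoc H K (L2 μ)) (decomposable μ F)) (tmul p f) (tmul q k) =
      DualDouble.slice (decomposable μ fun g => DualDouble.slice (F g) p q) f k :=
  clm_ext_inner fun x y => by
    rw [inner_slice, hF.inner_conjBy_assoc_decomposable,
      (hF.slice p q).isBddMeas.slice_decomposable_eq]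
    simp only [inner_slice]

/-- The space `L²(G)` is nontrivial, because the operators on `ℂ ⊗ L²(G)` given by the constants
`1` and `0` differ. -/
theorem exists_ne_zero (μ : Measure G) [μ.IsHaarMeasure] [μ.Regular] : ∃ f : L2 μ, f ≠ 0 := by
  by_contra! h
  have h1 : (fun _ : G => (1 : ℂ →L[ℂ] ℂ)) = fun _ => 0 :=
    (isStrongCont_const (G := G) (1 : ℂ →L[ℂ] ℂ)).isWeakCont.decomposable_injective (μ := μ)
      (isStrongCont_const (0 : ℂ →L[ℂ] ℂ)).isWeakCont
      (clm_ext_inner_tmul fun x f y k => by rw [h f, h k]; simp [tmul])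
  have h2 := congrArg (fun T : ℂ →L[ℂ] ℂ => T 1) (congrFun h1 1)
  simp at h2

section Double

variable {φ : A.toStarSubalgebra →⋆ₐ[ℂ] (H ⊗ʰ L2 μ →L[ℂ] H ⊗ʰ L2 μ)}
  {α : G →* (A.toStarSubalgebra ≃⋆ₐ[ℂ] A.toStarSubalgebra)}

theorem isStrongCont_twist (hφ : IsNormal A φ) (hα : IsContinuousAction A α)
    (x : A.toStarSubalgebra) : IsStrongCont fun g => twist φ α g x :=
  isStrongCont_of_starAlgHom (continuous_twist hφ hα) x

/-- `Δ(x)` is the decomposable operator given by the function `g ↦ β_g(x)`. -/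
theorem doubleMap_eq (hφ : IsNormal A φ) (hm : ∀ x, φ x ∈ vnTensor A (groupVN μ))
    (hα : IsContinuousAction A α) (hcov : IsCovariant μ A α φ) (x : A.toStarSubalgebra) :
    doubleMap μ A α φ x =
      conjBy (assoc H (L2 μ) (L2 μ)) (decomposable μ fun g => twist φ α g x) := by
  have hb := (isStrongCont_twist hφ hα x).isWeakCont
  have h1 : IsAmplification A (actionHom μ A α) (φ x)
      (conjBy (swapRight H (L2 μ) (L2 μ)) (decomposable μ fun g => twist φ α g x)) := fun ζ η => by
    refine ⟨slice_mem (hm x) ζ η, clm_ext_inner_tmul fun y f y' k => ?_⟩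
    rw [inner_slice, inner_conjBy, adjoint_swapRight, swapRight_tmul, swapRight_tmul,
      hb.isBddMeas.isDecomposed, actionHom,
      (isStrongCont_action hα _).isBddMeas.isDecomposed]
    refine integral_congr_ae (.of_forall fun g => ?_)
    dsimp only
    rw [← slice_twist hm hcov, inner_slice]
  rw [doubleMap, h1.amplify_eq, conjBy_conjBy, conjBy_conjBy]
  congr 1
  refine ContinuousLinearMap.ext_on
    (((total_univ (E := H)).tmul (total_univ (E := L2 μ))).tmul (total_univ (E := L2 μ))) ?_
  rintro _ ⟨_, ⟨a, -, b, -, rfl⟩, c, -, rfl⟩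
  simp [swapRight_tmul, assoc_tmul, opTensor_tmul, flip_tmul]

theorem exists_starAlgHom_doubleMap (hφ : IsNormal A φ) (hm : ∀ x, φ x ∈ vnTensor A (groupVN μ))
    (hα : IsContinuousAction A α) (hcov : IsCovariant μ A α φ) :
    ∃ Φ : A.toStarSubalgebra →⋆ₐ[ℂ] (H ⊗ʰ (L2 μ ⊗ʰ L2 μ) →L[ℂ] H ⊗ʰ (L2 μ ⊗ʰ L2 μ)),
      ∀ x, Φ x = doubleMap μ A α φ x := by
  obtain ⟨Ψ, hΨ⟩ := exists_starAlgHom_decomposable (μ := μ) (continuous_twist hφ hα)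
  refine ⟨(conjHom (assoc H (L2 μ) (L2 μ)) adjoint_assoc_comp_assoc
    assoc_comp_adjoint_assoc).comp Ψ, fun x => ?_⟩
  rw [doubleMap_eq hφ hm hα hcov, ← hΨ]
  rfl

theorem doubleMap_mem (hφ : IsNormal A φ) (hm : ∀ x, φ x ∈ vnTensor A (groupVN μ))
    (hα : IsContinuousAction A α) (hcov : IsCovariant μ A α φ) (x : A.toStarSubalgebra) :
    doubleMap μ A α φ x ∈ vnTensor A (dualDouble μ) := by
  rw [doubleMap_eq hφ hm hα hcov]
  exact conjBy_assoc_mem ((isStrongCont_twist hφ hα x).decomposable_mem fun g => twist_mem hm g x)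

theorem isNormal_doubleMap (hφ : IsNormal A φ) (hm : ∀ x, φ x ∈ vnTensor A (groupVN μ))
    (hα : IsContinuousAction A α) (hcov : IsCovariant μ A α φ) :
    IsNormal A (doubleMap μ A α φ) := by
  have h1 := (isNormal_decomposable (μ := μ) (continuous_twist hφ hα)
    (isNormal_twist hφ)).conjBy (assoc H (L2 μ) (L2 μ))
  have h2 : doubleMap μ A α φ = _ := funext (doubleMap_eq hφ hm hα hcov)
  rw [h2]
  exact h1

theorem inner_twist_mul_adjoint_leftReg (s t : G) (y : A.toStarSubalgebra) (ξ ξ' : H)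
    (p p' : L2 μ) :
    ⟪(tmul ξ (adjoint (leftReg μ t) p) : H ⊗ʰ L2 μ), twist φ α (s * t) y
      (tmul ξ' (adjoint (leftReg μ t) p'))⟫_ℂ =
      ⟪(tmul ξ p : H ⊗ʰ L2 μ), twist φ α s (α t y) (tmul ξ' p')⟫_ℂ := by
  rw [twist_comp, inner_conjBy, adjoint_opTensor, opTensor_tmul, opTensor_tmul, adjoint_one_eq,
    one_apply_eq_self, one_apply_eq_self]

/-- The coassociativity of `Δ`. Both sides have the coefficients
`∫ ∫ f₂(t)* k₂(t) f₁(s)* k₁(s) ⟪ξ ⊗ p₁, β_s(α_t(y)) (ξ' ⊗ p₁')⟫ ds dt`, where `y` is the slice of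
`δ(x)` by `p₂` and `p₂'`. -/
theorem doubleMap_coassoc (hδ : IsCoaction A (groupVN μ) (groupCoproduct μ) φ)
    (hα : IsContinuousAction A α) (hcov : IsCovariant μ A α φ) (x : A.toStarSubalgebra) :
    conjBy (assoc H (L2 μ ⊗ʰ L2 μ) (L2 μ ⊗ʰ L2 μ))
        (amplify A (doubleMap μ A α φ) (doubleMap μ A α φ x)) =
      amplifyLeft (dualDouble μ) (dualDoubleCoproduct μ) (doubleMap μ A α φ x) := by
  have hφ := hδ.isNormal
  have hm := hδ.mem_vnTensor
  have hmem := doubleMap_mem hφ hm hα hcov x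
  have hβ := fun z => (isStrongCont_twist hφ hα z).isWeakCont
  obtain ⟨Φ, hΦ⟩ := exists_starAlgHom_doubleMap hφ hm hα hcov
  have hΦ' : ⇑Φ = doubleMap μ A α φ := funext hΦ
  have hΦn : IsNormal A Φ := hΦ' ▸ isNormal_doubleMap hφ hm hα hcov
  have heq := doubleMap_eq hφ hm hα hcov
  obtain ⟨Y, hY⟩ := exists_sliceLeft_doubleCoproduct (doubleMap μ A α φ x)
  have h1 : amplifyLeft (dualDouble μ) (dualDoubleCoproduct μ) (doubleMap μ A α φ x) = Y :=
    amplifyLeft_eq fun ξ ξ' => ⟨sliceLeft_mem hmem ξ ξ', by rw [dualDoubleCoproduct_eq, hY]⟩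
  have hUU := assoc_comp_adjoint_assoc (H := H) (K := L2 μ ⊗ʰ L2 μ) (L := L2 μ ⊗ʰ L2 μ)
  have h2 : IsAmplification A Φ (doubleMap μ A α φ x)
      (conjBy (adjoint (assoc H (L2 μ ⊗ʰ L2 μ) (L2 μ ⊗ʰ L2 μ))) Y) := by
    refine isAmplification_of_total (fun ζ η => slice_mem hmem ζ η)
      ((total_univ (E := L2 μ)).tmul (total_univ (E := L2 μ)))
      ((total_univ (E := L2 μ)).tmul (total_isCc (μ := μ))) ?_
    rintro _ ⟨p₂, -, f₂, -, rfl⟩ _ ⟨p₂', -, k₂, hk₂, rfl⟩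
    set y : A.toStarSubalgebra := ⟨slice (φ x) p₂ p₂', slice_mem (hm x) p₂ p₂'⟩ with hy
    have ha := isStrongCont_action hα y
    have hb : slice (doubleMap μ A α φ x) (tmul p₂ f₂) (tmul p₂' k₂) =
        slice (decomposable μ fun t => (α t y : H →L[ℂ] H)) f₂ k₂ := by
      rw [heq, (hβ x).slice_conjBy_assoc_decomposable]
      simp only [slice_twist hm hcov, hy]
    rw [hΦn.slice_decomposable ha hk₂ hb]
    have hT := (total_univ (E := H)).tmul ((total_univ (E := L2 μ)).tmul (total_univ (E := L2 μ)))
    refine hT.clm_ext hT ?_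
    rintro _ ⟨ξ, -, _, ⟨p₁, -, f₁, -, rfl⟩, rfl⟩ _ ⟨ξ', -, _, ⟨p₁', -, k₁, -, rfl⟩, rfl⟩
    rw [(hΦn.isStrongCont ha).isBddMeas.slice_decomposable_eq, inner_slice, inner_conjBy,
      ContinuousLinearMap.adjoint_adjoint, assoc_tmul, assoc_tmul, ← inner_sliceLeft, hY, heq,
      (hβ x).sliceLeft_conjBy_assoc_decomposable,
      inner_doubleCoproduct ((hβ x).sliceLeft ξ ξ') fun g => sliceLeft_mem (twist_mem hm g x) ξ ξ']
    refine integral_congr_ae (.of_forall fun t => ?_)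
    dsimp only
    rw [hΦ, heq, (hβ _).inner_conjBy_assoc_decomposable]
    congr 1
    refine integral_congr_ae (.of_forall fun s => ?_)
    dsimp only
    rw [← inner_twist_mul_adjoint_leftReg, inner_twist hδ hcov (s * t) x y rfl]
  have h3 := h2.amplify_eq
  rw [hΦ'] at h3
  rw [h1, h3, conjBy_conjBy, hUU, conjBy_id]

theorem isCoaction_doubleMap (hδ : IsCoaction A (groupVN μ) (groupCoproduct μ) φ)
    (hα : IsContinuousAction A α) (hcov : IsCovariant μ A α φ) :
    IsCoaction A (dualDouble μ) (dualDoubleCoproduct μ) (doubleMap μ A α φ) where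
  isStarAlgHom := exists_starAlgHom_doubleMap hδ.isNormal hδ.mem_vnTensor hα hcov
  mem_vnTensor := doubleMap_mem hδ.isNormal hδ.mem_vnTensor hα hcov
  isNormal := isNormal_doubleMap hδ.isNormal hδ.mem_vnTensor hα hcov
  coassoc := doubleMap_coassoc hδ hα hcov

theorem doubleMap_injective (hφ : IsNormal A φ) (hm : ∀ x, φ x ∈ vnTensor A (groupVN μ))
    (hα : IsContinuousAction A α) (hcov : IsCovariant μ A α φ) (hi : Function.Injective φ) :
    Function.Injective (doubleMap μ A α φ) := fun x y hxy => by
  rw [doubleMap_eq hφ hm hα hcov, doubleMap_eq hφ hm hα hcov] at hxy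
  have h1 := (isStrongCont_twist hφ hα x).isWeakCont.decomposable_injective
    (isStrongCont_twist hφ hα y).isWeakCont (conjBy_injective adjoint_assoc_comp_assoc hxy)
  have h2 := congrFun h1 1
  simp only [twist_one] at h2
  exact hi h2

theorem fixedPoints_actionHom (hα : IsContinuousAction A α) :
    fixedPoints A (actionHom μ A α) = {x | ∀ g, α g x = x} := by
  ext x
  constructor
  · intro h g
    have h1 : decomposable μ (fun g => (α g x : H →L[ℂ] H)) =
        decomposable μ fun _ => (x : H →L[ℂ] H) := by
      rw [decomposable_const]; exact h
    exact Subtype.ext (congrFun ((isStrongCont_action hα x).isWeakCont.decomposable_injective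
      (isStrongCont_const _).isWeakCont h1) g)
  · intro h
    change decomposable μ (fun g => (α g x : H →L[ℂ] H)) = opTensor _ 1
    rw [← decomposable_const]
    congr 1
    funext g
    rw [h g]

theorem conjBy_assoc_opTensor_one {L : Type*} [NormedAddCommGroup L] [InnerProductSpace ℂ L]
    [CompleteSpace L] (a : H →L[ℂ] H) :
    conjBy (assoc H K L) (opTensor (opTensor a 1) 1) = opTensor a 1 := by
  refine ext_sliceLeft fun ξ ξ' => ?_
  rw [sliceLeft_conjBy_assoc_opTensor, sliceLeft_opTensor, sliceLeft_opTensor, opTensor_smul_left,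
    opTensor_one]

/-- `x` is fixed by `Δ` if and only if `β_g(x) = x ⊗ 1` for all `g`. -/
theorem mem_fixedPoints_doubleMap_iff (hφ : IsNormal A φ)
    (hm : ∀ x, φ x ∈ vnTensor A (groupVN μ)) (hα : IsContinuousAction A α)
    (hcov : IsCovariant μ A α φ) (x : A.toStarSubalgebra) :
    x ∈ fixedPoints A (doubleMap μ A α φ) ↔
      ∀ g, twist φ α g x = opTensor (x : H →L[ℂ] H) (1 : L2 μ →L[ℂ] L2 μ) := by
  change doubleMap μ A α φ x = opTensor (x : H →L[ℂ] H) 1 ↔ _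
  rw [doubleMap_eq hφ hm hα hcov, ← conjBy_assoc_opTensor_one (K := L2 μ) (L := L2 μ),
    ← decomposable_const,
    (conjBy_injective adjoint_assoc_comp_assoc).eq_iff]
  refine ⟨fun h g => congrFun ((isStrongCont_twist hφ hα x).isWeakCont.decomposable_injective
    (isStrongCont_const _).isWeakCont h) g, fun h => ?_⟩
  congr 1
  exact funext h

theorem fixedPoints_doubleMap (hφ : IsNormal A φ)
    (hm : ∀ x, φ x ∈ vnTensor A (groupVN μ)) (hα : IsContinuousAction A α)
    (hcov : IsCovariant μ A α φ) :
    fixedPoints A (doubleMap μ A α φ) =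
      fixedPoints A (actionHom μ A α) ∩ fixedPoints A φ := by
  ext x
  rw [Set.mem_inter_iff, mem_fixedPoints_doubleMap_iff hφ hm hα hcov, fixedPoints_actionHom hα]
  constructor
  · intro h
    have hx : φ x = opTensor (x : H →L[ℂ] H) 1 := by rw [← twist_one φ α, h]
    refine ⟨fun g => Subtype.ext ?_, hx⟩
    obtain ⟨f, hf⟩ := exists_ne_zero μ
    -- Slicing `β_g(x) = x ⊗ 1` by a vector `f` with itself gives `‖f‖² α_g(x) = ‖f‖² x`.
    have h1 : slice (φ x) f f = ⟪f, f⟫_ℂ • (x : H →L[ℂ] H) := by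
      rw [hx, slice_opTensor, one_apply_eq_self]
    have h2 : (⟨slice (φ x) f f, slice_mem (hm x) f f⟩ : A.toStarSubalgebra) = ⟪f, f⟫_ℂ • x :=
      Subtype.ext h1
    have h3 := slice_twist hm hcov g x f f
    rw [h2, h g, slice_opTensor, one_apply_eq_self, map_smul] at h3
    exact (smul_right_injective _ (inner_self_ne_zero.2 hf) h3).symm
  · rintro ⟨h, hx⟩ g
    have h1 : φ x = opTensor (x : H →L[ℂ] H) 1 := hx
    have h2 : opTensor (1 : H →L[ℂ] H) (leftReg μ g⁻¹) *
        adjoint (opTensor (1 : H →L[ℂ] H) (leftReg μ g⁻¹)) = 1 :=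
      one_opTensor_leftReg_unitary' g
    rw [twist_apply, h g, h1, conjBy_eq_mul, opTensor_mul, one_mul, mul_one]
    calc opTensor (x : H →L[ℂ] H) (leftReg μ g⁻¹) * _
        = opTensor (x : H →L[ℂ] H) 1 * (opTensor (1 : H →L[ℂ] H) (leftReg μ g⁻¹) *
          adjoint (opTensor (1 : H →L[ℂ] H) (leftReg μ g⁻¹))) := by
            rw [← mul_assoc, opTensor_mul, mul_one, one_mul]
      _ = _ := by rw [h2, mul_one]

end Double

end

end

end DualDouble

theorem mainTheorem12
    {G : Type*} [Group G] [TopologicalSpace G] [IsTopologicalGroup G] [LocallyCompactSpace G]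
    [T2Space G] [MeasurableSpace G] [BorelSpace G]
    (μ : MeasureTheory.Measure G) [μ.IsHaarMeasure] [μ.Regular]
    {H : Type*} [NormedAddCommGroup H] [InnerProductSpace ℂ H] [CompleteSpace H]
    (A : VonNeumannAlgebra H)
    (α : G →* (A.toStarSubalgebra ≃⋆ₐ[ℂ] A.toStarSubalgebra))
    (hα : DualDouble.IsContinuousAction A α)
    (δ : A.toStarSubalgebra →
      (DualDouble.HTensor H (DualDouble.L2 μ) →L[ℂ] DualDouble.HTensor H (DualDouble.L2 μ)))
    (hδ : DualDouble.IsCoaction A (DualDouble.groupVN μ) (DualDouble.groupCoproduct μ) δ)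
    (hcov : DualDouble.IsCovariant μ A α δ) :
    DualDouble.IsCoaction A (DualDouble.dualDouble μ) (DualDouble.dualDoubleCoproduct μ)
        (DualDouble.doubleMap μ A α δ) ∧
      (Function.Injective δ → Function.Injective (DualDouble.doubleMap μ A α δ)) ∧
      DualDouble.fixedPoints A (DualDouble.doubleMap μ A α δ) =
        DualDouble.fixedPoints A (DualDouble.actionHom μ A α) ∩ DualDouble.fixedPoints A δ ∧
      DualDouble.fixedPoints A (DualDouble.actionHom μ A α) = {x | ∀ g, α g x = x} := by
  obtain ⟨φ, hφ⟩ := hδ.isStarAlgHom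
  obtain rfl : ⇑φ = δ := funext hφ
  have hn := hδ.isNormal
  have hm := hδ.mem_vnTensor
  exact ⟨DualDouble.isCoaction_doubleMap hδ hα hcov, DualDouble.doubleMap_injective hn hm hα hcov,
    DualDouble.fixedPoints_doubleMap hn hm hα hcov, DualDouble.fixedPoints_actionHom hα⟩
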